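/- Let $n\ge 2$. For integers $a,b$ write $[a,b]=\{k\in\mathbb Z: a\le k\le b\}$ (empty if $a>b$). Let $\mathcal D_n$ be the group of bijections $\sigma$ of $\{\pm1,\dots,\pm n\}$ with $\sigma(-i)=-\sigma(i)$ for all $i$ and with an even number of negative values among $\sigma(1),\dots,\sigma(n)$; it is the Weyl group of type $D_n$ with Coxeter generators $s_0=(1,-2)(2,-1)$ and $s_i=(i,i+1)(-i,-(i+1))$ for $1\le i\le n-1$. It acts on the root system $\Phi=\{\pm(e_i\pm e_j): 1\le i<j\le n\}$ by $\sigma(e_i)=e_{\sigma(i)}$, where $e_{-k}=-e_k$. The simple roots are $e_1+e_2$ and $e_{i+1}-e_i$ ($1\le i\le n-1$), and $\Phi^+$ is the set of positive roots (nonnegative combinations of simple roots). The height of a root is the sum of its coefficients in the simple roots. For $w\in\mathcal D_n$ let the length $\ell(w)$ be the number of $\alpha\in\Phi^+$ with $w(\alpha)\in-\Phi^+$, and let the odd length $L(w)$ be the number of $\alpha\in\Phi^+$ of odd height with $w(\alpha)\in-\Phi^+$. For $I\subseteq[0,n-1]$ put $$\mathcal D_n^I=\{w\in\mathcal D_n:\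 \ell(ws_i)>\ell(w)\text{ for all } i\in I\},\qquad \mathcal D_n^I(x)=\sum_{w\in\mathcal D_n^I}(-1)^{\ell(w)}x^{L(w)}.$$ The connected components of $I\subseteq[0,n-1]$ are its maximal nonempty subintervals $[a,b]$. Let $I_0$ be the component containing $0$, with $I_0=\emptyset$ if $0\notin I$, and let $I_1,\dots,I_s$ be the other components. Put $$m_I=\sum_{k=0}^s\left\lfloor\frac{|I_k|+1}{2}\right\rfloor,\qquad C_I=\frac{[m_I]_{q}!}{\prod_{k=0}^s\left[\left\lfloor\frac{|I_k|+1}{2}\right\rfloor\right]_{q}!}\ \text{ with } q=x^2,$$ where $[r]_q!=\prod_{i=1}^r\frac{1-q^i}{1-q}$ and $[0]_q!=1$. Let $\widetilde I=I$ if $I_0=\emptyset$, and $\widetilde I=(I\setminus\{0\})\cup\{1\}$ otherwise. A product $\prod_{i=a}^n$ with $n<a$ equals $1$. **Theorem.** Let $n\ge2$ and let $I$ be a proper subset of $[0,n-1]$. Then $$\mathcal D_n^I(x)=f(x)\,C_{\widetilde I}\prod_{i=2\left\lfloor\frac{|I_0|+2}{2}\right\rfloor}^{n}\left(1+(-1)^{i-1}x^{\lfloor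 i/2\rfloor}\right)\prod_{j=2m_{\widetilde I}+2}^{n}\left(1+(-1)^{j-1}x^{\lfloor j/2\rfloor}\right),$$ where $$f(x)=\begin{cases}\dfrac{1+x^{|I_0|}+2x^{m_I}}{1+x^{m_I}}&\text{if } |I_0|\ge2,\ |I_0|\text{ is even and } n=2m_I,\\[2mm] 1+x^{|I_0|}&\text{if } |I_0|\ge2,\ |I_0|\text{ is even and } n>2m_I,\\ 1&\text{otherwise.}\end{cases}$$ The identity holds in the field of rational functions in $x$. -/

import Mathlib

namespace OddLengthD

noncomputable section

/-! ### The root system of type `D_n` -/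

/-- The vector `e_k` of the lattice with basis `e_1, e_2, …`, for a signed index `k`:
`e_{-k} = -e_k`. -/
def e (k : ℤ) : ℕ →₀ ℤ := Finsupp.single k.natAbs k.sign

/-- The roots `±(e_i ± e_j)`, `1 ≤ i < j ≤ n`. -/
def roots (n : ℕ) : Finset (ℕ →₀ ℤ) :=
  ((Finset.Icc 1 n ×ˢ Finset.Icc 1 n).filter (fun p => p.1 < p.2)).biUnion
    (fun p => {e p.1 + e p.2, -(e p.1 + e p.2), e p.1 - e p.2, -(e p.1 - e p.2)})

/-- The simple roots: `e_1 + e_2` (index `0`) and `e_{i+1} - e_i` (index `i ≥ 1`). Those of type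
`D_n` are the ones with index in `[0, n-1]`. -/
def simpleRoot (i : ℕ) : ℕ →₀ ℤ :=
  if i = 0 then e 1 + e 2 else e (i + 1) - e i

open Classical in
/-- The positive roots: the roots that are nonnegative combinations of simple roots. -/
def posRoots (n : ℕ) : Finset (ℕ →₀ ℤ) :=
  (roots n).filter fun α =>
    ∃ c : ℕ → ℕ, α = ∑ k ∈ Finset.range n, c k • simpleRoot k

/-- `α = ∑ c_k α_k` in terms of the simple roots `α_k`, with `∑ c_k = h`. -/
def HasHeight (n : ℕ) (α : ℕ →₀ ℤ) (h : ℤ) : Prop :=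
  ∃ c : ℕ → ℤ, α = ∑ k ∈ Finset.range n, c k • simpleRoot k ∧ ∑ k ∈ Finset.range n, c k = h

/-- The height is well defined. -/
theorem HasHeight.unique {n : ℕ} {α : ℕ →₀ ℤ} {h h' : ℤ} (H : HasHeight n α h)
    (H' : HasHeight n α h') : h = h' := by
  have key : ∀ {h : ℤ}, HasHeight n α h →
      h = Finsupp.linearCombination ℤ (fun i : ℕ => (i : ℤ) - 1) α := by
    rintro h ⟨c, rfl, rfl⟩
    rw [map_sum]
    refine Finset.sum_congr rfl fun k _ => ?_
    rw [map_smul]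
    have h1 : ∀ m : ℕ, 0 < m → (m : ℤ).sign = 1 := fun m hm =>
      Int.sign_eq_one_of_pos (by exact_mod_cast hm)
    rcases Nat.eq_zero_or_pos k with rfl | hk
    · simp [simpleRoot, e, Finsupp.linearCombination_single, show Int.sign 2 = 1 from rfl]
    · have h2 : ((k : ℤ) + 1).natAbs = k + 1 := by omega
      have h3 : ((k : ℤ) + 1).sign = 1 := Int.sign_eq_one_of_pos (by omega)
      simp [simpleRoot, e, hk.ne', h1 k hk, h2, h3, Finsupp.linearCombination_single]
  rw [key H, key H']

/-! ### The even hyperoctahedral group and its statistics -/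

/-- The even hyperoctahedral group `𝒟_n`. A signed permutation of degree `n` is an odd bijection of
`{±1, …, ±n}`; it is extended to `ℤ` by fixing `0` and all `k` with `|k| > n`. It lies in `𝒟_n` if
an even number of `σ(1), …, σ(n)` are negative. -/
def evenSignedPerm (n : ℕ) : Set (Equiv.Perm ℤ) :=
  {σ | (∀ k, σ (-k) = -σ k) ∧ (∀ k : ℤ, (n : ℤ) < |k| → σ k = k) ∧
    Even ((Finset.Icc (1 : ℤ) n).filter (fun k => σ k < 0)).card}

/-- The Coxeter generators `s_0 = (1, -2)(2, -1)` and `s_i = (i, i+1)(-i, -(i+1))`, `i ≥ 1`. -/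
def gen (i : ℕ) : Equiv.Perm ℤ :=
  if i = 0 then Equiv.swap 1 (-2) * Equiv.swap 2 (-1)
  else Equiv.swap (i : ℤ) (i + 1) * Equiv.swap (-(i : ℤ)) (-(i + 1))

/-- The linear action of a signed permutation, `e_i ↦ e_{σ(i)}`. -/
def act (σ : Equiv.Perm ℤ) : (ℕ →₀ ℤ) →ₗ[ℤ] (ℕ →₀ ℤ) :=
  Finsupp.linearCombination ℤ (fun i : ℕ => e (σ i))

open Classical in
/-- The Coxeter length `ℓ`: the number of positive roots sent to negative roots. -/
def len (n : ℕ) (σ : Equiv.Perm ℤ) : ℕ :=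
  ((posRoots n).filter fun α => -(act σ α) ∈ posRoots n).card

open Classical in
/-- The odd length `L`: the number of positive roots of odd height sent to negative roots. -/
def oddLen (n : ℕ) (σ : Equiv.Perm ℤ) : ℕ :=
  ((posRoots n).filter fun α =>
    (∃ h, HasHeight n α h ∧ Odd h) ∧ -(act σ α) ∈ posRoots n).card

/-- The parabolic quotient `𝒟_n^I`, where `i ∈ [0, n-1]` stands for the generator `s_i`. -/
def quotient (n : ℕ) (I : Finset ℕ) : Set (Equiv.Perm ℤ) :=
  {σ | σ ∈ evenSignedPerm n ∧ ∀ i ∈ I, len n σ < len n (σ * gen i)}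

theorem finite_evenSignedPerm (n : ℕ) : (evenSignedPerm n).Finite := by
  have hmem : ∀ σ ∈ evenSignedPerm n, ∀ k ∈ Set.Icc (-(n : ℤ)) n, σ k ∈ Set.Icc (-(n : ℤ)) n := by
    rintro σ ⟨_, hfix, _⟩ k hk
    by_contra hcon
    have h1 : (n : ℤ) < |σ k| := by
      rw [← not_le, abs_le]; exact hcon
    have h2 : σ k = k := σ.injective (hfix _ h1)
    rw [h2] at hcon
    exact hcon hk
  refine Set.Finite.of_finite_image
    (f := fun σ : Equiv.Perm ℤ => fun k : Set.Icc (-(n : ℤ)) n => σ k) ?_ ?_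
  · refine Set.Finite.subset (Set.Finite.pi' (ι := Set.Icc (-(n : ℤ)) n)
      (t := fun _ => Set.Icc (-(n : ℤ)) n) (fun _ => Set.finite_Icc _ _)) ?_
    rintro _ ⟨σ, hσ, rfl⟩ k
    exact hmem σ hσ k k.2
  · intro σ hσ τ hτ h
    ext k
    by_cases hk : k ∈ Set.Icc (-(n : ℤ)) n
    · exact congrFun h ⟨k, hk⟩
    · have h1 : (n : ℤ) < |k| := by
        rw [← not_le, abs_le]; exact hk
      rw [hσ.2.1 k h1, hτ.2.1 k h1]

theorem finite_quotient (n : ℕ) (I : Finset ℕ) : (quotient n I).Finite :=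
  (finite_evenSignedPerm n).subset fun _ h => h.1

/-- The sign-twisted generating function
`𝒟_n^I(x) = ∑_{w ∈ 𝒟_n^I} (-1)^{ℓ(w)} x^{L(w)}`. -/
def signTwistedGF (n : ℕ) (I : Finset ℕ) : Polynomial ℤ :=
  ∑ σ ∈ (finite_quotient n I).toFinset, (-1) ^ len n σ * Polynomial.X ^ oddLen n σ

/-! ### Connected components and multinomial coefficients -/

/-- The connected component `I_0` of `I` containing `0`; it is empty if `0 ∉ I`. -/
def zeroComponent (I : Finset ℕ) : Finset ℕ :=
  I.filter fun k => Finset.Icc 0 k ⊆ I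

open Classical in
/-- The nonempty connected components of `I`: the maximal intervals `[a, b] ⊆ I`. (An empty `I_0`
contributes neither to `m_I` nor to `C_I`.) -/
def components (I : Finset ℕ) : Finset (Finset ℕ) :=
  I.powerset.filter fun J =>
    ∃ a b, a ≤ b ∧ J = Finset.Icc a b ∧ b + 1 ∉ I ∧ ∀ c, c + 1 = a → c ∉ I

/-- `m_I = ∑_k ⌊(|I_k| + 1) / 2⌋`. -/
def m (I : Finset ℕ) : ℕ := ∑ J ∈ components I, (J.card + 1) / 2

variable {K : Type*} [Field K]

/-- `[n]_q = (1 - q^n) / (1 - q)`. -/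
def qNumber (q : K) (n : ℕ) : K := (1 - q ^ n) / (1 - q)

/-- `[n]_q! = [1]_q [2]_q ⋯ [n]_q`. -/
def qFactorial (q : K) (n : ℕ) : K := ∏ i ∈ Finset.Icc 1 n, qNumber q i

/-- `C_I`: the multinomial coefficient of `m_I` over the `⌊(|I_k| + 1) / 2⌋`, with parameter
`x ^ 2`. -/
def C (x : K) (I : Finset ℕ) : K :=
  qFactorial (x ^ 2) (m I) / ∏ J ∈ components I, qFactorial (x ^ 2) ((J.card + 1) / 2)

/-- `Ĩ = I` if `I_0 = ∅`, and `Ĩ = (I ∖ {0}) ∪ {1}` otherwise. -/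
def tilde (I : Finset ℕ) : Finset ℕ :=
  if zeroComponent I = ∅ then I else I.erase 0 ∪ {1}

/-- The product `∏_{i=a}^n (1 + (-1)^{i-1} x^{⌊i/2⌋})` (for `a ≥ 1`), equal to `1` if `n < a`. -/
def signedProd (x : K) (a n : ℕ) : K :=
  ∏ i ∈ Finset.Icc a n, (1 + (-1) ^ (i - 1) * x ^ (i / 2))

/-- The factor `f(x)`. -/
def f (x : K) (n : ℕ) (I : Finset ℕ) : K :=
  if 2 ≤ (zeroComponent I).card ∧ Even (zeroComponent I).card ∧ n = 2 * m I then
    (1 + x ^ (zeroComponent I).card + 2 * x ^ m I) / (1 + x ^ m I)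
  else if 2 ≤ (zeroComponent I).card ∧ Even (zeroComponent I).card ∧ 2 * m I < n then
    1 + x ^ (zeroComponent I).card
  else 1

end

end OddLengthD

/-!
The positive roots are `e_j ± e_i` with `i < j`, and a signed permutation `σ` makes `e_j - e_i`
negative if `σ j < σ i`, and `e_i + e_j` negative if `σ i + σ j < 0`; the root has odd height if and
only if `i` and `j` have opposite parities (`len_eq_sum`, `oddLen_eq_sum`). The elements of the
parabolic quotient are those whose word `σ 1, …, σ n` satisfies the ascent conditions indexed by
`I`. Changing the sign of the value `±1` shows that twice the generating function is the sum of
`(-1)^ℓ x^L` over all signed words that satisfy them (`two_mul_sum_quotient`), and this sum is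
computed by removing the largest absolute value again and again (`signedSum`).

The sign makes most of this sum cancel. If two values adjacent in size stand at positions of equal
parity, then exchanging them changes the sign of the contribution and keeps the odd length. So, in
the unsigned problem, only the arrangements survive in which the positions of the values `1, 2, …`
alternate in parity; their sum is `altSum`, and the two cancellations that matter are
`altSum_top_cancel` and `altSum_bot_cancel`.

Let `a` be the smallest element missing from `I`. The positions `1, …, a` form a block whose values
are ruled by all the ascent conditions among them, so that the largest absolute value can stand in
the block only at its end. So the signed sum is a combination of the two alternating
sums over the positions beyond `a`, one for each parity of the position of the smallest value, with
coefficients that depend only on the length of the block and on the number of further positions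
(`signedSum_union`). In the same way the last block of an alternating arrangement splits off
(`altSum_union`). The recursions for the two kinds of coefficients have solutions in closed form,
products of `1 - x^k` (`evenRow`, `oddRow`) and Gaussian binomial coefficients in `x^2`
(`blockCoeff_even_zero` and the lemmas after it).

By induction on the number of blocks, `altForm` evaluates both alternating sums. One of them vanishes
unless `n - a` is even and larger than `2 m_J`, where `J` is the part of `I` beyond `a`; this is
the origin of the case distinction in `f`. Multiplying by the coefficients of the first block gives
the product formula if `a ≠ 1` (`expansion_even`, `expansion_odd`). If `a = 1`, so that `0 ∈ I` and
`1 ∉ I`, the diagram automorphism that exchanges `s_0` and `s_1` replaces `I` by `Ĩ`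
(`signedSum_swap_zero_one`), which brings the case `a = 0`.
-/

namespace OddLengthD

/-! ### The length functions in terms of inversions -/

/-- The height functional, `e_i ↦ i - 1`; it takes the value `1` on every simple root. -/
noncomputable def hgt : (ℕ →₀ ℤ) →ₗ[ℤ] ℤ := Finsupp.linearCombination ℤ (fun i : ℕ => (i : ℤ) - 1)

theorem e_neg (k : ℤ) : e (-k) = -e k := by
  simp [e]

theorem e_natCast (i : ℕ) (hi : 1 ≤ i) : e (i : ℤ) = Finsupp.single i 1 := by
  simp [e, Int.sign_natCast_of_ne_zero (show i ≠ 0 by omega)]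

theorem hgt_e (a : ℤ) : hgt (e a) = a - a.sign := by
  unfold hgt e
  rw [Finsupp.linearCombination_single, smul_eq_mul, mul_sub, mul_one, Int.sign_mul_natAbs]

theorem hgt_simpleRoot (k : ℕ) : hgt (simpleRoot k) = 1 := by
  unfold simpleRoot
  split_ifs with h
  · rw [map_add, hgt_e, hgt_e]; rfl
  · rw [map_sub, hgt_e, hgt_e, Int.sign_eq_one_of_pos (by omega),
      Int.sign_eq_one_of_pos (by omega)]
    ring

theorem hgt_sum (n : ℕ) (c : ℕ → ℤ) :
    hgt (∑ k ∈ Finset.range n, c k • simpleRoot k) = ∑ k ∈ Finset.range n, c k := by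
  simp [map_sum, hgt_simpleRoot]

/-- The nonnegative combinations of the simple roots of type `D_n`. -/
def posCone (n : ℕ) : AddSubmonoid (ℕ →₀ ℤ) where
  carrier := {α | ∃ c : ℕ → ℕ, α = ∑ k ∈ Finset.range n, c k • simpleRoot k}
  zero_mem' := ⟨0, by simp⟩
  add_mem' := by
    rintro _ _ ⟨c, rfl⟩ ⟨d, rfl⟩
    exact ⟨c + d, by simp [add_smul, Finset.sum_add_distrib]⟩

theorem simpleRoot_mem_posCone {n k : ℕ} (hk : k < n) : simpleRoot k ∈ posCone n :=
  ⟨Pi.single k 1, by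
    rw [Finset.sum_eq_single k] <;> simp +contextual [hk]⟩

theorem sub_mem_posCone {n i j : ℕ} (hi : 1 ≤ i) (hij : i ≤ j) (hj : j ≤ n) :
    e j - e i ∈ posCone n := by
  induction j, hij using Nat.le_induction with
  | base => simp
  | succ j hij ih =>
    have h1 : e ((j + 1 : ℕ) : ℤ) - e i = simpleRoot j + (e j - e i) := by
      unfold simpleRoot
      rw [if_neg (by omega)]
      push_cast
      abel
    rw [h1]
    exact add_mem (simpleRoot_mem_posCone (by omega)) (ih (by omega))

theorem add_mem_posCone {n i j : ℕ} (hi : 1 ≤ i) (hij : i < j) (hj : j ≤ n) :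
    e i + e j ∈ posCone n := by
  have h1 : e i + e j = simpleRoot 0 + ((e i - e ((1 : ℕ) : ℤ)) + (e j - e ((2 : ℕ) : ℤ))) := by
    simp only [simpleRoot, if_true]
    push_cast
    abel
  rw [h1]
  exact add_mem (simpleRoot_mem_posCone (by omega))
    (add_mem (sub_mem_posCone le_rfl hi (by omega)) (sub_mem_posCone (by omega) (by omega) hj))

/-- The pairs `i < j` in `[1, n]`. -/
def pairs (n : ℕ) : Finset (ℕ × ℕ) :=
  (Finset.Icc 1 n ×ˢ Finset.Icc 1 n).filter (fun p => p.1 < p.2)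

theorem mem_pairs {n : ℕ} {p : ℕ × ℕ} : p ∈ pairs n ↔ 1 ≤ p.1 ∧ p.1 < p.2 ∧ p.2 ≤ n := by
  simp only [pairs, Finset.mem_filter, Finset.mem_product, Finset.mem_Icc]
  omega

theorem mem_roots {n : ℕ} {α : ℕ →₀ ℤ} : α ∈ roots n ↔ ∃ p ∈ pairs n,
    α = e p.1 + e p.2 ∨ α = -(e p.1 + e p.2) ∨ α = e p.1 - e p.2 ∨ α = -(e p.1 - e p.2) := by
  simp only [roots, pairs, Finset.mem_biUnion, Finset.mem_insert, Finset.mem_singleton]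

theorem neg_mem_roots {n : ℕ} {α : ℕ →₀ ℤ} (h : α ∈ roots n) : -α ∈ roots n := by
  rw [mem_roots] at h ⊢
  obtain ⟨p, hp, h⟩ := h
  refine ⟨p, hp, ?_⟩
  rcases h with rfl | rfl | rfl | rfl <;> simp

open Classical in
theorem mem_posRoots {n : ℕ} {α : ℕ →₀ ℤ} : α ∈ posRoots n ↔ α ∈ roots n ∧ 0 < hgt α := by
  unfold posRoots
  rw [Finset.mem_filter]
  refine and_congr_right fun hα => ?_
  obtain ⟨p, hp, h⟩ := mem_roots.1 hα
  rw [mem_pairs] at hp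
  have h1 := hgt_e p.1
  have h2 := hgt_e p.2
  rw [Int.sign_eq_one_of_pos (by omega)] at h1 h2
  constructor
  · rintro ⟨c, hc⟩
    have h3 : 0 ≤ hgt α := by
      have := hgt_sum n (fun k => (c k : ℤ))
      simp only [natCast_zsmul] at this
      rw [hc, this]
      exact Finset.sum_nonneg fun _ _ => by positivity
    rcases h with rfl | rfl | rfl | rfl <;>
    simp only [map_neg, map_add, map_sub, h1, h2] at h3 ⊢ <;> omega
  · intro h3
    rcases h with rfl | rfl | rfl | rfl <;>
    simp only [map_neg, map_add, map_sub, h1, h2] at h3 ⊢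
    · exact add_mem_posCone hp.1 hp.2.1 hp.2.2
    · omega
    · omega
    · rw [neg_sub]
      exact sub_mem_posCone hp.1 hp.2.1.le hp.2.2

open Classical in
/-- The positive roots are the `e_j - e_i` and `e_i + e_j` with `i < j`. -/
theorem posRoots_eq (n : ℕ) :
    posRoots n = (pairs n).biUnion fun p => {e p.2 - e p.1, e p.1 + e p.2} := by
  ext α
  rw [mem_posRoots, mem_roots]
  simp only [Finset.mem_biUnion, Finset.mem_insert, Finset.mem_singleton]
  constructor
  · rintro ⟨⟨p, hp, h⟩, h3⟩
    refine ⟨p, hp, ?_⟩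
    rw [mem_pairs] at hp
    have h1 := hgt_e p.1
    have h2 := hgt_e p.2
    rw [Int.sign_eq_one_of_pos (by omega)] at h1 h2
    rcases h with rfl | rfl | rfl | rfl <;>
    simp only [map_neg, map_add, map_sub, h1, h2] at h3 ⊢
    · exact Or.inr trivial
    · omega
    · omega
    · left; abel
  · rintro ⟨p, hp, h⟩
    refine ⟨⟨p, hp, ?_⟩, ?_⟩
    · rcases h with rfl | rfl <;> simp
    rw [mem_pairs] at hp
    have h1 := hgt_e p.1
    have h2 := hgt_e p.2
    rw [Int.sign_eq_one_of_pos (by omega)] at h1 h2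
    rcases h with rfl | rfl <;> simp only [map_add, map_sub, h1, h2] <;> omega

theorem odd_height_iff {n : ℕ} {α : ℕ →₀ ℤ} (h : α ∈ posRoots n) :
    (∃ h, HasHeight n α h ∧ Odd h) ↔ Odd (hgt α) := by
  constructor
  · rintro ⟨h, ⟨c, rfl, rfl⟩, ho⟩
    rwa [hgt_sum]
  · intro ho
    classical
    obtain ⟨c, hc⟩ := (Finset.mem_filter.1 h).2
    refine ⟨hgt α, ⟨fun k => (c k : ℤ), ?_, ?_⟩, ho⟩
    · simpa only [natCast_zsmul] using hc
    · have := hgt_sum n (fun k => (c k : ℤ))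
      simp only [natCast_zsmul] at this
      rw [hc, this]

open Classical in
theorem card_filter_posRoots (n : ℕ) (P : (ℕ →₀ ℤ) → Prop) [DecidablePred P] :
    ((posRoots n).filter P).card = ∑ p ∈ pairs n,
      ((if P (e p.2 - e p.1) then 1 else 0) + (if P (e p.1 + e p.2) then 1 else 0)) := by
  have hinj : ∀ p ∈ pairs n, ∀ p' ∈ pairs n, ∀ α : ℕ →₀ ℤ, (α = e p.2 - e p.1 ∨ α = e p.1 + e p.2) →
      (α = e p'.2 - e p'.1 ∨ α = e p'.1 + e p'.2) → p = p' := by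
    rintro ⟨i, j⟩ hp ⟨i', j'⟩ hp' α h h'
    rw [mem_pairs] at hp hp'
    simp only at hp hp' h h'
    have key : ∀ i j : ℕ, 1 ≤ i → i < j → (α = e j - e i ∨ α = e i + e j) →
        ∀ k, α k ≠ 0 ↔ k = i ∨ k = j := by
      intro i j hi hij h k
      rw [e_natCast i hi, e_natCast j (by omega)] at h
      rcases h with rfl | rfl <;>
      simp only [Finsupp.sub_apply, Finsupp.add_apply, Finsupp.single_apply] <;>
      split_ifs <;> simp <;> omega
    have h1 := key i j hp.1 hp.2.1 h
    have h2 := key i' j' hp'.1 hp'.2.1 h'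
    have h3 := (h1 i).symm.trans (h2 i)
    have h4 := (h1 j).symm.trans (h2 j)
    ext <;> simp only <;> omega
  rw [Finset.card_filter, posRoots_eq, Finset.sum_biUnion]
  · refine Finset.sum_congr rfl fun p hp => ?_
    rw [Finset.sum_pair]
    intro h
    rw [mem_pairs] at hp
    have := congrArg (fun f => f p.1) h
    rw [e_natCast p.1 hp.1, e_natCast p.2 (by omega)] at this
    simp [(show p.2 ≠ p.1 by omega)] at this
  · intro p hp p' hp' hne
    rw [Function.onFun, Finset.disjoint_left]
    intro α h h'
    simp only [Finset.mem_insert, Finset.mem_singleton] at h h'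
    exact hne (hinj p hp p' hp' α h h')

/-- The number of positive roots among `e_j - e_i`, `e_i + e_j` that are made negative by a signed
permutation with `i ↦ a`, `j ↦ b`. -/
def pairStat (a b : ℤ) : ℕ := (if b < a then 1 else 0) + (if a + b < 0 then 1 else 0)

theorem act_e (σ : Equiv.Perm ℤ) {i : ℕ} (hi : 1 ≤ i) : act σ (e i) = e (σ i) := by
  rw [e_natCast i hi, act, Finsupp.linearCombination_single, one_smul]

theorem sub_mem_roots {n : ℕ} {a b : ℤ} (ha : 1 ≤ a.natAbs) (hb' : b.natAbs ≤ n)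
    (hab : a.natAbs < b.natAbs) : e a - e b ∈ roots n ∧ e a + e b ∈ roots n := by
  have ha1 : a = a.natAbs ∨ a = -a.natAbs := by omega
  have hb1 : b = b.natAbs ∨ b = -b.natAbs := by omega
  have hp : (a.natAbs, b.natAbs) ∈ pairs n := by rw [mem_pairs]; omega
  simp only [mem_roots]
  constructor <;> refine ⟨_, hp, ?_⟩ <;> rcases ha1 with h | h <;> rcases hb1 with h' | h' <;>
  (rw [h, h']; simp only [e_neg, Int.natAbs_neg, Int.natAbs_natCast])
  · right; right; left; trivial
  · left; abel
  · right; left; abel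
  · right; right; right; abel
  · left; trivial
  · right; right; left; abel
  · right; right; right; abel
  · right; left; abel

theorem add_sub_mem_roots {n : ℕ} {a b : ℤ} (ha : 1 ≤ a.natAbs) (ha' : a.natAbs ≤ n)
    (hb : 1 ≤ b.natAbs) (hb' : b.natAbs ≤ n) (hab : a.natAbs ≠ b.natAbs) :
    e b - e a ∈ roots n ∧ e a + e b ∈ roots n := by
  rcases lt_or_gt_of_ne hab with h | h
  · have := sub_mem_roots ha hb' h
    refine ⟨?_, this.2⟩
    rw [← neg_sub]
    exact neg_mem_roots this.1
  · have := sub_mem_roots hb ha' h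
    refine ⟨this.1, ?_⟩
    rw [add_comm]
    exact this.2

/-- A root `± e_a ± e_b` is negative as soon as its height is; the signs of `e_b - e_a` and
`e_a + e_b` are thus those of `b - a` and `a + b`. -/
theorem neg_mem_posRoots_iff {n : ℕ} {a b : ℤ} (ha : 1 ≤ a.natAbs) (ha' : a.natAbs ≤ n)
    (hb : 1 ≤ b.natAbs) (hb' : b.natAbs ≤ n) (hab : a.natAbs ≠ b.natAbs) :
    (-(e b - e a) ∈ posRoots n ↔ b < a) ∧ (-(e a + e b) ∈ posRoots n ↔ a + b < 0) := by
  obtain ⟨h1, h2⟩ := add_sub_mem_roots ha ha' hb hb' hab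
  rw [mem_posRoots, mem_posRoots]
  simp only [neg_mem_roots h1, neg_mem_roots h2, true_and, map_neg, map_add, map_sub, hgt_e]
  have sgn : ∀ a : ℤ, 1 ≤ a.natAbs → (0 < a ∧ a.sign = 1) ∨ (a < 0 ∧ a.sign = -1) := by
    intro a ha
    rcases lt_trichotomy a 0 with h | h | h
    · exact Or.inr ⟨h, Int.sign_eq_neg_one_of_neg h⟩
    · simp [h] at ha
    · exact Or.inl ⟨h, Int.sign_eq_one_of_pos h⟩
  rcases sgn a ha with ⟨h3, h4⟩ | ⟨h3, h4⟩ <;> rcases sgn b hb with ⟨h5, h6⟩ | ⟨h5, h6⟩ <;>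
  rw [h4, h6] <;> omega

/-- The signed permutations of degree `n`, with no condition on the number of negative values. -/
def signedPerm (n : ℕ) : Set (Equiv.Perm ℤ) :=
  {σ | (∀ k, σ (-k) = -σ k) ∧ ∀ k : ℤ, (n : ℤ) < |k| → σ k = k}

theorem signedPerm_zero {n : ℕ} {σ : Equiv.Perm ℤ} (h : σ ∈ signedPerm n) : σ 0 = 0 := by
  have := h.1 0
  simp at this
  omega

theorem signedPerm_abs {n : ℕ} {σ : Equiv.Perm ℤ} (h : σ ∈ signedPerm n) {i : ℕ}
    (hi : 1 ≤ i) (hin : i ≤ n) : 1 ≤ (σ i).natAbs ∧ (σ i).natAbs ≤ n := by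
  constructor
  · by_contra hc
    have h0 : σ i = 0 := by omega
    have := σ.injective (h0.trans (signedPerm_zero h).symm)
    omega
  · by_contra hc
    have := σ.injective (h.2 (σ i) (by rw [Int.abs_eq_natAbs]; omega))
    rw [this] at hc
    simp at hc
    omega

theorem signedPerm_abs_injective {n : ℕ} {σ : Equiv.Perm ℤ} (h : σ ∈ signedPerm n)
    {i j : ℕ} (hij : i ≠ j) : (σ i).natAbs ≠ (σ j).natAbs := by
  intro h1
  rcases Int.natAbs_eq_natAbs_iff.1 h1 with h2 | h2
  · exact hij (by exact_mod_cast σ.injective h2)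
  · rw [← h.1] at h2
    have := σ.injective h2
    omega

theorem len_eq_sum {n : ℕ} {σ : Equiv.Perm ℤ} (h : σ ∈ signedPerm n) :
    len n σ = ∑ p ∈ pairs n, pairStat (σ p.1) (σ p.2) := by
  rw [len, card_filter_posRoots]
  refine Finset.sum_congr rfl fun p hp => ?_
  rw [mem_pairs] at hp
  have h1 := signedPerm_abs h hp.1 (by omega)
  have h2 := signedPerm_abs (i := p.2) h (by omega) (by omega)
  have := neg_mem_posRoots_iff h1.1 h1.2 h2.1 h2.2 (signedPerm_abs_injective h (by omega))
  rw [map_sub, map_add, act_e σ hp.1, act_e σ (by omega : 1 ≤ p.2)]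
  simp only [this, pairStat]

/-- The roots `e_j - e_i` and `e_i + e_j` have heights `j - i` and `i + j - 2`, so they are of odd
height exactly when `i` and `j` have opposite parities. -/
theorem oddLen_eq_sum {n : ℕ} {σ : Equiv.Perm ℤ} (h : σ ∈ signedPerm n) :
    oddLen n σ = ∑ p ∈ pairs n, if (p.1 + p.2) % 2 = 1 then pairStat (σ p.1) (σ p.2) else 0 := by
  rw [oddLen, card_filter_posRoots]
  refine Finset.sum_congr rfl fun p hp => ?_
  have hmem : e p.2 - e p.1 ∈ posRoots n ∧ e p.1 + e p.2 ∈ posRoots n := by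
    rw [posRoots_eq, Finset.mem_biUnion, Finset.mem_biUnion]
    exact ⟨⟨p, hp, by simp⟩, ⟨p, hp, by simp⟩⟩
  rw [mem_pairs] at hp
  have h1 := signedPerm_abs h hp.1 (by omega)
  have h2 := signedPerm_abs (i := p.2) h (by omega) (by omega)
  have := neg_mem_posRoots_iff h1.1 h1.2 h2.1 h2.2 (signedPerm_abs_injective h (by omega))
  rw [odd_height_iff hmem.1, odd_height_iff hmem.2, map_sub hgt, map_add hgt, map_sub (act σ),
    map_add (act σ), act_e σ hp.1, act_e σ (by omega : 1 ≤ p.2), hgt_e, hgt_e,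
    Int.sign_eq_one_of_pos (by omega), Int.sign_eq_one_of_pos (by omega)]
  simp only [this, pairStat]
  have h3 : Odd ((p.2 : ℤ) - 1 - (p.1 - 1)) ↔ (p.1 + p.2) % 2 = 1 := by
    rw [Int.odd_iff]; omega
  have h4 : Odd ((p.1 : ℤ) - 1 + (p.2 - 1)) ↔ (p.1 + p.2) % 2 = 1 := by
    rw [Int.odd_iff]; omega
  simp only [h3, h4]
  by_cases h5 : (p.1 + p.2) % 2 = 1 <;> simp [h5]

/-! ### Descents -/

/-- Reindexing along the transposition of `i` and `i + 1`, which permutes the pairs other than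
`(i, i + 1)`. -/
theorem sum_pairs_swap {n i : ℕ} (hi : 1 ≤ i) (hin : i + 1 ≤ n) (g g' : ℕ × ℕ → ℕ)
    (h : ∀ p ∈ pairs n, p ≠ (i, i + 1) →
      g' p = g (Equiv.swap i (i + 1) p.1, Equiv.swap i (i + 1) p.2)) :
    ∑ p ∈ pairs n, g' p + g (i, i + 1) = ∑ p ∈ pairs n, g p + g' (i, i + 1) := by
  have hmem : (i, i + 1) ∈ pairs n := by rw [mem_pairs]; simp only; omega
  rw [← Finset.add_sum_erase _ _ hmem, ← Finset.add_sum_erase _ g hmem]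
  have hmaps : ∀ p ∈ (pairs n).erase (i, i + 1),
      (Equiv.swap i (i + 1) p.1, Equiv.swap i (i + 1) p.2) ∈ (pairs n).erase (i, i + 1) := by
    rintro ⟨a, b⟩ hp
    rw [Finset.mem_erase, mem_pairs] at hp ⊢
    simp only [ne_eq, Prod.mk.injEq, Equiv.swap_apply_def] at hp ⊢
    split_ifs <;> omega
  have : ∑ p ∈ (pairs n).erase (i, i + 1), g' p = ∑ p ∈ (pairs n).erase (i, i + 1), g p := by
    refine Finset.sum_nbij' (fun p => (Equiv.swap i (i + 1) p.1, Equiv.swap i (i + 1) p.2))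
      (fun p => (Equiv.swap i (i + 1) p.1, Equiv.swap i (i + 1) p.2)) hmaps hmaps ?_ ?_ ?_
    · intro p _; simp
    · intro p _; simp
    · intro p hp
      rw [Finset.mem_erase] at hp
      exact h p hp.2 hp.1
  omega

theorem mul_gen_mem_signedPerm {n i : ℕ} {σ : Equiv.Perm ℤ} (h : σ ∈ signedPerm n) (hn : 2 ≤ n)
    (hi : i < n) : σ * gen i ∈ signedPerm n := by
  have hg : gen i ∈ signedPerm n := by
    constructor
    · intro k
      unfold gen
      split_ifs
      · simp only [Equiv.Perm.mul_apply, Equiv.swap_apply_def]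
        split_ifs <;> first | contradiction | omega
      · simp only [Equiv.Perm.mul_apply, Equiv.swap_apply_def]
        split_ifs <;> first | contradiction | omega
    · intro k hk
      rw [Int.abs_eq_natAbs] at hk
      unfold gen
      split_ifs
      · simp only [Equiv.Perm.mul_apply, Equiv.swap_apply_def]
        split_ifs <;> first | contradiction | omega
      · simp only [Equiv.Perm.mul_apply, Equiv.swap_apply_def]
        split_ifs <;> first | contradiction | omega
  refine ⟨fun k => ?_, fun k hk => ?_⟩
  · rw [Equiv.Perm.mul_apply, hg.1, h.1, Equiv.Perm.mul_apply]
  · rw [Equiv.Perm.mul_apply, hg.2 k hk, h.2 k hk]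

theorem gen_zero_apply (j : ℕ) (hj : 1 ≤ j) :
    gen 0 j = if j = 1 ∨ j = 2 then -((Equiv.swap 1 (1 + 1) j : ℕ) : ℤ) else j := by
  simp only [gen, if_true, Equiv.Perm.mul_apply, Equiv.swap_apply_def]
  split_ifs <;> first | contradiction | omega

theorem gen_succ_apply (i j : ℕ) (hi : 1 ≤ i) (hj : 1 ≤ j) :
    gen i j = (Equiv.swap i (i + 1) j : ℕ) := by
  simp only [gen, if_neg (show i ≠ 0 by omega), Equiv.Perm.mul_apply, Equiv.swap_apply_def]
  split_ifs <;> first | contradiction | omega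

theorem len_lt_len_mul_gen_iff {n i : ℕ} {σ : Equiv.Perm ℤ} (h : σ ∈ signedPerm n) (hi : 1 ≤ i)
    (hin : i < n) : len n σ < len n (σ * gen i) ↔ σ i < σ (i + 1 : ℕ) := by
  rw [len_eq_sum h, len_eq_sum (mul_gen_mem_signedPerm h (by omega) hin)]
  have := sum_pairs_swap hi hin (fun p => pairStat (σ p.1) (σ p.2))
    (fun p => pairStat ((σ * gen i) p.1) ((σ * gen i) p.2)) (by
      intro p hp _
      rw [mem_pairs] at hp
      simp only [Equiv.Perm.mul_apply]
      rw [gen_succ_apply i _ hi hp.1, gen_succ_apply i _ hi (by omega)])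
  simp only [Equiv.Perm.mul_apply] at this ⊢
  rw [gen_succ_apply i _ hi hi, gen_succ_apply i _ hi (by omega), Equiv.swap_apply_left,
    Equiv.swap_apply_right] at this
  have hne : σ i ≠ σ (i + 1 : ℕ) := fun h => by
    have := σ.injective h
    omega
  simp only [pairStat] at this ⊢
  generalize σ i = a at *
  generalize σ (i + 1 : ℕ) = b at *
  split_ifs at this <;> omega

theorem len_lt_len_mul_gen_zero_iff {n : ℕ} {σ : Equiv.Perm ℤ} (h : σ ∈ signedPerm n)
    (hn : 2 ≤ n) : len n σ < len n (σ * gen 0) ↔ 0 < σ (1 : ℕ) + σ (2 : ℕ) := by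
  have hab : (σ (1 : ℕ)).natAbs ≠ (σ (2 : ℕ)).natAbs := signedPerm_abs_injective h (by omega)
  rw [len_eq_sum h, len_eq_sum (mul_gen_mem_signedPerm h (by omega) (by omega))]
  have := sum_pairs_swap le_rfl hn (fun p => pairStat (σ p.1) (σ p.2))
    (fun p => pairStat ((σ * gen 0) p.1) ((σ * gen 0) p.2)) (by
      rintro ⟨a, b⟩ hp hne
      rw [mem_pairs] at hp
      simp only [Equiv.Perm.mul_apply, ne_eq, Prod.mk.injEq] at hp hne ⊢
      rw [gen_zero_apply a hp.1, gen_zero_apply b (by omega), if_neg (show ¬(b = 1 ∨ b = 2) by omega),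
        Equiv.swap_apply_of_ne_of_ne (show b ≠ 1 by omega) (show b ≠ 1 + 1 by omega)]
      split_ifs with h1
      · rw [h.1]
        simp only [pairStat]
        generalize σ b = b
        generalize σ ((Equiv.swap 1 (1 + 1) a : ℕ) : ℤ) = a
        split_ifs <;> omega
      · rw [Equiv.swap_apply_of_ne_of_ne (show a ≠ 1 by omega) (show a ≠ 1 + 1 by omega)])
  simp only [Equiv.Perm.mul_apply] at this ⊢
  rw [gen_zero_apply 1 le_rfl, gen_zero_apply (1 + 1) (by omega), if_pos (by simp), if_pos (by simp),
    Equiv.swap_apply_left, Equiv.swap_apply_right, h.1, h.1] at this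
  simp only [pairStat, Nat.reduceAdd] at this ⊢
  generalize σ (1 : ℕ) = a at *
  generalize σ (2 : ℕ) = b at *
  split_ifs at this <;> omega

/-! ### Fillings -/

open Classical in
/-- The fillings of a set `S` of `k` positions: the functions `w`, zero off `S`, such that `|w|`
maps `S` bijectively to `[1, k]`. -/
noncomputable def fill : ℕ → Finset ℕ → Finset (ℕ → ℤ)
  | 0, _ => {0}
  | k + 1, S => S.biUnion fun p => (fill k (S.erase p)).biUnion fun w =>
      {Function.update w p ((k : ℤ) + 1), Function.update w p (-((k : ℤ) + 1))}

theorem exists_natAbs_eq {k : ℕ} {S : Finset ℕ} (hS : S.card = k) {w : ℕ → ℤ}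
    (h1 : ∀ i ∈ S, 1 ≤ (w i).natAbs ∧ (w i).natAbs ≤ k)
    (h2 : Set.InjOn (fun i => (w i).natAbs) S) {v : ℕ} (hv : 1 ≤ v) (hvk : v ≤ k) :
    ∃ i ∈ S, (w i).natAbs = v := by
  have := Finset.surjOn_of_injOn_of_card_le (s := S) (t := Finset.Icc 1 k)
    (fun i => (w i).natAbs) (fun i hi => by simpa using h1 i hi) h2 (by simp [hS])
  obtain ⟨i, hi, h⟩ := this (show v ∈ (Finset.Icc 1 k : Set ℕ) by simp [hv, hvk])
  exact ⟨i, hi, h⟩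

/-- The recursive definition by choice of the position `p` and the sign of the largest absolute
value does yield all the fillings. -/
theorem mem_fill {k : ℕ} {S : Finset ℕ} (hS : S.card = k) {w : ℕ → ℤ} :
    w ∈ fill k S ↔ (∀ i ∉ S, w i = 0) ∧ (∀ i ∈ S, 1 ≤ (w i).natAbs ∧ (w i).natAbs ≤ k) ∧
      Set.InjOn (fun i => (w i).natAbs) S := by
  induction k generalizing S w with
  | zero =>
    rw [Finset.card_eq_zero] at hS
    simp [fill, hS, funext_iff]
  | succ k ih =>
    have hcard : ∀ p ∈ S, (S.erase p).card = k := fun p hp => by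
      rw [Finset.card_erase_of_mem hp, hS]; rfl
    simp only [fill, Finset.mem_biUnion, Finset.mem_insert, Finset.mem_singleton]
    constructor
    · rintro ⟨p, hp, w', hw', h⟩
      rw [ih (hcard p hp)] at hw'
      obtain ⟨h1, h2, h3⟩ := hw'
      have hwp : (w p).natAbs = k + 1 := by
        rcases h with rfl | rfl <;> simp only [Function.update_self] <;> omega
      have hwi : ∀ i, i ≠ p → w i = w' i := by
        intro i hi
        rcases h with rfl | rfl <;> simp [hi]
      refine ⟨?_, ?_, ?_⟩
      · intro i hi
        have hip : i ≠ p := by rintro rfl; exact hi hp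
        rw [hwi i hip]
        exact h1 i (by simp [hi])
      · intro i hi
        by_cases hip : i = p
        · rw [hip, hwp]; omega
        · rw [hwi i hip]
          have := h2 i (by simp [hip, hi])
          omega
      · intro i hi j hj hij
        simp only at hij
        rw [Finset.mem_coe] at hi hj
        by_cases hip : i = p <;> by_cases hjp : j = p
        · rw [hip, hjp]
        · have := h2 j (by simp [hjp, hj])
          rw [hip, hwi j hjp] at hij
          omega
        · have := h2 i (by simp [hip, hi])
          rw [hjp, hwi i hip] at hij
          omega
        · rw [hwi i hip, hwi j hjp] at hij
          exact h3 (by simp [hip, hi]) (by simp [hjp, hj]) hij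
    · rintro ⟨h1, h2, h3⟩
      obtain ⟨p, hp, hpk⟩ := exists_natAbs_eq hS h2 h3 (show 1 ≤ k + 1 by omega) le_rfl
      refine ⟨p, hp, Function.update w p 0, (ih (hcard p hp)).2 ⟨?_, ?_, ?_⟩, ?_⟩
      · intro i hi
        by_cases hip : i = p
        · simp [hip]
        · rw [Function.update_of_ne hip]
          exact h1 i (by simpa [hip] using hi)
      · intro i hi
        rw [Finset.mem_erase] at hi
        rw [Function.update_of_ne hi.1]
        have := h2 i hi.2
        have : (w i).natAbs ≠ (w p).natAbs := fun h => hi.1 (h3 hi.2 hp h)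
        omega
      · intro i hi j hj hij
        simp only [Finset.coe_erase, Set.mem_sdiff, Finset.mem_coe, Set.mem_singleton_iff] at hi hj
        simp only [Function.update_of_ne hi.2, Function.update_of_ne hj.2] at hij
        exact h3 hi.1 hj.1 hij
      · have : w p = k + 1 ∨ w p = -(k + 1) := by omega
        rcases this with h | h
        · left
          rw [← h]; simp
        · right
          rw [← h]; simp

theorem sum_fill_succ {M : Type*} [AddCommMonoid M] {k : ℕ} {S : Finset ℕ} (hS : S.card = k + 1)
    (g : (ℕ → ℤ) → M) :
    ∑ w ∈ fill (k + 1) S, g w = ∑ p ∈ S, ∑ w ∈ fill k (S.erase p),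
      (g (Function.update w p ((k : ℤ) + 1)) + g (Function.update w p (-((k : ℤ) + 1)))) := by
  have hcard : ∀ p ∈ S, (S.erase p).card = k := fun p hp => by
    rw [Finset.card_erase_of_mem hp, hS]; rfl
  have hp_eq : ∀ p ∈ S, ∀ w ∈ fill k (S.erase p), ∀ u : ℕ → ℤ,
      u = Function.update w p ((k : ℤ) + 1) ∨ u = Function.update w p (-((k : ℤ) + 1)) →
      w = Function.update u p 0 ∧ ∀ i, (u i).natAbs = k + 1 ↔ i = p := by
    intro p hp w hw u hu
    rw [mem_fill (hcard p hp)] at hw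
    obtain ⟨h1, h2, h3⟩ := hw
    have hwp : w p = 0 := h1 p (by simp)
    constructor
    · rcases hu with rfl | rfl <;> simp [← hwp]
    · intro i
      by_cases hip : i = p
      · rcases hu with rfl | rfl <;> simp [hip] <;> omega
      · have hle : (w i).natAbs ≤ k := by
          by_cases hi : i ∈ S.erase p
          · exact (h2 i hi).2
          · rw [h1 i hi]; simp
        rcases hu with rfl | rfl <;> simp [hip] <;> omega
  classical
  rw [fill, Finset.sum_biUnion]
  · refine Finset.sum_congr rfl fun p hp => ?_
    rw [Finset.sum_biUnion]
    · refine Finset.sum_congr rfl fun w _ => ?_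
      rw [Finset.sum_pair]
      intro h
      have := congrFun h p
      simp only [Function.update_self] at this
      omega
    · intro w hw w' hw' hne
      rw [Function.onFun, Finset.disjoint_left]
      intro u hu hu'
      simp only [Finset.mem_insert, Finset.mem_singleton] at hu hu'
      exact hne ((hp_eq p hp w hw u hu).1.trans (hp_eq p hp w' hw' u hu').1.symm)
  · intro p hp p' hp' hne
    rw [Function.onFun, Finset.disjoint_left]
    intro u hu hu'
    simp only [Finset.mem_biUnion, Finset.mem_insert, Finset.mem_singleton] at hu hu'
    obtain ⟨w, hw, hu⟩ := hu
    obtain ⟨w', hw', hu'⟩ := hu'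
    exact hne (((hp_eq p' hp' w' hw' u hu').2 p).1 (((hp_eq p hp w hw u hu).2 p).2 rfl))

/-! ### Removing the largest absolute value -/

/-- The number of positions in `S` to the right of `p`. -/
def right (S : Finset ℕ) (p : ℕ) : ℕ := (S.filter fun j => p < j).card

/-- The number of positions in `S` to the left of `p`. -/
def left (S : Finset ℕ) (p : ℕ) : ℕ := (S.filter fun j => j < p).card

/-- The number of positions in `S` of parity opposite to that of `p`. -/
def opp (S : Finset ℕ) (p : ℕ) : ℕ := (S.filter fun j => (p + j) % 2 = 1).card

/-- The number of positions in `S` to the right of `p` and of opposite parity. -/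
def oppRight (S : Finset ℕ) (p : ℕ) : ℕ := (S.filter fun j => p < j ∧ (p + j) % 2 = 1).card

/-- The number of positions in `S` to the left of `p` and of opposite parity. -/
def oppLeft (S : Finset ℕ) (p : ℕ) : ℕ := (S.filter fun j => j < p ∧ (p + j) % 2 = 1).card

/-- The contribution to the length of the pairs of positions in `S`. -/
def inv (S : Finset ℕ) (w : ℕ → ℤ) : ℕ :=
  ∑ i ∈ S, ∑ j ∈ S, if i < j then pairStat (w i) (w j) else 0

/-- The contribution to the odd length of the pairs of positions in `S`. -/
def oddInv (S : Finset ℕ) (w : ℕ → ℤ) : ℕ :=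
  ∑ i ∈ S, ∑ j ∈ S, if i < j ∧ (i + j) % 2 = 1 then pairStat (w i) (w j) else 0

/-- The ascent conditions indexed by `I` between positions in `S`. -/
def Ascending (I S : Finset ℕ) (w : ℕ → ℤ) : Prop :=
  (∀ i ∈ I, i ∈ S → i + 1 ∈ S → w i < w (i + 1)) ∧ (0 ∈ I → 1 ∈ S → 2 ∈ S → 0 < w 1 + w 2)

/-- No ascent condition prevents the largest value from standing at `p`. -/
def TopFree (I S : Finset ℕ) (p : ℕ) : Prop := p ∈ I → p + 1 ∉ S

/-- No ascent condition, other than the one indexed by `0`, prevents the smallest value from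
standing at `p`. -/
def BotFree (I S : Finset ℕ) (p : ℕ) : Prop := ∀ i ∈ I, i + 1 = p → i ∉ S

/-- The ascent condition indexed by `0` does not prevent a negative value of largest absolute value
from standing at `p`. -/
def ZeroFree (I S : Finset ℕ) (p : ℕ) : Prop := ¬(0 ∈ I ∧ 1 ∈ S ∧ 2 ∈ S ∧ (p = 1 ∨ p = 2))

instance (I S : Finset ℕ) (p : ℕ) : Decidable (TopFree I S p) := by
  unfold TopFree; infer_instance

instance (I S : Finset ℕ) (p : ℕ) : Decidable (BotFree I S p) := by
  unfold BotFree; infer_instance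

instance (I S : Finset ℕ) (p : ℕ) : Decidable (ZeroFree I S p) := by
  unfold ZeroFree; infer_instance

instance (I S : Finset ℕ) (w : ℕ → ℤ) : Decidable (Ascending I S w) := by
  unfold Ascending; infer_instance

section
variable {K : Type*} [Field K]

/-- The contribution of the position `p` to `(-1)^ℓ x^L` if the largest absolute value stands at `p`
with a positive sign. -/
def topWeight (x : K) (S : Finset ℕ) (p : ℕ) : K := (-1) ^ right S p * x ^ oppRight S p

/-- The sum of `(-1)^ℓ x^L` over the ascending fillings of a set `S` of `k` positions, computed by
repeatedly removing the largest absolute value. A positive one makes one root negative for each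
position to its right; a negative one makes two more negative for each position to its left, which
affects `x^L` but not the sign. -/
def signedSum (x : K) (I : Finset ℕ) : ℕ → Finset ℕ → K
  | 0, _ => 1
  | k + 1, S => ∑ p ∈ S, ((if TopFree I S p then 1 else 0) +
      (if BotFree I S p ∧ ZeroFree I S p then x ^ (2 * oppLeft S p) else 0)) *
        topWeight x S p * signedSum x I k (S.erase p)

theorem sum_sum_erase (S : Finset ℕ) {p : ℕ} (hp : p ∈ S) (g : ℕ → ℕ → ℕ) (hg : g p p = 0) :
    ∑ i ∈ S, ∑ j ∈ S, g i j = ∑ i ∈ S.erase p, ∑ j ∈ S.erase p, g i j +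
      (∑ j ∈ S.erase p, g p j + ∑ i ∈ S.erase p, g i p) := by
  rw [← Finset.add_sum_erase _ _ hp, ← Finset.add_sum_erase _ _ hp, hg, zero_add,
    Finset.sum_congr rfl (fun i _ => (Finset.add_sum_erase S (fun j => g i j) hp).symm),
    Finset.sum_add_distrib]
  ring

/-- The pairs that involve a position `p` whose value `a` compares in the same way with all the
other values of `w`. -/
theorem sum_ite_update {S : Finset ℕ} {p : ℕ} (hp : p ∈ S) (w : ℕ → ℤ) (a : ℤ) (r : ℕ → ℕ → Prop)
    [DecidableRel r] (hr : ¬r p p) (c d : ℕ) (hc : ∀ j ∈ S.erase p, pairStat a (w j) = c)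
    (hd : ∀ i ∈ S.erase p, pairStat (w i) a = d) :
    ∑ i ∈ S, ∑ j ∈ S, (if r i j then
        pairStat (Function.update w p a i) (Function.update w p a j) else 0) =
      ∑ i ∈ S.erase p, ∑ j ∈ S.erase p, (if r i j then pairStat (w i) (w j) else 0) +
        ((S.filter fun j => r p j).card * c + (S.filter fun i => r i p).card * d) := by
  have hcard : ∀ P : ℕ → Prop, [DecidablePred P] → ¬ P p →
      S.filter P = (S.erase p).filter P := by
    intro P _ hP
    ext j
    simp only [Finset.mem_filter, Finset.mem_erase]
    constructor
    · rintro ⟨h1, h2⟩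
      exact ⟨⟨by rintro rfl; exact hP h2, h1⟩, h2⟩
    · rintro ⟨⟨_, h1⟩, h2⟩
      exact ⟨h1, h2⟩
  rw [sum_sum_erase S hp _ (by simp [hr]), hcard (fun j => r p j) hr, hcard (fun i => r i p) hr]
  congr 1
  · refine Finset.sum_congr rfl fun i hi => Finset.sum_congr rfl fun j hj => ?_
    rw [Function.update_of_ne (Finset.ne_of_mem_erase hi),
      Function.update_of_ne (Finset.ne_of_mem_erase hj)]
  · rw [← smul_eq_mul, ← smul_eq_mul, ← Finset.sum_const, ← Finset.sum_const, Finset.sum_filter,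
      Finset.sum_filter]
    congr 1
    · refine Finset.sum_congr rfl fun j hj => ?_
      rw [Function.update_of_ne (Finset.ne_of_mem_erase hj), Function.update_self, hc j hj]
    · refine Finset.sum_congr rfl fun j hj => ?_
      rw [Function.update_of_ne (Finset.ne_of_mem_erase hj), Function.update_self, hd j hj]

theorem ascending_update_pos {I S : Finset ℕ} {p : ℕ} {k : ℕ} (hp : p ∈ S) {w : ℕ → ℤ}
    (hw : ∀ i ∈ S.erase p, (w i).natAbs ≤ k) :
    Ascending I S (Function.update w p ((k : ℤ) + 1)) ↔
      TopFree I S p ∧ Ascending I (S.erase p) w := by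
  have hle : ∀ i ∈ S, i ≠ p → (w i).natAbs ≤ k := fun i hi hip =>
    hw i (Finset.mem_erase.2 ⟨hip, hi⟩)
  unfold Ascending TopFree
  simp only [Finset.mem_erase]
  constructor
  · rintro ⟨h1, h2⟩
    refine ⟨fun hpI hp1 => ?_, fun i hi hiS hiS' => ?_, fun h0I h1S h2S => ?_⟩
    · have := h1 p hpI hp hp1
      rw [Function.update_self, Function.update_of_ne (by omega)] at this
      have := hle (p + 1) hp1 (by omega)
      omega
    · have := h1 i hi hiS.2 hiS'.2
      rwa [Function.update_of_ne hiS.1, Function.update_of_ne hiS'.1] at this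
    · have := h2 h0I h1S.2 h2S.2
      rwa [Function.update_of_ne h1S.1, Function.update_of_ne h2S.1] at this
  · rintro ⟨h1, h2, h3⟩
    refine ⟨fun i hi hiS hiS' => ?_, fun h0I h1S h2S => ?_⟩
    · by_cases hip : i = p
      · subst hip
        exact absurd hiS' (h1 hi)
      by_cases hip' : i + 1 = p
      · rw [hip', Function.update_self, Function.update_of_ne hip]
        have := hle i hiS hip
        omega
      · rw [Function.update_of_ne hip, Function.update_of_ne hip']
        exact h2 i hi ⟨hip, hiS⟩ ⟨hip', hiS'⟩
    · by_cases hp1 : 1 = p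
      · rw [← hp1, Function.update_self, Function.update_of_ne (by omega)]
        have := hle 2 h2S (by omega)
        omega
      by_cases hp2 : 2 = p
      · rw [← hp2, Function.update_self, Function.update_of_ne (by omega)]
        have := hle 1 h1S (by omega)
        omega
      · rw [Function.update_of_ne hp1, Function.update_of_ne hp2]
        exact h3 h0I ⟨hp1, h1S⟩ ⟨hp2, h2S⟩

theorem ascending_update_neg {I S : Finset ℕ} {p : ℕ} {k : ℕ} (hp : p ∈ S) {w : ℕ → ℤ}
    (hw : ∀ i ∈ S.erase p, (w i).natAbs ≤ k) :
    Ascending I S (Function.update w p (-((k : ℤ) + 1))) ↔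
      (BotFree I S p ∧ ZeroFree I S p) ∧ Ascending I (S.erase p) w := by
  have hle : ∀ i ∈ S, i ≠ p → (w i).natAbs ≤ k := fun i hi hip =>
    hw i (Finset.mem_erase.2 ⟨hip, hi⟩)
  unfold Ascending BotFree ZeroFree
  simp only [Finset.mem_erase]
  constructor
  · rintro ⟨h1, h2⟩
    refine ⟨⟨fun i hi hip hiS => ?_, ?_⟩, fun i hi hiS hiS' => ?_, fun h0I h1S h2S => ?_⟩
    · have := h1 i hi hiS (hip ▸ hp)
      rw [hip, Function.update_self, Function.update_of_ne (by omega)] at this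
      have := hle i hiS (by omega)
      omega
    · rintro ⟨h0I, h1S, h2S, hp1 | hp2⟩
      · have := h2 h0I h1S h2S
        rw [hp1, Function.update_self, Function.update_of_ne (by omega)] at this
        have := hle 2 h2S (by omega)
        omega
      · have := h2 h0I h1S h2S
        rw [hp2, Function.update_self, Function.update_of_ne (by omega)] at this
        have := hle 1 h1S (by omega)
        omega
    · have := h1 i hi hiS.2 hiS'.2
      rwa [Function.update_of_ne hiS.1, Function.update_of_ne hiS'.1] at this
    · have := h2 h0I h1S.2 h2S.2
      rwa [Function.update_of_ne h1S.1, Function.update_of_ne h2S.1] at this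
  · rintro ⟨⟨h1, h4⟩, h2, h3⟩
    refine ⟨fun i hi hiS hiS' => ?_, fun h0I h1S h2S => ?_⟩
    · by_cases hip' : i + 1 = p
      · exact absurd hiS (h1 i hi hip')
      by_cases hip : i = p
      · rw [hip, Function.update_self, Function.update_of_ne (by omega)]
        have := hle (p + 1) (hip ▸ hiS') (by omega)
        omega
      · rw [Function.update_of_ne hip, Function.update_of_ne hip']
        exact h2 i hi ⟨hip, hiS⟩ ⟨hip', hiS'⟩
    · by_cases hp1 : 1 = p
      · exact absurd ⟨h0I, h1S, h2S, Or.inl hp1.symm⟩ h4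
      by_cases hp2 : 2 = p
      · exact absurd ⟨h0I, h1S, h2S, Or.inr hp2.symm⟩ h4
      · rw [Function.update_of_ne hp1, Function.update_of_ne hp2]
        exact h3 h0I ⟨hp1, h1S⟩ ⟨hp2, h2S⟩

theorem sum_fill_eq_signedSum (x : K) (I : Finset ℕ) {k : ℕ} {S : Finset ℕ} (hS : S.card = k) :
    ∑ w ∈ fill k S, (if Ascending I S w then (-1) ^ inv S w * x ^ oddInv S w else 0) =
      signedSum x I k S := by
  induction k generalizing S with
  | zero =>
    rw [Finset.card_eq_zero] at hS
    simp [fill, signedSum, hS, Ascending, inv, oddInv]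
  | succ k ih =>
    rw [sum_fill_succ hS, signedSum]
    refine Finset.sum_congr rfl fun p hp => ?_
    have hcard : (S.erase p).card = k := by rw [Finset.card_erase_of_mem hp, hS]; rfl
    rw [← ih hcard, Finset.mul_sum]
    refine Finset.sum_congr rfl fun w hw => ?_
    rw [mem_fill hcard] at hw
    have hle : ∀ i ∈ S.erase p, (w i).natAbs ≤ k := fun i hi => (hw.2.1 i hi).2
    have e1 : inv S (Function.update w p ((k : ℤ) + 1)) = inv (S.erase p) w + right S p := by
      unfold inv
      rw [sum_ite_update hp w _ (fun i j => i < j) (by simp) 1 0]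
      · simp [right]
      · intro j hj
        have := hle j hj
        unfold pairStat
        rw [if_pos (by omega), if_neg (by omega)]
      · intro j hj
        have := hle j hj
        unfold pairStat
        rw [if_neg (by omega), if_neg (by omega)]
    have e2 : oddInv S (Function.update w p ((k : ℤ) + 1)) =
        oddInv (S.erase p) w + oppRight S p := by
      unfold oddInv
      rw [sum_ite_update hp w _ (fun i j => i < j ∧ (i + j) % 2 = 1) (by simp) 1 0]
      · simp [oppRight]
      · intro j hj
        have := hle j hj
        unfold pairStat
        rw [if_pos (by omega), if_neg (by omega)]
      · intro j hj
        have := hle j hj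
        unfold pairStat
        rw [if_neg (by omega), if_neg (by omega)]
    have e3 : inv S (Function.update w p (-((k : ℤ) + 1))) =
        inv (S.erase p) w + (right S p + left S p * 2) := by
      unfold inv
      rw [sum_ite_update hp w _ (fun i j => i < j) (by simp) 1 2]
      · simp [right, left]
      · intro j hj
        have := hle j hj
        unfold pairStat
        rw [if_neg (by omega), if_pos (by omega)]
      · intro j hj
        have := hle j hj
        unfold pairStat
        rw [if_pos (by omega), if_pos (by omega)]
    have e4 : oddInv S (Function.update w p (-((k : ℤ) + 1))) =
        oddInv (S.erase p) w + (oppRight S p + oppLeft S p * 2) := by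
      unfold oddInv
      rw [sum_ite_update hp w _ (fun i j => i < j ∧ (i + j) % 2 = 1) (by simp) 1 2]
      · simp [oppRight, oppLeft, add_comm]
      · intro j hj
        have := hle j hj
        unfold pairStat
        rw [if_neg (by omega), if_pos (by omega)]
      · intro j hj
        have := hle j hj
        unfold pairStat
        rw [if_pos (by omega), if_pos (by omega)]
    rw [e1, e2, e3, e4]
    simp only [ascending_update_pos hp hle, ascending_update_neg hp hle]
    have h5 : ((-1 : K)) ^ (left S p * 2) = 1 := by rw [mul_comm, pow_mul]; simp
    unfold topWeight
    by_cases h1 : Ascending I (S.erase p) w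
    · by_cases h2 : TopFree I S p <;> by_cases h3 : BotFree I S p ∧ ZeroFree I S p <;>
      simp only [h1, h2, h3, and_true, and_self, if_true, if_false, pow_add, h5] <;> ring
    · simp [h1]

end

/-! ### From the group to fillings -/

/-- The filling `i ↦ σ i` of `[1, n]` attached to a signed permutation. -/
def word (n : ℕ) (σ : Equiv.Perm ℤ) (i : ℕ) : ℤ := if i ∈ Finset.Icc 1 n then σ i else 0

/-- The number of negative values of a filling on `S`. -/
def negCount (S : Finset ℕ) (w : ℕ → ℤ) : ℕ := (S.filter fun i => w i < 0).card

theorem word_apply {n i : ℕ} (σ : Equiv.Perm ℤ) (h1 : 1 ≤ i) (h2 : i ≤ n) : word n σ i = σ i :=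
  if_pos (Finset.mem_Icc.2 ⟨h1, h2⟩)

theorem word_mem_fill {n : ℕ} {σ : Equiv.Perm ℤ} (h : σ ∈ signedPerm n) :
    word n σ ∈ fill n (Finset.Icc 1 n) := by
  rw [mem_fill (by simp)]
  refine ⟨fun i hi => if_neg hi, fun i hi => ?_, fun i hi j hj hij => ?_⟩
  · rw [Finset.mem_Icc] at hi
    rw [word_apply σ hi.1 hi.2]
    exact signedPerm_abs h hi.1 hi.2
  · rw [Finset.mem_coe, Finset.mem_Icc] at hi hj
    simp only [word_apply σ hi.1 hi.2, word_apply σ hj.1 hj.2] at hij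
    by_contra hne
    exact signedPerm_abs_injective h hne hij

theorem word_injOn {n : ℕ} {σ τ : Equiv.Perm ℤ} (hσ : σ ∈ signedPerm n) (hτ : τ ∈ signedPerm n)
    (h : word n σ = word n τ) : σ = τ := by
  have h1 : ∀ i : ℕ, σ i = τ i := by
    intro i
    by_cases hi : i ∈ Finset.Icc 1 n
    · have := congrFun h i
      rwa [word, word, if_pos hi, if_pos hi] at this
    · rw [Finset.mem_Icc] at hi
      by_cases h0 : i = 0
      · subst h0
        exact_mod_cast (signedPerm_zero hσ).trans (signedPerm_zero hτ).symm
      · have hlt : (n : ℤ) < |(i : ℤ)| := by rw [Int.abs_eq_natAbs]; omega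
        rw [hσ.2 i hlt, hτ.2 i hlt]
  ext k
  rcases Int.eq_nat_or_neg k with ⟨i, rfl | rfl⟩
  · exact h1 i
  · rw [hσ.1, hτ.1, h1]

/-- Every filling of `[1, n]` extends to an odd bijection of `ℤ`. -/
theorem exists_word_eq {n : ℕ} {w : ℕ → ℤ} (hw : w ∈ fill n (Finset.Icc 1 n)) :
    ∃ σ ∈ signedPerm n, word n σ = w := by
  have hw' := (mem_fill (by simp)).1 hw
  obtain ⟨h1, h2, h3⟩ := hw'
  simp only [Finset.mem_Icc] at h1 h2
  let g : ℤ → ℤ := fun k => if k.natAbs ≤ n then k.sign * w k.natAbs else k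
  have w0 : w 0 = 0 := h1 0 (by omega)
  have gpos : ∀ i : ℕ, i ≤ n → g i = w i := by
    intro i hi
    simp only [g, Int.natAbs_natCast, if_pos hi]
    rcases Nat.eq_zero_or_pos i with rfl | h
    · simp [w0]
    · rw [Int.sign_eq_one_of_pos (by omega), one_mul]
  have godd : ∀ k, g (-k) = -g k := by
    intro k
    simp only [g, Int.natAbs_neg, Int.sign_neg]
    split_ifs <;> ring
  have gbig : ∀ k : ℤ, n < k.natAbs → g k = k := fun k hk => if_neg (by omega)
  have gabs : ∀ k : ℤ, (g k).natAbs = if k.natAbs ≤ n then (w k.natAbs).natAbs else k.natAbs := by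
    intro k
    split_ifs with h
    · simp only [g, if_pos h, Int.natAbs_mul]
      rcases eq_or_ne k 0 with rfl | hk
      · simp [w0]
      · rw [Int.natAbs_sign_of_ne_zero hk, one_mul]
    · rw [gbig k (by omega)]
  have gle : ∀ k : ℤ, k.natAbs ≤ n → (g k).natAbs ≤ n := by
    intro k hk
    rw [gabs, if_pos hk]
    rcases Nat.eq_zero_or_pos k.natAbs with h | h
    · rw [h, w0]; simp
    · exact (h2 _ ⟨h, hk⟩).2
  have hzero : ∀ i, i ≤ n → w i = 0 → i = 0 := by
    intro i hi hwi
    by_contra hc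
    have := h2 i ⟨by omega, hi⟩
    omega
  have ginj : Function.Injective g := by
    intro k l hkl
    have habs : (g k).natAbs = (g l).natAbs := by rw [hkl]
    have hkl' : k.natAbs = l.natAbs := by
      by_cases hk : k.natAbs ≤ n <;> by_cases hl : l.natAbs ≤ n
      · rw [gabs, gabs, if_pos hk, if_pos hl] at habs
        rcases Nat.eq_zero_or_pos k.natAbs with h | h
        · rw [h, w0, Int.natAbs_zero, eq_comm, Int.natAbs_eq_zero] at habs
          rw [h, hzero _ hl habs]
        · rcases Nat.eq_zero_or_pos l.natAbs with h' | h'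
          · rw [h', w0, Int.natAbs_zero, Int.natAbs_eq_zero] at habs
            rw [h', hzero _ hk habs]
          · exact h3 (by simp; omega) (by simp; omega) habs
      · have := gle k hk
        rw [gabs l, if_neg hl] at habs
        omega
      · have := gle l hl
        rw [gabs k, if_neg hk] at habs
        omega
      · rwa [gabs, gabs, if_neg hk, if_neg hl] at habs
    rcases Int.natAbs_eq_natAbs_iff.1 hkl' with h | h
    · exact h
    · rw [h, godd] at hkl
      have h0 : g l = 0 := by omega
      have : (g l).natAbs = 0 := by rw [h0]; rfl
      rw [gabs] at this
      split_ifs at this with hl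
      · have := hzero _ hl (Int.natAbs_eq_zero.1 this)
        omega
      · omega
  have gsurj : Function.Surjective g := by
    intro y
    by_cases hy : y.natAbs ≤ n
    · have := Finset.surjOn_of_injOn_of_card_le (s := Finset.Icc (-(n : ℤ)) n)
        (t := Finset.Icc (-(n : ℤ)) n) g (fun k hk => by
          simp only [Finset.coe_Icc, Set.mem_Icc] at hk ⊢
          have := gle k (by omega)
          omega) ginj.injOn le_rfl
      obtain ⟨k, _, hk⟩ := this (show y ∈ (Finset.Icc (-(n : ℤ)) n : Set ℤ) by simp; omega)
      exact ⟨k, hk⟩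
    · exact ⟨y, gbig y (by omega)⟩
  refine ⟨Equiv.ofBijective g ⟨ginj, gsurj⟩, ⟨godd, fun k hk => ?_⟩, ?_⟩
  · rw [Int.abs_eq_natAbs] at hk
    exact gbig k (by omega)
  · funext i
    unfold word
    split_ifs with hi
    · exact gpos i (Finset.mem_Icc.1 hi).2
    · rw [Finset.mem_Icc] at hi
      exact (h1 i hi).symm

theorem sum_pairs_eq {n : ℕ} (r : ℕ → ℕ → Prop) [DecidableRel r] (g : ℕ → ℕ → ℕ) :
    (∑ p ∈ pairs n, if r p.1 p.2 then g p.1 p.2 else 0) =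
      ∑ i ∈ Finset.Icc 1 n, ∑ j ∈ Finset.Icc 1 n, if i < j ∧ r i j then g i j else 0 := by
  rw [pairs, Finset.sum_filter, Finset.sum_product]
  refine Finset.sum_congr rfl fun i _ => Finset.sum_congr rfl fun j _ => ?_
  simp only [ite_and]

theorem len_eq_inv {n : ℕ} {σ : Equiv.Perm ℤ} (h : σ ∈ signedPerm n) :
    len n σ = inv (Finset.Icc 1 n) (word n σ) := by
  have := sum_pairs_eq (n := n) (fun _ _ => True) (fun i j => pairStat (σ i) (σ j))
  simp only [if_true, and_true] at this
  rw [len_eq_sum h, this, inv]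
  refine Finset.sum_congr rfl fun i hi => Finset.sum_congr rfl fun j hj => ?_
  rw [word, word, if_pos hi, if_pos hj]

theorem oddLen_eq_oddInv {n : ℕ} {σ : Equiv.Perm ℤ} (h : σ ∈ signedPerm n) :
    oddLen n σ = oddInv (Finset.Icc 1 n) (word n σ) := by
  rw [oddLen_eq_sum h, sum_pairs_eq (fun i j => (i + j) % 2 = 1) (fun i j => pairStat (σ i) (σ j)),
    oddInv]
  refine Finset.sum_congr rfl fun i hi => Finset.sum_congr rfl fun j hj => ?_
  rw [word, word, if_pos hi, if_pos hj]

theorem mem_evenSignedPerm_iff {n : ℕ} {σ : Equiv.Perm ℤ} :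
    σ ∈ evenSignedPerm n ↔ σ ∈ signedPerm n ∧ Even (negCount (Finset.Icc 1 n) (word n σ)) := by
  have : ((Finset.Icc (1 : ℤ) n).filter (fun k => σ k < 0)).card =
      negCount (Finset.Icc 1 n) (word n σ) := by
    symm
    refine Finset.card_nbij (fun i : ℕ => (i : ℤ)) ?_ ?_ ?_
    · intro i hi
      simp only [Finset.coe_filter, Finset.mem_Icc, Set.mem_ofPred_eq] at hi ⊢
      rw [word_apply σ hi.1.1 hi.1.2] at hi
      exact ⟨by omega, hi.2⟩
    · intro i _ j _ h
      exact Nat.cast_injective (R := ℤ) h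
    · intro k hk
      simp only [Finset.coe_filter, Finset.mem_Icc, Set.mem_ofPred_eq] at hk
      refine ⟨k.toNat, ?_, by simp only; omega⟩
      simp only [Finset.coe_filter, Finset.mem_Icc, Set.mem_ofPred_eq]
      rw [word_apply σ (by omega) (by omega), Int.toNat_of_nonneg (by omega)]
      exact ⟨by omega, hk.2⟩
  rw [evenSignedPerm, Set.mem_ofPred_eq, this, signedPerm, Set.mem_ofPred_eq, and_assoc]

theorem mem_quotient_iff {n : ℕ} (hn : 2 ≤ n) {I : Finset ℕ} (hI : I ⊆ Finset.range n)
    {σ : Equiv.Perm ℤ} : σ ∈ quotient n I ↔ σ ∈ signedPerm n ∧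
      Ascending I (Finset.Icc 1 n) (word n σ) ∧ Even (negCount (Finset.Icc 1 n) (word n σ)) := by
  rw [quotient, Set.mem_ofPred_eq, mem_evenSignedPerm_iff, and_assoc, and_comm (b := Even _)]
  refine and_congr_right fun h => and_congr_right fun _ => ?_
  constructor
  · intro hlt
    refine ⟨fun i hi hi1 hi2 => ?_, fun h0 h1 h2 => ?_⟩
    · have := hlt i hi
      rw [Finset.mem_Icc] at hi1 hi2
      rw [len_lt_len_mul_gen_iff h hi1.1 (by omega)] at this
      rwa [word_apply σ hi1.1 hi1.2, word_apply σ hi2.1 hi2.2]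
    · have := hlt 0 h0
      rw [len_lt_len_mul_gen_zero_iff h hn] at this
      rwa [word_apply σ le_rfl (by omega), word_apply σ (by omega) hn]
  · rintro ⟨h1, h2⟩ i hi
    have hin := Finset.mem_range.1 (hI hi)
    rcases Nat.eq_zero_or_pos i with rfl | hpos
    · rw [len_lt_len_mul_gen_zero_iff h hn]
      have := h2 hi (by simp; omega) (by simp; omega)
      rwa [word_apply σ le_rfl (by omega), word_apply σ (by omega) hn] at this
    · rw [len_lt_len_mul_gen_iff h hpos hin]
      have := h1 i hi (by simp; omega) (by simp; omega)
      rwa [word_apply σ hpos hin.le, word_apply σ (by omega) (by omega)] at this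

section
variable {K : Type*} [Field K]

theorem sum_quotient_eq (x : K) {n : ℕ} (hn : 2 ≤ n) {I : Finset ℕ} (hI : I ⊆ Finset.range n) :
    ∑ σ ∈ (finite_quotient n I).toFinset, (-1) ^ len n σ * x ^ oddLen n σ =
      ∑ w ∈ (fill n (Finset.Icc 1 n)).filter (fun w => Even (negCount (Finset.Icc 1 n) w)),
        if Ascending I (Finset.Icc 1 n) w then
          (-1) ^ inv (Finset.Icc 1 n) w * x ^ oddInv (Finset.Icc 1 n) w else 0 := by
  rw [← Finset.sum_filter]
  refine Finset.sum_nbij (word n) ?_ ?_ ?_ ?_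
  · intro σ hσ
    rw [Set.Finite.mem_toFinset, mem_quotient_iff hn hI] at hσ
    simp only [Finset.mem_filter]
    exact ⟨⟨word_mem_fill hσ.1, hσ.2.2⟩, hσ.2.1⟩
  · intro σ hσ τ hτ h
    rw [Finset.mem_coe, Set.Finite.mem_toFinset, mem_quotient_iff hn hI] at hσ hτ
    exact word_injOn hσ.1 hτ.1 h
  · intro w hw
    simp only [Finset.coe_filter, Finset.mem_filter, Set.mem_ofPred_eq] at hw
    obtain ⟨σ, hσ, rfl⟩ := exists_word_eq hw.1.1
    refine ⟨σ, ?_, rfl⟩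
    rw [Finset.mem_coe, Set.Finite.mem_toFinset, mem_quotient_iff hn hI]
    exact ⟨hσ, hw.2, hw.1.2⟩
  · intro σ hσ
    rw [Set.Finite.mem_toFinset, mem_quotient_iff hn hI] at hσ
    rw [len_eq_inv hσ.1, oddLen_eq_oddInv hσ.1]

/-- The filling obtained by changing the sign of the value of absolute value `1`. -/
def flipOne (w : ℕ → ℤ) (i : ℕ) : ℤ := if (w i).natAbs = 1 then -w i else w i

theorem flipOne_flipOne (w : ℕ → ℤ) : flipOne (flipOne w) = w := by
  funext i
  unfold flipOne
  split_ifs <;> omega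

theorem natAbs_flipOne (w : ℕ → ℤ) (i : ℕ) : (flipOne w i).natAbs = (w i).natAbs := by
  unfold flipOne
  split_ifs <;> omega

theorem flipOne_mem_fill {k : ℕ} {S : Finset ℕ} (hS : S.card = k) {w : ℕ → ℤ}
    (hw : w ∈ fill k S) : flipOne w ∈ fill k S := by
  rw [mem_fill hS] at hw ⊢
  simp only [natAbs_flipOne]
  refine ⟨fun i hi => ?_, hw.2⟩
  rw [← Int.natAbs_eq_zero, natAbs_flipOne, hw.1 i hi]; rfl

theorem flipOne_lt {w : ℕ → ℤ} {i j : ℕ} (hi : w i ≠ 0) (hj : w j ≠ 0)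
    (hij : (w i).natAbs ≠ (w j).natAbs) :
    (flipOne w i < flipOne w j ↔ w i < w j) ∧ (flipOne w i + flipOne w j < 0 ↔ w i + w j < 0) ∧
      (0 < flipOne w i + flipOne w j ↔ 0 < w i + w j) := by
  unfold flipOne
  split_ifs <;> omega

theorem natAbs_ne_of_mem_fill {k : ℕ} {S : Finset ℕ} (hS : S.card = k) {w : ℕ → ℤ}
    (hw : w ∈ fill k S) {i j : ℕ} (hi : i ∈ S) (hj : j ∈ S) (hij : i ≠ j) :
    w i ≠ 0 ∧ w j ≠ 0 ∧ (w i).natAbs ≠ (w j).natAbs := by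
  rw [mem_fill hS] at hw
  have h1 := (hw.2.1 i hi).1
  have h2 := (hw.2.1 j hj).1
  exact ⟨by omega, by omega, fun h => hij (hw.2.2 hi hj h)⟩

theorem pairStat_flipOne {k : ℕ} {S : Finset ℕ} (hS : S.card = k) {w : ℕ → ℤ}
    (hw : w ∈ fill k S) {i j : ℕ} (hi : i ∈ S) (hj : j ∈ S) (hij : i ≠ j) :
    pairStat (flipOne w i) (flipOne w j) = pairStat (w i) (w j) := by
  obtain ⟨h1, h2, h3⟩ := natAbs_ne_of_mem_fill hS hw hi hj hij
  unfold pairStat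
  simp only [(flipOne_lt h2 h1 h3.symm).1, (flipOne_lt h1 h2 h3).2.1]

theorem ascending_flipOne {k : ℕ} {I S : Finset ℕ} (hS : S.card = k) {w : ℕ → ℤ}
    (hw : w ∈ fill k S) : Ascending I S (flipOne w) ↔ Ascending I S w := by
  unfold Ascending
  refine and_congr ?_ ?_
  · refine forall₄_congr fun i _ hi hi' => ?_
    obtain ⟨h1, h2, h3⟩ := natAbs_ne_of_mem_fill hS hw hi hi' (by omega)
    exact (flipOne_lt h1 h2 h3).1
  · refine forall₃_congr fun _ hi hi' => ?_
    obtain ⟨h1, h2, h3⟩ := natAbs_ne_of_mem_fill hS hw hi hi' (by omega)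
    exact (flipOne_lt h1 h2 h3).2.2

theorem negCount_flipOne {k : ℕ} {S : Finset ℕ} (hS : S.card = k) (hk : 1 ≤ k) {w : ℕ → ℤ}
    (hw : w ∈ fill k S) : Even (negCount S (flipOne w)) ↔ ¬Even (negCount S w) := by
  have hw' := (mem_fill hS).1 hw
  obtain ⟨p, hp, hp1⟩ := exists_natAbs_eq hS hw'.2.1 hw'.2.2 le_rfl hk
  unfold negCount
  rw [Finset.card_filter, Finset.card_filter, ← Finset.add_sum_erase _ _ hp,
    ← Finset.add_sum_erase S (fun i => if w i < 0 then 1 else 0) hp]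
  have : ∑ i ∈ S.erase p, (if flipOne w i < 0 then 1 else 0) =
      ∑ i ∈ S.erase p, (if w i < 0 then 1 else 0) := by
    refine Finset.sum_congr rfl fun i hi => ?_
    have h1 := natAbs_ne_of_mem_fill hS hw (Finset.mem_of_mem_erase hi) hp
      (Finset.ne_of_mem_erase hi)
    have h2 : flipOne w i = w i := if_neg (by omega)
    rw [h2]
  have h3 : flipOne w p = -w p := if_pos hp1
  rw [this, h3, Nat.even_iff, Nat.even_iff]
  split_ifs <;> omega

/-- Changing the sign of the value of absolute value `1` preserves both lengths and the ascent
conditions, and it changes the parity of the number of negative values. So the sum over the even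
signed permutations is half of the sum over all fillings. -/
theorem two_mul_sum_quotient (x : K) {n : ℕ} (hn : 2 ≤ n) {I : Finset ℕ}
    (hI : I ⊆ Finset.range n) :
    2 * ∑ σ ∈ (finite_quotient n I).toFinset, (-1) ^ len n σ * x ^ oddLen n σ =
      signedSum x I n (Finset.Icc 1 n) := by
  have hS : (Finset.Icc 1 n).card = n := by simp
  rw [← sum_fill_eq_signedSum x I hS, sum_quotient_eq x hn hI,
    ← Finset.sum_filter_add_sum_filter_not (fill n (Finset.Icc 1 n))
      (fun w => Even (negCount (Finset.Icc 1 n) w)), two_mul]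
  congr 1
  refine Finset.sum_nbij' flipOne flipOne ?_ ?_ (fun w _ => flipOne_flipOne w)
    (fun w _ => flipOne_flipOne w) ?_
  · intro w hw
    rw [Finset.mem_filter] at hw ⊢
    exact ⟨flipOne_mem_fill hS hw.1, by rw [negCount_flipOne hS (by omega) hw.1, not_not]; exact hw.2⟩
  · intro w hw
    rw [Finset.mem_filter] at hw ⊢
    exact ⟨flipOne_mem_fill hS hw.1, by rw [negCount_flipOne hS (by omega) hw.1]; exact hw.2⟩
  · intro w hw
    rw [Finset.mem_filter] at hw
    have h1 : inv (Finset.Icc 1 n) (flipOne w) = inv (Finset.Icc 1 n) w := by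
      refine Finset.sum_congr rfl fun i hi => Finset.sum_congr rfl fun j hj => ?_
      split_ifs with h
      · exact pairStat_flipOne hS hw.1 hi hj (by omega)
      · rfl
    have h2 : oddInv (Finset.Icc 1 n) (flipOne w) = oddInv (Finset.Icc 1 n) w := by
      refine Finset.sum_congr rfl fun i hi => Finset.sum_congr rfl fun j hj => ?_
      split_ifs with h
      · exact pairStat_flipOne hS hw.1 hi hj (by omega)
      · rfl
    simp only [ascending_flipOne hS hw.1, h1, h2]

/-- The diagram automorphism interchanging the generators `s_0` and `s_1` carries the case
`0 ∈ I`, `1 ∉ I` to a case with `0 ∉ I`. On fillings it changes the sign of the first value. -/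
theorem signedSum_swap_zero_one (x : K) {n : ℕ} (hn : 2 ≤ n) {I : Finset ℕ} (h0 : 0 ∈ I)
    (h1 : 1 ∉ I) : signedSum x I n (Finset.Icc 1 n) =
      signedSum x (I.erase 0 ∪ {1}) n (Finset.Icc 1 n) := by
  have hS : (Finset.Icc 1 n).card = n := by simp
  have h1S : 1 ∈ Finset.Icc 1 n := by simp; omega
  have h2S : 2 ∈ Finset.Icc 1 n := by simp; omega
  rw [← sum_fill_eq_signedSum x _ hS, ← sum_fill_eq_signedSum x _ hS]
  have hinvol : ∀ w : ℕ → ℤ, Function.update (Function.update w 1 (-w 1)) 1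
      (-(Function.update w 1 (-w 1)) 1) = w := by
    intro w; simp
  have habs : ∀ (w : ℕ → ℤ) (i : ℕ), (Function.update w 1 (-w 1) i).natAbs = (w i).natAbs := by
    intro w i
    by_cases hi : i = 1
    · rw [hi]; simp
    · rw [Function.update_of_ne hi]
  have hmaps : ∀ w ∈ fill n (Finset.Icc 1 n),
      Function.update w 1 (-w 1) ∈ fill n (Finset.Icc 1 n) := by
    intro w hw
    rw [mem_fill hS] at hw ⊢
    simp only [habs]
    refine ⟨fun i hi => ?_, hw.2⟩
    rw [← Int.natAbs_eq_zero, habs, hw.1 i hi]; rfl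
  refine Finset.sum_nbij' (fun w => Function.update w 1 (-w 1))
    (fun w => Function.update w 1 (-w 1)) hmaps hmaps (fun w _ => hinvol w)
    (fun w _ => hinvol w) ?_
  intro w hw
  have hstat : ∀ i ∈ Finset.Icc 1 n, ∀ j, i < j →
      pairStat (Function.update w 1 (-w 1) i) (Function.update w 1 (-w 1) j) =
        pairStat (w i) (w j) := by
    intro i hi j hij
    rw [Finset.mem_Icc] at hi
    rw [Function.update_of_ne (show j ≠ 1 by omega)]
    by_cases hi1 : i = 1
    · rw [hi1, Function.update_self]
      unfold pairStat
      split_ifs <;> omega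
    · rw [Function.update_of_ne hi1]
  have e1 : inv (Finset.Icc 1 n) (Function.update w 1 (-w 1)) = inv (Finset.Icc 1 n) w := by
    refine Finset.sum_congr rfl fun i hi => Finset.sum_congr rfl fun j _ => ?_
    split_ifs with h
    · exact hstat i hi j h
    · rfl
  have e2 : oddInv (Finset.Icc 1 n) (Function.update w 1 (-w 1)) = oddInv (Finset.Icc 1 n) w := by
    refine Finset.sum_congr rfl fun i hi => Finset.sum_congr rfl fun j _ => ?_
    split_ifs with h
    · exact hstat i hi j h.1
    · rfl
  have e3 : Ascending (I.erase 0 ∪ {1}) (Finset.Icc 1 n) (Function.update w 1 (-w 1)) ↔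
      Ascending I (Finset.Icc 1 n) w := by
    unfold Ascending
    simp only [Finset.mem_union, Finset.mem_erase, Finset.mem_singleton]
    constructor
    · rintro ⟨h2, -⟩
      refine ⟨fun i hi hiS hiS' => ?_, fun _ _ _ => ?_⟩
      · have hi1 : i ≠ 1 := fun h => h1 (h ▸ hi)
        have hi0 : 1 ≤ i := (Finset.mem_Icc.1 hiS).1
        have := h2 i (Or.inl ⟨by omega, hi⟩) hiS hiS'
        rwa [Function.update_of_ne hi1, Function.update_of_ne (by omega)] at this
      · have := h2 1 (Or.inr rfl) h1S h2S
        rw [Function.update_self, Function.update_of_ne (by omega)] at this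
        norm_num at this
        omega
    · rintro ⟨h2, h3⟩
      refine ⟨fun i hi hiS hiS' => ?_, fun h => by omega⟩
      rcases hi with hi | rfl
      · have hi1 : i ≠ 1 := fun h => h1 (h ▸ hi.2)
        rw [Function.update_of_ne hi1, Function.update_of_ne (by omega)]
        exact h2 i hi.2 hiS hiS'
      · rw [Function.update_self, Function.update_of_ne (by omega)]
        have := h3 h0 h1S h2S
        norm_num
        omega
  simp only [e1, e2, e3]

end

/-! ### Alternating arrangements -/

section
variable {K : Type*} [Field K]

/-- The sum of `(-1)^ℓ x^L` over the ascending unsigned arrangements of `k` values on a set `S` of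
`k` positions such that the parities of the positions of the values `1, …, k` alternate, starting
with the parity of `β`. -/
def altSum (x : K) (I : Finset ℕ) (β : ℕ) : ℕ → Finset ℕ → K
  | 0, _ => 1
  | k + 1, S => ∑ p ∈ S, if TopFree I S p ∧ (p + β + k) % 2 = 0 then
      topWeight x S p * altSum x I β k (S.erase p) else 0

/-- The contribution of the position `p` to `(-1)^ℓ x^L` if the smallest value stands at `p`. -/
def botWeight (x : K) (S : Finset ℕ) (p : ℕ) : K := (-1) ^ left S p * x ^ oppLeft S p

theorem altSum_congr (x : K) (I : Finset ℕ) {β β' : ℕ} (h : β % 2 = β' % 2) (k : ℕ)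
    (S : Finset ℕ) : altSum x I β k S = altSum x I β' k S := by
  induction k generalizing S with
  | zero => rfl
  | succ k ih =>
    unfold altSum
    refine Finset.sum_congr rfl fun p _ => ?_
    rw [ih]
    refine if_congr (and_congr_right fun _ => ?_) rfl rfl
    omega

theorem card_filter_erase {S : Finset ℕ} {q : ℕ} (hq : q ∈ S) (P : ℕ → Prop) [DecidablePred P] :
    (S.filter P).card = ((S.erase q).filter P).card + if P q then 1 else 0 := by
  rw [Finset.card_filter, Finset.card_filter, Finset.sum_erase_add _ _ hq]

theorem topWeight_erase_of_lt (x : K) {S : Finset ℕ} {p q : ℕ} (hq : q ∈ S) (h : q < p) :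
    topWeight x (S.erase q) p = topWeight x S p := by
  unfold topWeight right oppRight
  rw [card_filter_erase hq, card_filter_erase (S := S) hq, if_neg (by omega), if_neg (by omega),
    add_zero, add_zero]

theorem topWeight_erase_of_gt (x : K) {S : Finset ℕ} {p q : ℕ} (hq : q ∈ S) (h : p < q) :
    topWeight x S p = -(x ^ ((p + q) % 2)) * topWeight x (S.erase q) p := by
  unfold topWeight right oppRight
  rw [card_filter_erase hq, card_filter_erase (S := S) hq, if_pos h]
  rcases Nat.mod_two_eq_zero_or_one (p + q) with h2 | h2 <;> simp [h, h2, pow_succ]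
  ring

theorem botWeight_erase_of_gt (x : K) {S : Finset ℕ} {p q : ℕ} (hq : q ∈ S) (h : p < q) :
    botWeight x (S.erase q) p = botWeight x S p := by
  unfold botWeight left oppLeft
  rw [card_filter_erase hq, card_filter_erase (S := S) hq, if_neg (by omega), if_neg (by omega),
    add_zero, add_zero]

theorem botWeight_erase_of_lt (x : K) {S : Finset ℕ} {p q : ℕ} (hq : q ∈ S) (h : q < p) :
    botWeight x S p = -(x ^ ((p + q) % 2)) * botWeight x (S.erase q) p := by
  unfold botWeight left oppLeft
  rw [card_filter_erase hq, card_filter_erase (S := S) hq, if_pos h]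
  rcases Nat.mod_two_eq_zero_or_one (p + q) with h2 | h2 <;> simp [h, h2, pow_succ]
  ring

theorem topFree_erase {I S : Finset ℕ} {p q : ℕ} (h : q ≠ p + 1) :
    TopFree I (S.erase q) p ↔ TopFree I S p := by
  unfold TopFree
  simp [h.symm]

theorem botFree_erase {I S : Finset ℕ} {p q : ℕ} (h : q + 1 ≠ p) :
    BotFree I (S.erase q) p ↔ BotFree I S p := by
  unfold BotFree
  refine forall₃_congr fun i _ hi => ?_
  have : i ≠ q := by omega
  simp [this]

theorem sum_sum_erase_comm {M : Type*} [AddCommMonoid M] (S : Finset ℕ) (F : ℕ → ℕ → M) :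
    ∑ p ∈ S, ∑ q ∈ S.erase p, F p q = ∑ q ∈ S, ∑ p ∈ S.erase q, F p q := by
  refine Finset.sum_comm' fun p q => ?_
  simp only [Finset.mem_erase]
  constructor
  · rintro ⟨h1, h2, h3⟩
    exact ⟨⟨h2.symm, h1⟩, h3⟩
  · rintro ⟨⟨h1, h2⟩, h3⟩
    exact ⟨h2, h1.symm, h3⟩

/-- The alternating sums may also be computed by removing the smallest value. -/
theorem altSum_succ_eq_bot (x : K) (I : Finset ℕ) (β k : ℕ) {S : Finset ℕ} (hS : S.card = k + 1) :
    altSum x I β (k + 1) S = ∑ p ∈ S, if BotFree I S p ∧ (p + β) % 2 = 0 then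
      botWeight x S p * altSum x I (β + 1) k (S.erase p) else 0 := by
  induction k generalizing S with
  | zero =>
    obtain ⟨p, rfl⟩ := Finset.card_eq_one.1 hS
    have h1 : BotFree I {p} p := fun i _ hi => by simp; omega
    simp [altSum, h1, TopFree, topWeight, botWeight, right, left, oppRight, oppLeft,
      Finset.filter_singleton]
  | succ k ih =>
    have hcard : ∀ p ∈ S, (S.erase p).card = k + 1 := fun p hp => by
      rw [Finset.card_erase_of_mem hp, hS]; rfl
    have e1 : altSum x I β (k + 1 + 1) S = ∑ p ∈ S, ∑ q ∈ S.erase p,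
        if TopFree I S p ∧ (p + β + (k + 1)) % 2 = 0 then topWeight x S p *
          (if BotFree I (S.erase p) q ∧ (q + β) % 2 = 0 then botWeight x (S.erase p) q *
            altSum x I (β + 1) k ((S.erase p).erase q) else 0) else 0 := by
      rw [altSum]
      refine Finset.sum_congr rfl fun p hp => ?_
      split_ifs
      · rw [ih (hcard p hp), Finset.mul_sum]
      · simp
    have e2 : (∑ p ∈ S, if BotFree I S p ∧ (p + β) % 2 = 0 then
        botWeight x S p * altSum x I (β + 1) (k + 1) (S.erase p) else 0) =
        ∑ q ∈ S, ∑ p ∈ S.erase q, if BotFree I S q ∧ (q + β) % 2 = 0 then botWeight x S q *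
          (if TopFree I (S.erase q) p ∧ (p + (β + 1) + k) % 2 = 0 then topWeight x (S.erase q) p *
            altSum x I (β + 1) k ((S.erase q).erase p) else 0) else 0 := by
      refine Finset.sum_congr rfl fun q hq => ?_
      split_ifs
      · rw [altSum, Finset.mul_sum]
      · simp
    rw [e1, e2, sum_sum_erase_comm]
    refine Finset.sum_congr rfl fun q hq => Finset.sum_congr rfl fun p hp => ?_
    rw [Finset.mem_erase] at hp
    rw [show p + β + (k + 1) = p + (β + 1) + k by ring, Finset.erase_right_comm]
    rcases lt_or_gt_of_ne hp.1 with h | h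
    · -- the two positions interact if they are adjacent and tied by an ascent condition
      by_cases h1 : q = p + 1 ∧ p ∈ I
      · have h2 : ¬TopFree I S p := fun h3 => h3 h1.2 (h1.1 ▸ hq)
        have h3 : ¬BotFree I S q := fun h3 => h3 p h1.2 h1.1.symm hp.2
        simp [h2, h3]
      · have h2 : TopFree I (S.erase q) p ↔ TopFree I S p := by
          by_cases h3 : q = p + 1
          · have : p ∉ I := fun h4 => h1 ⟨h3, h4⟩
            simp [TopFree, this]
          · exact topFree_erase h3
        have h3 : BotFree I (S.erase p) q ↔ BotFree I S q := by
          by_cases h3 : p + 1 = q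
          · have : p ∉ I := fun h4 => h1 ⟨h3.symm, h4⟩
            unfold BotFree
            refine forall₃_congr fun i hi hi' => ?_
            have : i ≠ p := fun h5 => this (h5 ▸ hi)
            simp [this]
          · exact botFree_erase h3
        simp only [h2, h3]
        rw [topWeight_erase_of_gt x hq h, botWeight_erase_of_lt x hp.2 h, add_comm q p]
        by_cases h4 : TopFree I S p ∧ (p + (β + 1) + k) % 2 = 0 <;>
        by_cases h5 : BotFree I S q ∧ (q + β) % 2 = 0 <;> simp only [h4, h5, and_self, if_true,
          if_false, mul_zero]
        ring
    · simp only [topFree_erase (show q ≠ p + 1 by omega), botFree_erase (show p + 1 ≠ q by omega)]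
      rw [topWeight_erase_of_lt x hq h, botWeight_erase_of_gt x hp.2 h]
      by_cases h4 : TopFree I S p ∧ (p + (β + 1) + k) % 2 = 0 <;>
      by_cases h5 : BotFree I S q ∧ (q + β) % 2 = 0 <;> simp only [h4, h5, and_self, if_true,
        if_false, mul_zero]
      ring

/-- Alternation determines the number of positions of each parity. -/
theorem opp_of_altSum_ne_zero {x : K} {I : Finset ℕ} {β k : ℕ} {S : Finset ℕ} (hS : S.card = k)
    (h : altSum x I β k S ≠ 0) (p : ℕ) :
    opp S p = (k + (p + β) % 2) / 2 := by
  induction k generalizing S with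
  | zero =>
    rw [Finset.card_eq_zero] at hS
    simp [hS, opp]
  | succ k ih =>
    rw [altSum] at h
    obtain ⟨q, hq, h1⟩ := Finset.exists_ne_zero_of_sum_ne_zero h
    have hcard : (S.erase q).card = k := by rw [Finset.card_erase_of_mem hq, hS]; rfl
    have h2 : TopFree I S q ∧ (q + β + k) % 2 = 0 := by
      by_contra h2
      rw [if_neg h2] at h1
      exact h1 rfl
    rw [if_pos h2] at h1
    have h3 := ih hcard (right_ne_zero_of_mul h1)
    rw [opp, card_filter_erase hq, ← opp, h3]
    split_ifs <;> omega

variable [CharZero K]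

/-- An antisymmetric function sums to zero over the ordered pairs of distinct elements. -/
theorem sum_antisymm (S : Finset ℕ) (F : ℕ → ℕ → K)
    (h : ∀ p ∈ S, ∀ q ∈ S, p < q → F p q = -F q p) : ∑ p ∈ S, ∑ q ∈ S.erase p, F p q = 0 := by
  have h1 : ∑ p ∈ S, ∑ q ∈ S.erase p, F p q = -∑ p ∈ S, ∑ q ∈ S.erase p, F p q := by
    conv_lhs => rw [sum_sum_erase_comm]
    rw [← Finset.sum_neg_distrib]
    refine Finset.sum_congr rfl fun p hp => ?_
    rw [← Finset.sum_neg_distrib]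
    refine Finset.sum_congr rfl fun q hq => ?_
    rw [Finset.mem_erase] at hq
    rcases lt_or_gt_of_ne hq.1 with h2 | h2
    · exact h q hq.2 p hp h2
    · rw [h p hp q hq.2 h2, neg_neg]
  exact self_eq_neg.1 h1

/-- If the two largest values stand at positions of the same parity, then exchanging them changes
the sign of the contribution. -/
theorem altSum_top_cancel (x : K) (I : Finset ℕ) (β k : ℕ) (S : Finset ℕ) :
    ∑ p ∈ S, (if TopFree I S p ∧ (p + β + k) % 2 = 0 then
      topWeight x S p * altSum x I β (k + 1) (S.erase p) else 0) = 0 := by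
  refine Eq.trans ?_ (sum_antisymm S (fun p q => if TopFree I S p ∧ (p + β + k) % 2 = 0 then
    topWeight x S p * (if TopFree I (S.erase p) q ∧ (q + β + k) % 2 = 0 then
      topWeight x (S.erase p) q * altSum x I β k ((S.erase p).erase q) else 0) else 0) ?_)
  · refine Finset.sum_congr rfl fun p _ => ?_
    split_ifs
    · rw [altSum, Finset.mul_sum]
    · simp
  · intro p hp q hq hpq
    by_cases h1 : (p + β + k) % 2 = 0
    · by_cases h2 : (q + β + k) % 2 = 0
      · simp only [topFree_erase (show p ≠ q + 1 by omega), topFree_erase (show q ≠ p + 1 by omega)]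
        rw [topWeight_erase_of_lt x hp hpq, topWeight_erase_of_gt x hq hpq, Finset.erase_right_comm,
          show (p + q) % 2 = 0 by omega]
        by_cases h3 : TopFree I S p <;> by_cases h4 : TopFree I S q <;> simp [h1, h2, h3, h4]
        ring
      · simp [h2]
    · simp [h1]

/-- If the two smallest values stand at positions of the same parity, then exchanging them changes
the sign of the contribution. -/
theorem altSum_bot_cancel (x : K) (I : Finset ℕ) (β k : ℕ) {S : Finset ℕ} (hS : S.card = k + 2) :
    ∑ p ∈ S, (if BotFree I S p ∧ (p + β) % 2 = 0 then
      botWeight x S p * altSum x I β (k + 1) (S.erase p) else 0) = 0 := by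
  have hcard : ∀ p ∈ S, (S.erase p).card = k + 1 := fun p hp => by
    rw [Finset.card_erase_of_mem hp, hS]; rfl
  refine Eq.trans ?_ (sum_antisymm S (fun p q => if BotFree I S p ∧ (p + β) % 2 = 0 then
    botWeight x S p * (if BotFree I (S.erase p) q ∧ (q + β) % 2 = 0 then
      botWeight x (S.erase p) q * altSum x I (β + 1) k ((S.erase p).erase q) else 0) else 0) ?_)
  · refine Finset.sum_congr rfl fun p hp => ?_
    split_ifs
    · rw [altSum_succ_eq_bot x I β k (hcard p hp), Finset.mul_sum]
    · simp
  · intro p hp q hq hpq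
    by_cases h1 : (p + β) % 2 = 0
    · by_cases h2 : (q + β) % 2 = 0
      · simp only [botFree_erase (show p + 1 ≠ q by omega), botFree_erase (show q + 1 ≠ p by omega)]
        rw [botWeight_erase_of_gt x hq hpq, botWeight_erase_of_lt x hp hpq, Finset.erase_right_comm,
          show (q + p) % 2 = 0 by omega]
        by_cases h3 : BotFree I S p <;> by_cases h4 : BotFree I S q <;> simp [h1, h2, h3, h4]
        ring
      · simp [h2]
    · simp [h1]

end

/-! ### Splitting off the first block -/

section
variable {K : Type*} [Field K]

theorem opp_Icc (s b p : ℕ) : opp (Finset.Icc (s + 1) (s + b)) p = (b + (p + s + 1) % 2) / 2 := by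
  unfold opp
  induction b with
  | zero => simp
  | succ b ih =>
    rw [← add_assoc, ← Finset.insert_Icc_right_eq_Icc_add_one (by omega), Finset.filter_insert]
    split_ifs with h
    · rw [Finset.card_insert_of_notMem (by simp), ih]; omega
    · rw [ih]; omega

theorem card_filter_union {A B : Finset ℕ} (h : Disjoint A B) (P : ℕ → Prop) [DecidablePred P] :
    ((A ∪ B).filter P).card = (A.filter P).card + (B.filter P).card := by
  rw [Finset.filter_union, Finset.card_union_of_disjoint (Finset.disjoint_filter_filter h)]

/-- The step of the recursion for the sum over fillings, for a set of positions consisting of an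
initial interval, ruled by all the ascent conditions it can satisfy, and of positions beyond. -/
theorem signedSum_union_succ (x : K) {I : Finset ℕ} {a₀ a k N : ℕ} (hI : ∀ i < a₀, i ∈ I)
    (ha₀ : a₀ ∉ I) (ha₁ : a₀ ≠ 1) (ha : a ≤ a₀) {S : Finset ℕ} (hS : S.card = k)
    (hlt : ∀ j ∈ S, a₀ < j) :
    signedSum x I (N + 1) (Finset.Icc 1 a ∪ S) =
      ∑ p ∈ S, (if TopFree I S p then
        topWeight x S p * signedSum x I N (Finset.Icc 1 a ∪ S.erase p) else 0) +
      ∑ p ∈ S, (if BotFree I S p then x ^ (2 * oppLeft S p + 2 * opp (Finset.Icc 1 a) p) *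
        topWeight x S p * signedSum x I N (Finset.Icc 1 a ∪ S.erase p) else 0) +
      if a = 0 then 0 else (if a = 1 then 2 else 1) * (-1) ^ k * x ^ opp S a *
        signedSum x I N (Finset.Icc 1 (a - 1) ∪ S) := by
  have hdisj : Disjoint (Finset.Icc 1 a) S := by
    rw [Finset.disjoint_left]
    intro j hj hj'
    have := hlt j hj'
    rw [Finset.mem_Icc] at hj
    omega
  have hmem : ∀ j, j ∈ Finset.Icc 1 a ∪ S ↔ (1 ≤ j ∧ j ≤ a) ∨ j ∈ S := by simp
  rw [signedSum, Finset.sum_union hdisj, add_comm, ← Finset.sum_add_distrib]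
  congr 1
  · refine Finset.sum_congr rfl fun p hp => ?_
    have hp' := hlt p hp
    have h1 : TopFree I (Finset.Icc 1 a ∪ S) p ↔ TopFree I S p := by
      unfold TopFree
      rw [hmem]
      exact imp_congr_right fun _ => not_congr ⟨fun h => h.resolve_left (by omega), Or.inr⟩
    have h2 : BotFree I (Finset.Icc 1 a ∪ S) p ∧ ZeroFree I (Finset.Icc 1 a ∪ S) p ↔
        BotFree I S p := by
      constructor
      · rintro ⟨h, _⟩ i hi hip hiS
        exact h i hi hip ((hmem i).2 (Or.inr hiS))
      · refine fun h => ⟨fun i hi hip hiS => ?_, ?_⟩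
        · rcases (hmem i).1 hiS with h3 | h3
          · have : i = a₀ := by omega
            exact ha₀ (this ▸ hi)
          · exact h i hi hip h3
        · rintro ⟨h0, -, -, h3⟩
          have : a₀ ≠ 0 := fun h4 => ha₀ (h4 ▸ h0)
          omega
    have h3 : topWeight x (Finset.Icc 1 a ∪ S) p = topWeight x S p := by
      unfold topWeight right oppRight
      rw [card_filter_union hdisj, card_filter_union hdisj,
        Finset.filter_false_of_mem (s := Finset.Icc 1 a) (p := fun j => p < j),
        Finset.filter_false_of_mem (s := Finset.Icc 1 a) (p := fun j => p < j ∧ (p + j) % 2 = 1)]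
      · simp
      · intro j hj; rw [Finset.mem_Icc] at hj; omega
      · intro j hj; rw [Finset.mem_Icc] at hj; omega
    have h4 : oppLeft (Finset.Icc 1 a ∪ S) p = oppLeft S p + opp (Finset.Icc 1 a) p := by
      unfold oppLeft opp
      rw [card_filter_union hdisj, add_comm]
      congr 2
      refine Finset.filter_congr fun j hj => ?_
      rw [Finset.mem_Icc] at hj
      exact and_iff_right (by omega)
    have h5 : (Finset.Icc 1 a ∪ S).erase p = Finset.Icc 1 a ∪ S.erase p := by
      rw [Finset.erase_union_distrib, Finset.erase_eq_of_notMem (s := Finset.Icc 1 a)]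
      rw [Finset.mem_Icc]; omega
    simp only [h1, h2, h3, h4, h5, mul_add]
    split_ifs <;> ring
  · rcases Nat.eq_zero_or_pos a with rfl | hpos
    · simp
    rw [if_neg (by omega), Finset.sum_eq_single_of_mem a (by simp; omega)]
    · have h1 : TopFree I (Finset.Icc 1 a ∪ S) a := by
        intro haI h
        rcases (hmem _).1 h with h | h
        · omega
        · have := hlt _ h
          have : a = a₀ := by omega
          exact ha₀ (this ▸ haI)
      have h3 : topWeight x (Finset.Icc 1 a ∪ S) a = (-1) ^ k * x ^ opp S a := by
        unfold topWeight right oppRight opp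
        rw [card_filter_union hdisj, card_filter_union hdisj,
          Finset.filter_false_of_mem (s := Finset.Icc 1 a) (p := fun j => a < j),
          Finset.filter_false_of_mem (s := Finset.Icc 1 a) (p := fun j => a < j ∧ (a + j) % 2 = 1),
          Finset.filter_true_of_mem (s := S) (p := fun j => a < j), hS,
          Finset.filter_congr (s := S) (q := fun j => (a + j) % 2 = 1)]
        · simp only [Finset.card_empty, zero_add]
        · intro j hj
          have := hlt j hj
          exact and_iff_right (by omega)
        · intro j hj; have := hlt j hj; omega
        · intro j hj; rw [Finset.mem_Icc] at hj; omega
        · intro j hj; rw [Finset.mem_Icc] at hj; omega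
      have h5 : (Finset.Icc 1 a ∪ S).erase a = Finset.Icc 1 (a - 1) ∪ S := by
        rw [Finset.erase_union_distrib, Finset.erase_eq_of_notMem (s := S)]
        · congr 1
          ext j
          simp only [Finset.mem_erase, Finset.mem_Icc]
          omega
        · intro h; have := hlt a h; omega
      rw [if_pos h1, h3, h5]
      by_cases ha2 : a = 1
      · subst ha2
        have h2 : BotFree I (Finset.Icc 1 1 ∪ S) 1 ∧ ZeroFree I (Finset.Icc 1 1 ∪ S) 1 := by
          refine ⟨fun i _ hi h => ?_, ?_⟩
          · rcases (hmem _).1 h with h | h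
            · omega
            · have := hlt _ h; omega
          · rintro ⟨-, -, h, -⟩
            rcases (hmem _).1 h with h | h
            · omega
            · have := hlt _ h; omega
        have h4 : oppLeft (Finset.Icc 1 1 ∪ S) 1 = 0 := by
          unfold oppLeft
          rw [Finset.card_eq_zero]
          refine Finset.filter_false_of_mem fun j hj => ?_
          rcases (hmem _).1 hj with h | h
          · omega
          · have := hlt _ h; omega
        rw [if_pos h2, if_pos rfl, h4]
        ring
      · have h2 : ¬(BotFree I (Finset.Icc 1 a ∪ S) a ∧ ZeroFree I (Finset.Icc 1 a ∪ S) a) := by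
          rintro ⟨h, -⟩
          exact h (a - 1) (hI _ (by omega)) (by omega) ((hmem _).2 (by omega))
        rw [if_neg h2, if_neg ha2]
        ring
    · intro p hp hpa
      rw [Finset.mem_Icc] at hp
      have h1 : ¬TopFree I (Finset.Icc 1 a ∪ S) p :=
        fun h => h (hI p (by omega)) ((hmem _).2 (by omega))
      have h2 : ¬(BotFree I (Finset.Icc 1 a ∪ S) p ∧ ZeroFree I (Finset.Icc 1 a ∪ S) p) := by
        rintro ⟨h, h'⟩
        by_cases hp1 : p = 1
        · exact h' ⟨hI 0 (by omega), (hmem _).2 (by omega), (hmem _).2 (by omega), Or.inl hp1⟩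
        · exact h (p - 1) (hI _ (by omega)) (by omega) ((hmem _).2 (by omega))
      rw [if_neg h1, if_neg h2]
      ring

/-- The coefficients in the expansion of the sum over fillings in terms of the alternating sums:
the first block has length `a`, there are `k` further positions, and the smallest of their values
stands at a position with the parity of `β`. -/
def signedCoeff (x : K) : ℕ → ℕ → ℕ → K
  | 0, 0, _ => 1
  | 0, k + 1, β => signedCoeff x 0 k β + (-1) ^ k * x ^ ((k + 1) / 2) * signedCoeff x 0 k (β + 1)
  | a + 1, 0, β => (if a = 0 then 2 else 1) * signedCoeff x a 0 β
  | a + 1, k + 1, β => signedCoeff x (a + 1) k β +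
      (-1) ^ k * x ^ ((k + 1) / 2 + 2 * ((a + 1 + (β + 1) % 2) / 2)) *
        signedCoeff x (a + 1) k (β + 1) +
      (if a = 0 then 2 else 1) * (-1) ^ (k + 1) * x ^ ((k + 1 + (a + 1 + β) % 2) / 2) *
        signedCoeff x a (k + 1) β

theorem signedCoeff_congr (x : K) (a k : ℕ) {β β' : ℕ} (h : β % 2 = β' % 2) :
    signedCoeff x a k β = signedCoeff x a k β' := by
  induction a generalizing k β β' with
  | zero =>
    induction k generalizing β β' with
    | zero => rw [signedCoeff, signedCoeff]
    | succ k ih =>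
      rw [signedCoeff, signedCoeff, ih h, ih (show (β + 1) % 2 = (β' + 1) % 2 by omega)]
  | succ a iha =>
    induction k generalizing β β' with
    | zero => rw [signedCoeff, signedCoeff, iha 0 h]
    | succ k ih =>
      rw [signedCoeff, signedCoeff, ih h, ih (show (β + 1) % 2 = (β' + 1) % 2 by omega),
        iha (k + 1) h, show (β + 1) % 2 = (β' + 1) % 2 by omega,
        show (a + 1 + β) % 2 = (a + 1 + β') % 2 by omega]

theorem signedCoeff_zero (x : K) (a β : ℕ) :
    signedCoeff x a 0 β = if a = 0 then 1 else 2 := by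
  induction a with
  | zero => simp [signedCoeff]
  | succ a ih =>
    rw [signedCoeff, ih]
    by_cases h : a = 0 <;> simp [h]

/-- A form of the recursion for the coefficients common to the cases `a = 0` and `a > 0`. -/
theorem signedCoeff_succ (x : K) (a k β : ℕ) : signedCoeff x a (k + 1) β = signedCoeff x a k β +
      (-1) ^ k * x ^ ((k + 1) / 2 + 2 * ((a + (β + 1) % 2) / 2)) * signedCoeff x a k (β + 1) +
      if a = 0 then 0 else (if a = 1 then 2 else 1) * (-1) ^ (k + 1) *
        x ^ ((k + 1 + (a + β) % 2) / 2) * signedCoeff x (a - 1) (k + 1) β := by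
  cases a with
  | zero =>
    have : (0 + (β + 1) % 2) / 2 = 0 := by omega
    rw [signedCoeff, this]
    simp
  | succ a => simp [signedCoeff]

theorem signedSum_Icc (x : K) {I : Finset ℕ} {a₀ a : ℕ} (hI : ∀ i < a₀, i ∈ I)
    (ha₀ : a₀ ∉ I) (ha₁ : a₀ ≠ 1) (ha : a ≤ a₀) :
    signedSum x I a (Finset.Icc 1 a) = signedCoeff x a 0 0 := by
  induction a with
  | zero => rw [signedCoeff, signedSum]
  | succ a ih =>
    have := signedSum_union_succ x (N := a) hI ha₀ ha₁ ha (S := ∅) rfl (by simp)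
    simp only [Finset.union_empty, Finset.sum_empty, Nat.succ_ne_zero, if_false, zero_add,
      Nat.add_sub_cancel] at this
    rw [this, ih (by omega), signedCoeff]
    simp [opp]

/-- The weight of a negative value of largest absolute value at `p` is, up to a factor depending
only on the parity of `p`, the weight of a smallest value at `p`. -/
theorem topWeight_mul_pow_oppLeft (x : K) {S : Finset ℕ} {k p : ℕ} (hS : S.card = k + 1)
    (hp : p ∈ S) : x ^ (2 * oppLeft S p) * topWeight x S p =
      (-1) ^ k * x ^ opp S p * botWeight x S p := by
  have h1 : right S p + left S p = k := by
    unfold right left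
    rw [← Finset.card_union_of_disjoint, ← Finset.filter_or]
    · rw [show k = (S.erase p).card by rw [Finset.card_erase_of_mem hp, hS]; rfl]
      congr 1
      ext j
      simp only [Finset.mem_filter, Finset.mem_erase]
      rw [and_comm]
      refine and_congr_left fun _ => ?_
      omega
    · rw [Finset.disjoint_left]
      intro j hj hj'
      rw [Finset.mem_filter] at hj hj'
      omega
  have h2 : opp S p = oppRight S p + oppLeft S p := by
    unfold opp oppRight oppLeft
    rw [← Finset.card_union_of_disjoint, ← Finset.filter_or]
    · congr 1
      refine Finset.filter_congr fun j _ => ?_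
      omega
    · rw [Finset.disjoint_left]
      intro j hj hj'
      rw [Finset.mem_filter] at hj hj'
      omega
  have h3 : ((-1 : K)) ^ right S p = (-1) ^ k * (-1) ^ left S p := by
    rw [← h1, pow_add, mul_assoc, ← mul_pow]; simp
  unfold topWeight botWeight
  rw [h2, h3]
  ring

/-- The number of positions of `S` of given parity is forced if there are alternating arrangements
on `S`. -/
theorem pow_opp_mul_altSum (x : K) (I : Finset ℕ) (β : ℕ) {k : ℕ} {S : Finset ℕ}
    (hS : S.card = k) (p : ℕ) :
    x ^ opp S p * altSum x I β k S = x ^ ((k + (p + β) % 2) / 2) * altSum x I β k S := by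
  by_cases h : altSum x I β k S = 0
  · rw [h, mul_zero, mul_zero]
  · rw [opp_of_altSum_ne_zero hS h]

theorem altSum_singleton (x : K) (I : Finset ℕ) (β p : ℕ) :
    altSum x I β 1 {p} = if (p + β) % 2 = 0 then 1 else 0 := by
  simp [altSum, TopFree, topWeight, right, oppRight, Finset.filter_singleton]

variable [CharZero K]

/-- When the largest value is put on top of alternating arrangements, the result may fail to
alternate only in its last step; these contributions cancel. -/
theorem sum_topWeight_mul_altSum (x : K) (I : Finset ℕ) (β k : ℕ) {S : Finset ℕ} :
    ∑ p ∈ S, (if TopFree I S p then topWeight x S p * altSum x I β (k + 1) (S.erase p) else 0) =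
      altSum x I β (k + 2) S := by
  refine Eq.trans ?_ ((congrArg (altSum x I β (k + 2) S + ·) (altSum_top_cancel x I β k S)).trans
    (add_zero _))
  rw [altSum, ← Finset.sum_add_distrib]
  refine Finset.sum_congr rfl fun p _ => ?_
  rcases Nat.mod_two_eq_zero_or_one (p + β + k) with h | h
  · simp [h, show (p + β + (k + 1)) % 2 = 1 by omega]
  · simp [h, show (p + β + (k + 1)) % 2 = 0 by omega]

/-- When a new smallest value is put below alternating arrangements, the result may fail to
alternate only in its first step; these contributions cancel. -/
theorem sum_botWeight_mul_altSum (x : K) (I : Finset ℕ) (β k : ℕ) {S : Finset ℕ}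
    (hS : S.card = k + 2) (c : ℕ → K) (hc : ∀ p q, p % 2 = q % 2 → c p = c q) :
    ∑ p ∈ S, (if BotFree I S p then
        c p * (botWeight x S p * altSum x I β (k + 1) (S.erase p)) else 0) =
      c (β + 1) * altSum x I (β + 1) (k + 2) S := by
  have h0 := altSum_bot_cancel x I β k hS
  have h1 := altSum_succ_eq_bot x I (β + 1) (k + 1) hS
  refine Eq.trans ?_ ((congrArg (c (β + 1) * altSum x I (β + 1) (k + 2) S + c β * ·) h0).trans
    (by rw [mul_zero, add_zero]))
  rw [h1, Finset.mul_sum, Finset.mul_sum, ← Finset.sum_add_distrib]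
  refine Finset.sum_congr rfl fun p _ => ?_
  rw [altSum_congr x I (show (β + 1 + 1) % 2 = β % 2 by omega)]
  rcases Nat.mod_two_eq_zero_or_one (p + β) with h | h
  · rw [hc p β (by omega)]
    simp [h, show (p + (β + 1)) % 2 = 1 by omega]
  · rw [hc p (β + 1) (by omega)]
    simp [h, show (p + (β + 1)) % 2 = 0 by omega]

/-- The expansion of the sum over fillings when the positions beyond the first block are arranged
by their relative order. -/
theorem signedSum_union (x : K) {I : Finset ℕ} {a₀ : ℕ} (hI : ∀ i < a₀, i ∈ I)
    (ha₀ : a₀ ∉ I) (ha₁ : a₀ ≠ 1) {a k : ℕ} (ha : a ≤ a₀) {S : Finset ℕ} (hS : S.card = k + 1)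
    (hlt : ∀ j ∈ S, a₀ < j) :
    signedSum x I (a + k + 1) (Finset.Icc 1 a ∪ S) =
      signedCoeff x a (k + 1) 0 * altSum x I 0 (k + 1) S +
        signedCoeff x a (k + 1) 1 * altSum x I 1 (k + 1) S := by
  induction hN : a + k using Nat.strong_induction_on generalizing a k S with
  | _ N ih =>
  subst hN
  rw [signedSum_union_succ x hI ha₀ ha₁ ha hS hlt, signedCoeff_succ x a k 0, signedCoeff_succ x a k 1]
  have hopp : ∀ p, opp (Finset.Icc 1 a) p = (a + (p + 1) % 2) / 2 := fun p => by
    have := opp_Icc 0 a p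
    rwa [zero_add, zero_add, add_zero] at this
  -- the terms in which the largest absolute value stands in the first block
  have hthird : (if a = 0 then 0 else (if a = 1 then 2 else 1) * (-1) ^ (k + 1) * x ^ opp S a *
      signedSum x I (a + k) (Finset.Icc 1 (a - 1) ∪ S)) =
      (if a = 0 then 0 else (if a = 1 then 2 else 1) * (-1) ^ (k + 1) *
        x ^ ((k + 1 + (a + 0) % 2) / 2) * signedCoeff x (a - 1) (k + 1) 0) *
          altSum x I 0 (k + 1) S +
      (if a = 0 then 0 else (if a = 1 then 2 else 1) * (-1) ^ (k + 1) *
        x ^ ((k + 1 + (a + 1) % 2) / 2) * signedCoeff x (a - 1) (k + 1) 1) *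
          altSum x I 1 (k + 1) S := by
    rcases Nat.eq_zero_or_pos a with rfl | hpos
    · simp
    · have h1 := ih (a - 1 + k) (by omega) (by omega) hS hlt rfl
      rw [show a - 1 + k + 1 = a + k by omega] at h1
      have h2 := pow_opp_mul_altSum x I 0 hS a
      have h3 := pow_opp_mul_altSum x I 1 hS a
      simp only [if_neg (show ¬a = 0 by omega)]
      rw [h1]
      linear_combination (if a = 1 then 2 else 1) * (-1) ^ (k + 1) *
        (signedCoeff x (a - 1) (k + 1) 0 * h2 + signedCoeff x (a - 1) (k + 1) 1 * h3)
  rw [hthird]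
  have hcard : ∀ p ∈ S, (S.erase p).card = k := fun p hp => by
    rw [Finset.card_erase_of_mem hp, hS]; rfl
  rcases k with _ | k
  · obtain ⟨p, rfl⟩ := Finset.card_eq_one.1 hS
    have h1 : BotFree I {p} p := fun i _ hi => by simp; omega
    have h2 : TopFree I {p} p := fun _ => by simp
    rw [Finset.sum_singleton, Finset.sum_singleton, if_pos h1, if_pos h2, Finset.erase_singleton,
      Finset.union_empty, add_zero, signedSum_Icc x hI ha₀ ha₁ ha, hopp,
      altSum_singleton, altSum_singleton]
    simp only [signedCoeff_zero]
    rcases Nat.mod_two_eq_zero_or_one p with h | h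
    · rw [show (p + 1) % 2 = 1 by omega, show (p + 0) % 2 = 0 by omega]
      simp [topWeight, right, oppRight, oppLeft, Finset.filter_singleton]
    · rw [show (p + 1) % 2 = 0 by omega, show (p + 0) % 2 = 1 by omega]
      simp [topWeight, right, oppRight, oppLeft, Finset.filter_singleton]
  · have hih : ∀ p ∈ S, signedSum x I (a + (k + 1)) (Finset.Icc 1 a ∪ S.erase p) =
        signedCoeff x a (k + 1) 0 * altSum x I 0 (k + 1) (S.erase p) +
          signedCoeff x a (k + 1) 1 * altSum x I 1 (k + 1) (S.erase p) := fun p hp =>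
      ih (a + k) (by omega) ha (hcard p hp) (fun j hj => hlt j (Finset.mem_of_mem_erase hj)) rfl
    have hfirst : ∑ p ∈ S, (if TopFree I S p then
        topWeight x S p * signedSum x I (a + (k + 1)) (Finset.Icc 1 a ∪ S.erase p) else 0) =
        signedCoeff x a (k + 1) 0 * altSum x I 0 (k + 2) S +
          signedCoeff x a (k + 1) 1 * altSum x I 1 (k + 2) S := by
      rw [← sum_topWeight_mul_altSum, ← sum_topWeight_mul_altSum, Finset.mul_sum, Finset.mul_sum,
        ← Finset.sum_add_distrib]
      refine Finset.sum_congr rfl fun p hp => ?_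
      split_ifs
      · rw [hih p hp]; ring
      · ring
    set c : ℕ → K := fun p => (-1) ^ (k + 1) * x ^ (opp S p + 2 * opp (Finset.Icc 1 a) p) with hc
    have hcc : ∀ p q, p % 2 = q % 2 → c p = c q := by
      intro p q hpq
      have h1 : ∀ S : Finset ℕ, opp S p = opp S q := fun S => by
        unfold opp
        congr 1
        refine Finset.filter_congr fun j _ => ?_
        omega
      rw [hc]
      simp only [h1]
    have hsecond : ∑ p ∈ S, (if BotFree I S p then
        x ^ (2 * oppLeft S p + 2 * opp (Finset.Icc 1 a) p) * topWeight x S p *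
          signedSum x I (a + (k + 1)) (Finset.Icc 1 a ∪ S.erase p) else 0) =
        signedCoeff x a (k + 1) 0 * (c 1 * altSum x I 1 (k + 2) S) +
          signedCoeff x a (k + 1) 1 * (c 2 * altSum x I 0 (k + 2) S) := by
      have h0 := sum_botWeight_mul_altSum x I 0 k hS c hcc
      have h1 := sum_botWeight_mul_altSum x I 1 k hS c hcc
      rw [altSum_congr x I (show (1 + 1) % 2 = 0 % 2 by omega)] at h1
      rw [zero_add] at h0
      rw [← h0, ← h1, Finset.mul_sum, Finset.mul_sum, ← Finset.sum_add_distrib]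
      refine Finset.sum_congr rfl fun p hp => ?_
      split_ifs
      · have h2 := topWeight_mul_pow_oppLeft x hS hp
        rw [hih p hp, pow_add, hc]
        simp only
        rw [pow_add]
        linear_combination x ^ (2 * opp (Finset.Icc 1 a) p) *
          (signedCoeff x a (k + 1) 0 * altSum x I 0 (k + 1) (S.erase p) +
            signedCoeff x a (k + 1) 1 * altSum x I 1 (k + 1) (S.erase p)) * h2
      · ring
    rw [hfirst, hsecond, hc]
    simp only [hopp]
    have h2 := pow_opp_mul_altSum x I 0 hS 2
    have h3 := pow_opp_mul_altSum x I 1 hS 1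
    rw [signedCoeff_congr x a (k + 1) (show (1 + 1) % 2 = 0 % 2 by omega)]
    simp only [Nat.reduceAdd, Nat.reduceMod, add_zero, zero_add] at h2 h3 ⊢
    simp only [pow_add x]
    linear_combination (-1) ^ (k + 1) * (x ^ (2 * ((a + 1) / 2)) * signedCoeff x a (k + 1) 1 * h2 +
      x ^ (2 * (a / 2)) * signedCoeff x a (k + 1) 0 * h3)

end

/-! ### Closed forms for the coefficients of the expansion -/

section
variable {K : Type*} [Field K]

/-- `(1 - q) (1 - q^2) ⋯ (1 - q^r)` for `q = x^2`. -/
def poch (x : K) (r : ℕ) : K := ∏ i ∈ Finset.range r, (1 - x ^ (2 * (i + 1)))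

theorem poch_zero (x : K) : poch x 0 = 1 := rfl

theorem poch_succ (x : K) (r : ℕ) : poch x (r + 1) = poch x r * (1 - x ^ (2 * (r + 1))) :=
  Finset.prod_range_succ _ _

/-- The coefficients of the expansion, doubled for an empty first block: this normalization makes
their recursion uniform. -/
def doubledCoeff (x : K) (a k β : ℕ) : K := (if a = 0 then 2 else 1) * signedCoeff x a k β

theorem doubledCoeff_zero (x : K) (a β : ℕ) : doubledCoeff x a 0 β = 2 := by
  rw [doubledCoeff, signedCoeff_zero]
  split_ifs <;> ring

theorem doubledCoeff_succ_zero (x : K) (a k : ℕ) :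
    doubledCoeff x (a + 1) (k + 1) 0 = doubledCoeff x (a + 1) k 0 +
      (-1) ^ k * x ^ ((k + 1) / 2 + 2 * ((a + 2) / 2)) * doubledCoeff x (a + 1) k 1 +
      (-1) ^ (k + 1) * x ^ ((k + 1 + (a + 1) % 2) / 2) * doubledCoeff x a (k + 1) 0 := by
  simp only [doubledCoeff, if_neg (Nat.succ_ne_zero a), one_mul]
  rw [signedCoeff]
  simp only [Nat.reduceMod, add_zero, zero_add]
  rw [show a + 1 + 1 = a + 2 from rfl]
  ring

theorem doubledCoeff_succ_one (x : K) (a k : ℕ) :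
    doubledCoeff x (a + 1) (k + 1) 1 = doubledCoeff x (a + 1) k 1 +
      (-1) ^ k * x ^ ((k + 1) / 2 + 2 * ((a + 1) / 2)) * doubledCoeff x (a + 1) k 0 +
      (-1) ^ (k + 1) * x ^ ((k + 1 + a % 2) / 2) * doubledCoeff x a (k + 1) 1 := by
  simp only [doubledCoeff, if_neg (Nat.succ_ne_zero a), one_mul]
  rw [signedCoeff, signedCoeff_congr x (a + 1) k (show (1 + 1) % 2 = 0 % 2 by omega)]
  simp only [Nat.reduceAdd, Nat.reduceMod, add_zero]
  rw [show (a + 1 + 1) % 2 = a % 2 by omega]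
  ring

/-- The closed forms for a first block of even length `2 α`, the position of the smallest value
beyond it having the parity of the first position beyond it (`β = 1`) or not (`β = 0`). -/
def EvenRow (x : K) (α : ℕ) : Prop :=
  (∀ μ, doubledCoeff x (2 * α) (2 * μ + 1) 1 * (poch x α ^ 2 * poch x μ) =
      2 * poch x (α + μ) ^ 2 * (1 + x ^ (2 * α)) ∧
    doubledCoeff x (2 * α) (2 * μ + 1) 0 * (poch x α ^ 2 * poch x μ) =
      2 * poch x (α + μ) ^ 2 * (2 * x ^ α)) ∧
  ∀ μ N, α + μ = N + 1 → doubledCoeff x (2 * α) (2 * μ) 1 * (poch x α ^ 2 * poch x μ) =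
      2 * poch x N ^ 2 * (1 - x ^ (N + 1)) ^ 2 * (1 + x ^ (2 * α) + 2 * x ^ (N + 1)) ∧
    doubledCoeff x (2 * α) (2 * μ) 0 * (poch x α ^ 2 * poch x μ) =
      2 * poch x N ^ 2 * (1 - x ^ (N + 1)) ^ 2 * (x ^ μ * (1 + x ^ (2 * α)) + 2 * x ^ α)

/-- The closed forms for a first block of odd length `2 α + 1`, the position of the smallest value
beyond it having the parity of the first position beyond it (`β = 0`) or not (`β = 1`). -/
def OddRow (x : K) (α : ℕ) : Prop :=
  ∀ μ, (doubledCoeff x (2 * α + 1) (2 * μ) 0 * (poch x α ^ 2 * poch x μ) =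
      2 * poch x (α + μ) ^ 2 ∧
    doubledCoeff x (2 * α + 1) (2 * μ) 1 * (poch x α ^ 2 * poch x μ) =
      2 * poch x (α + μ) ^ 2 * x ^ μ) ∧
  (doubledCoeff x (2 * α + 1) (2 * μ + 1) 0 * (poch x α ^ 2 * poch x μ) =
      2 * poch x (α + μ) ^ 2 * (1 - x ^ (α + μ + 1)) ^ 2 ∧
    doubledCoeff x (2 * α + 1) (2 * μ + 1) 1 * (poch x α ^ 2 * poch x μ) = 0)

theorem evenRow_zero (x : K) : EvenRow x 0 := by
  have h : ∀ μ, (∀ β, signedCoeff x 0 (2 * μ + 1) β = 2 * poch x μ) ∧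
      ∀ β, signedCoeff x 0 (2 * μ + 2) β = 2 * poch x μ * (1 - x ^ (μ + 1)) := by
    have step : ∀ μ, (∀ β, signedCoeff x 0 (2 * μ + 1) β = 2 * poch x μ) →
        ∀ β, signedCoeff x 0 (2 * μ + 2) β = 2 * poch x μ * (1 - x ^ (μ + 1)) := by
      intro μ h β
      rw [signedCoeff, h, h, show (2 * μ + 1 + 1) / 2 = μ + 1 by omega, pow_succ, pow_mul]
      ring
    intro μ
    induction μ with
    | zero =>
      have h0 : ∀ β, signedCoeff x 0 (2 * 0 + 1) β = 2 * poch x 0 := by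
        intro β
        rw [signedCoeff, signedCoeff, signedCoeff]
        simp [poch_zero]
        norm_num
      exact ⟨h0, step 0 h0⟩
    | succ μ ih =>
      have h1 : ∀ β, signedCoeff x 0 (2 * (μ + 1) + 1) β = 2 * poch x (μ + 1) := by
        intro β
        rw [signedCoeff, show 2 * (μ + 1) = 2 * μ + 2 by ring, ih.2, ih.2,
          show (2 * μ + 2 + 1) / 2 = μ + 1 by omega, show 2 * μ + 2 = 2 * (μ + 1) by ring, pow_mul,
          poch_succ]
        ring
      exact ⟨h1, step _ h1⟩
  constructor
  · intro μ
    simp only [doubledCoeff, mul_zero, if_true, (h μ).1, poch_zero, zero_add, pow_zero]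
    constructor <;> ring
  · intro μ N hN
    obtain rfl : μ = N + 1 := by omega
    simp only [doubledCoeff, mul_zero, if_true, show 2 * (N + 1) = 2 * N + 2 by ring, (h N).2,
      poch_zero, pow_zero, poch_succ]
    constructor <;> ring

/-- Both columns are computed at once, by induction on the number of further positions. -/
theorem EvenRow.oddRow {x : K} {α : ℕ} (h : EvenRow x α) : OddRow x α := by
  obtain ⟨h1, h2⟩ := h
  have stepOdd : ∀ μ, (doubledCoeff x (2 * α + 1) (2 * μ) 0 * (poch x α ^ 2 * poch x μ) =
      2 * poch x (α + μ) ^ 2 ∧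
      doubledCoeff x (2 * α + 1) (2 * μ) 1 * (poch x α ^ 2 * poch x μ) =
        2 * poch x (α + μ) ^ 2 * x ^ μ) →
      (doubledCoeff x (2 * α + 1) (2 * μ + 1) 0 * (poch x α ^ 2 * poch x μ) =
        2 * poch x (α + μ) ^ 2 * (1 - x ^ (α + μ + 1)) ^ 2 ∧
      doubledCoeff x (2 * α + 1) (2 * μ + 1) 1 * (poch x α ^ 2 * poch x μ) = 0) := by
    rintro μ ⟨e1, e2⟩
    obtain ⟨e3, e4⟩ := h1 μ
    rw [doubledCoeff_succ_zero, doubledCoeff_succ_one, show (2 * μ + 1) / 2 = μ by omega,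
      show (2 * α + 2) / 2 = α + 1 by omega, show (2 * α + 1) / 2 = α by omega,
      show (2 * μ + 1 + (2 * α + 1) % 2) / 2 = μ + 1 by omega,
      show (2 * μ + 1 + 2 * α % 2) / 2 = μ by omega, pow_succ (-1 : K), pow_mul (-1 : K),
      neg_one_sq, one_pow]
    constructor
    · linear_combination e1 + x ^ (μ + 2 * (α + 1)) * e2 - x ^ (μ + 1) * e4
    · linear_combination e2 + x ^ (μ + 2 * α) * e1 - x ^ μ * e3
  intro μ
  induction μ with
  | zero =>
    have h0 : doubledCoeff x (2 * α + 1) (2 * 0) 0 * (poch x α ^ 2 * poch x 0) =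
        2 * poch x (α + 0) ^ 2 ∧
        doubledCoeff x (2 * α + 1) (2 * 0) 1 * (poch x α ^ 2 * poch x 0) =
          2 * poch x (α + 0) ^ 2 * x ^ 0 := by
      simp [doubledCoeff_zero, poch_zero]
    exact ⟨h0, stepOdd 0 h0⟩
  | succ μ ih =>
    obtain ⟨-, e1, e2⟩ := ih
    obtain ⟨e3, e4⟩ := h2 (μ + 1) (α + μ) (by omega)
    have h0 : doubledCoeff x (2 * α + 1) (2 * (μ + 1)) 0 * (poch x α ^ 2 * poch x (μ + 1)) =
        2 * poch x (α + (μ + 1)) ^ 2 ∧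
        doubledCoeff x (2 * α + 1) (2 * (μ + 1)) 1 * (poch x α ^ 2 * poch x (μ + 1)) =
          2 * poch x (α + (μ + 1)) ^ 2 * x ^ (μ + 1) := by
      rw [show 2 * (μ + 1) = 2 * μ + 1 + 1 by ring] at e3 e4 ⊢
      rw [← add_assoc α, poch_succ x (α + μ),
        doubledCoeff_succ_zero x _ (2 * μ + 1), doubledCoeff_succ_one x _ (2 * μ + 1),
        show (2 * μ + 1 + 1) / 2 = μ + 1 by omega, show (2 * α + 2) / 2 = α + 1 by omega,
        show (2 * α + 1) / 2 = α by omega,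
        show (2 * μ + 1 + 1 + (2 * α + 1) % 2) / 2 = μ + 1 by omega,
        show (2 * μ + 1 + 1 + 2 * α % 2) / 2 = μ + 1 by omega, pow_succ (-1 : K) (2 * μ + 1),
        pow_succ (-1 : K) (2 * μ), pow_mul (-1 : K), neg_one_sq, one_pow]
      constructor
      · rw [poch_succ x μ] at e4 ⊢
        linear_combination (1 - x ^ (2 * (μ + 1))) * (e1 - x ^ (μ + 1 + 2 * (α + 1)) * e2) +
          x ^ (μ + 1) * e4
      · rw [poch_succ x μ] at e3 ⊢
        linear_combination (1 - x ^ (2 * (μ + 1))) * (e2 - x ^ (μ + 1 + 2 * α) * e1) +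
          x ^ (μ + 1) * e3
    exact ⟨h0, stepOdd _ h0⟩

theorem OddRow.evenRow {x : K} {α : ℕ} (h : OddRow x α) : EvenRow x (α + 1) := by
  have stepOdd : ∀ μ, (doubledCoeff x (2 * (α + 1)) (2 * μ) 1 *
        (poch x (α + 1) ^ 2 * poch x μ) = 2 * poch x (α + μ) ^ 2 * (1 - x ^ (α + μ + 1)) ^ 2 *
          (1 + x ^ (2 * (α + 1)) + 2 * x ^ (α + μ + 1)) ∧
      doubledCoeff x (2 * (α + 1)) (2 * μ) 0 * (poch x (α + 1) ^ 2 * poch x μ) =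
        2 * poch x (α + μ) ^ 2 * (1 - x ^ (α + μ + 1)) ^ 2 *
          (x ^ μ * (1 + x ^ (2 * (α + 1))) + 2 * x ^ (α + 1))) →
      doubledCoeff x (2 * (α + 1)) (2 * μ + 1) 1 * (poch x (α + 1) ^ 2 * poch x μ) =
        2 * poch x (α + μ + 1) ^ 2 * (1 + x ^ (2 * (α + 1))) ∧
      doubledCoeff x (2 * (α + 1)) (2 * μ + 1) 0 * (poch x (α + 1) ^ 2 * poch x μ) =
        2 * poch x (α + μ + 1) ^ 2 * (2 * x ^ (α + 1)) := by
    rintro μ ⟨e1, e2⟩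
    obtain ⟨-, e3, e4⟩ := h μ
    rw [show 2 * (α + 1) = 2 * α + 1 + 1 by ring] at e1 e2 ⊢
    rw [doubledCoeff_succ_zero, doubledCoeff_succ_one, show (2 * μ + 1) / 2 = μ by omega,
      show (2 * α + 1 + 2) / 2 = α + 1 by omega, show (2 * α + 1 + 1) / 2 = α + 1 by omega,
      show (2 * μ + 1 + (2 * α + 1 + 1) % 2) / 2 = μ by omega,
      show (2 * μ + 1 + (2 * α + 1) % 2) / 2 = μ + 1 by omega, pow_succ (-1 : K), pow_mul (-1 : K),
      neg_one_sq, one_pow, poch_succ x (α + μ)]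
    rw [poch_succ x α] at e1 e2 ⊢
    constructor
    · linear_combination e1 + x ^ (μ + 2 * (α + 1)) * e2 -
        x ^ (μ + 1) * (1 - x ^ (2 * (α + 1))) ^ 2 * e4
    · linear_combination e2 + x ^ (μ + 2 * (α + 1)) * e1 -
        x ^ μ * (1 - x ^ (2 * (α + 1))) ^ 2 * e3
  have key : ∀ μ, doubledCoeff x (2 * (α + 1)) (2 * μ) 1 *
        (poch x (α + 1) ^ 2 * poch x μ) = 2 * poch x (α + μ) ^ 2 * (1 - x ^ (α + μ + 1)) ^ 2 *
          (1 + x ^ (2 * (α + 1)) + 2 * x ^ (α + μ + 1)) ∧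
      doubledCoeff x (2 * (α + 1)) (2 * μ) 0 * (poch x (α + 1) ^ 2 * poch x μ) =
        2 * poch x (α + μ) ^ 2 * (1 - x ^ (α + μ + 1)) ^ 2 *
          (x ^ μ * (1 + x ^ (2 * (α + 1))) + 2 * x ^ (α + 1)) := by
    intro μ
    induction μ with
    | zero =>
      simp only [mul_zero, doubledCoeff_zero, poch_zero, poch_succ, add_zero, pow_zero]
      constructor <;> ring
    | succ μ ih =>
      obtain ⟨e1, e2⟩ := stepOdd μ ih
      obtain ⟨⟨e3, e4⟩, -⟩ := h (μ + 1)
      rw [show 2 * (μ + 1) = 2 * μ + 1 + 1 by ring] at e3 e4 ⊢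
      rw [show 2 * (α + 1) = 2 * α + 1 + 1 by ring] at e1 e2 ⊢
      rw [← add_assoc α] at e3 e4 ⊢
      rw [doubledCoeff_succ_zero x _ (2 * μ + 1), doubledCoeff_succ_one x _ (2 * μ + 1),
        show (2 * μ + 1 + 1) / 2 = μ + 1 by omega, show (2 * α + 1 + 2) / 2 = α + 1 by omega,
        show (2 * α + 1 + 1) / 2 = α + 1 by omega,
        show (2 * μ + 1 + 1 + (2 * α + 1 + 1) % 2) / 2 = μ + 1 by omega,
        show (2 * μ + 1 + 1 + (2 * α + 1) % 2) / 2 = μ + 1 by omega,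
        pow_succ (-1 : K) (2 * μ + 1), pow_succ (-1 : K) (2 * μ), pow_mul (-1 : K), neg_one_sq,
        one_pow]
      rw [poch_succ x α] at e1 e2 ⊢
      rw [poch_succ x μ] at e3 e4 ⊢
      rw [poch_succ x (α + μ)] at e1 e2 e3 e4 ⊢
      constructor
      · linear_combination (1 - x ^ (2 * (μ + 1))) * (e1 - x ^ (μ + 1 + 2 * (α + 1)) * e2) +
          x ^ (μ + 1) * (1 - x ^ (2 * (α + 1))) ^ 2 * e4
      · linear_combination (1 - x ^ (2 * (μ + 1))) * (e2 - x ^ (μ + 1 + 2 * (α + 1)) * e1) +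
          x ^ (μ + 1) * (1 - x ^ (2 * (α + 1))) ^ 2 * e3
  constructor
  · intro μ
    rw [show α + 1 + μ = α + μ + 1 by ring]
    exact stepOdd μ (key μ)
  · intro μ N hN
    obtain rfl : N = α + μ := by omega
    exact key μ

theorem evenRow (x : K) (α : ℕ) : EvenRow x α := by
  induction α with
  | zero => exact evenRow_zero x
  | succ α ih => exact ih.oddRow.evenRow

theorem oddRow (x : K) (α : ℕ) : OddRow x α := (evenRow x α).oddRow

end

/-! ### Splitting off the last block of an alternating arrangement -/

section
variable {K : Type*} [Field K]

/-- The recursion for the alternating sum over `S` followed by a block: within the block the values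
increase, so the largest value stands in `S` or at the end of the block. -/
theorem altSum_union_succ (x : K) {I : Finset ℕ} (β : ℕ) {p₀ b₀ b N : ℕ}
    (hI : ∀ i, p₀ < i → i < p₀ + b₀ → i ∈ I) (hp₀ : p₀ ∉ I) (hb : b ≤ b₀) {S : Finset ℕ}
    (hle : ∀ j ∈ S, j ≤ p₀) :
    altSum x I β (N + 1) (S ∪ Finset.Icc (p₀ + 1) (p₀ + b)) =
      ∑ p ∈ S, (if TopFree I S p ∧ (p + β + N) % 2 = 0 then
        (-1) ^ b * x ^ ((b + (p + p₀ + 1) % 2) / 2) *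
          (topWeight x S p * altSum x I β N (S.erase p ∪ Finset.Icc (p₀ + 1) (p₀ + b))) else 0) +
      if b = 0 then 0 else if (p₀ + b + β + N) % 2 = 0 then
        altSum x I β N (S ∪ Finset.Icc (p₀ + 1) (p₀ + (b - 1))) else 0 := by
  have hdisj : Disjoint S (Finset.Icc (p₀ + 1) (p₀ + b)) := by
    rw [Finset.disjoint_left]
    intro j hj hj'
    have := hle j hj
    rw [Finset.mem_Icc] at hj'
    omega
  have hmem : ∀ j, j ∈ S ∪ Finset.Icc (p₀ + 1) (p₀ + b) ↔ j ∈ S ∨ (p₀ < j ∧ j ≤ p₀ + b) := by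
    simp
  rw [altSum, Finset.sum_union hdisj]
  congr 1
  · refine Finset.sum_congr rfl fun p hp => ?_
    have hp' := hle p hp
    have h1 : TopFree I (S ∪ Finset.Icc (p₀ + 1) (p₀ + b)) p ↔ TopFree I S p := by
      unfold TopFree
      rw [hmem]
      refine forall_congr' fun hpI => not_congr ⟨fun h => h.resolve_right fun h => ?_, Or.inl⟩
      have : p = p₀ := by omega
      exact hp₀ (this ▸ hpI)
    have h2 : right (S ∪ Finset.Icc (p₀ + 1) (p₀ + b)) p = right S p + b := by
      unfold right
      rw [card_filter_union hdisj, Finset.filter_true_of_mem (s := Finset.Icc _ _)]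
      · simp
      · intro j hj; rw [Finset.mem_Icc] at hj; omega
    have h3 : oppRight (S ∪ Finset.Icc (p₀ + 1) (p₀ + b)) p =
        oppRight S p + (b + (p + p₀ + 1) % 2) / 2 := by
      rw [← opp_Icc]
      unfold oppRight opp
      rw [card_filter_union hdisj]
      congr 2
      refine Finset.filter_congr fun j hj => ?_
      rw [Finset.mem_Icc] at hj
      exact and_iff_right (by omega)
    have h5 : (S ∪ Finset.Icc (p₀ + 1) (p₀ + b)).erase p =
        S.erase p ∪ Finset.Icc (p₀ + 1) (p₀ + b) := by
      rw [Finset.erase_union_distrib, Finset.erase_eq_of_notMem (s := Finset.Icc _ _)]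
      rw [Finset.mem_Icc]; omega
    simp only [h1, h5, topWeight, h2, h3, pow_add]
    split_ifs <;> ring
  · rcases Nat.eq_zero_or_pos b with rfl | hpos
    · simp
    rw [if_neg (by omega), Finset.sum_eq_single_of_mem (p₀ + b) (by simp; omega)]
    · have h1 : TopFree I (S ∪ Finset.Icc (p₀ + 1) (p₀ + b)) (p₀ + b) := by
        intro _ h
        rcases (hmem _).1 h with h | h
        · have := hle _ h; omega
        · omega
      have h2 : topWeight x (S ∪ Finset.Icc (p₀ + 1) (p₀ + b)) (p₀ + b) = 1 := by
        unfold topWeight right oppRight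
        rw [Finset.filter_false_of_mem, Finset.filter_false_of_mem]
        · simp
        · intro j hj h
          rcases (hmem _).1 hj with h' | h'
          · have := hle _ h'; omega
          · omega
        · intro j hj h
          rcases (hmem _).1 hj with h' | h'
          · have := hle _ h'; omega
          · omega
      have h3 : (S ∪ Finset.Icc (p₀ + 1) (p₀ + b)).erase (p₀ + b) =
          S ∪ Finset.Icc (p₀ + 1) (p₀ + (b - 1)) := by
        rw [Finset.erase_union_distrib, Finset.erase_eq_of_notMem (s := S)]
        · congr 1
          ext j
          simp only [Finset.mem_erase, Finset.mem_Icc]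
          omega
        · intro h; have := hle _ h; omega
      simp only [h1, h2, h3, true_and, one_mul]
    · intro p hp hpb
      rw [Finset.mem_Icc] at hp
      rw [if_neg]
      rintro ⟨h, -⟩
      exact h (hI p (by omega) (by omega)) ((hmem _).2 (Or.inr (by omega)))

/-- The coefficients in the expansion of the alternating sum over `k` positions followed by a block
of length `b`. The parity of `u` tells whether the smallest value stands at a position with the
parity of the first position of the block (`u` even) or not; that of `v` tells whether the smallest
value and the smallest among the values outside the block stand at positions of equal parity. -/
def blockCoeff (x : K) (u v : ℕ) : ℕ → ℕ → K
  | 0, 0 => 1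
  | 0, b + 1 => if u % 2 = 0 then blockCoeff x u v 0 b else 0
  | k + 1, 0 => if v % 2 = 0 then blockCoeff x u v k 0 else 0
  | k + 1, b + 1 => (if (k + 1 + u) % 2 = 0 then blockCoeff x u v (k + 1) b else 0) +
      if (b + 1 + v) % 2 = 0 then (-1) ^ (b + 1) * x ^ ((b + 1 + (u + k + (b + 1)) % 2) / 2) *
        blockCoeff x u v k (b + 1) else 0

/-- A form of the recursion for the coefficients common to the cases `b = 0` and `b > 0`. -/
theorem blockCoeff_succ (x : K) (u v k b : ℕ) : blockCoeff x u v (k + 1) b =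
    (if (b + v) % 2 = 0 then (-1) ^ b * x ^ ((b + (u + k + b) % 2) / 2) *
      blockCoeff x u v k b else 0) +
    if b = 0 then 0 else
      if (k + 1 + u) % 2 = 0 then blockCoeff x u v (k + 1) (b - 1) else 0 := by
  cases b with
  | zero =>
    have : (0 + (u + k + 0) % 2) / 2 = 0 := by omega
    rw [blockCoeff, this]
    simp
  | succ b =>
    rw [blockCoeff, add_comm]
    simp

/-- A single block carries one arrangement, the increasing one. -/
theorem altSum_Icc (x : K) {I : Finset ℕ} (β v : ℕ) {p₀ b₀ b : ℕ}
    (hI : ∀ i, p₀ < i → i < p₀ + b₀ → i ∈ I) (hp₀ : p₀ ∉ I) (hb : b ≤ b₀) :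
    altSum x I β b (Finset.Icc (p₀ + 1) (p₀ + b)) = blockCoeff x (p₀ + 1 + β) v 0 b := by
  induction b with
  | zero => rw [altSum, blockCoeff]
  | succ b ih =>
    have := altSum_union_succ x β (N := b) hI hp₀ hb (S := ∅) (by simp)
    rw [Finset.empty_union] at this
    rw [this, blockCoeff, ← ih (by omega)]
    simp only [Finset.sum_empty, zero_add, Nat.succ_ne_zero, if_false, Finset.empty_union,
      Nat.add_sub_cancel]
    refine if_congr ?_ rfl rfl
    omega

variable [CharZero K]

/-- The largest value is put on top of alternating arrangements, at positions of a prescribed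
parity: the result alternates or the contributions cancel. -/
theorem sum_topWeight_mul_altSum_of_parity (x : K) (I : Finset ℕ) (β γ k : ℕ) (S : Finset ℕ) :
    ∑ p ∈ S, (if TopFree I S p ∧ (p + γ + (k + 1)) % 2 = 0 then
      topWeight x S p * altSum x I β (k + 1) (S.erase p) else 0) =
      if (γ + β) % 2 = 0 then altSum x I β (k + 2) S else 0 := by
  split_ifs with h
  · rw [altSum]
    refine Finset.sum_congr rfl fun p _ => if_congr (and_congr_right fun _ => ?_) rfl rfl
    omega
  · refine Eq.trans (Finset.sum_congr rfl fun p _ => if_congr (and_congr_right fun _ => ?_) rfl rfl)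
      (altSum_top_cancel x I β k S)
    omega

/-- The expansion of the alternating sum over a set of positions followed by a block. -/
theorem altSum_union (x : K) {I : Finset ℕ} (β : ℕ) {p₀ b₀ : ℕ}
    (hI : ∀ i, p₀ < i → i < p₀ + b₀ → i ∈ I) (hp₀ : p₀ ∉ I) {b k : ℕ} (hb : b ≤ b₀)
    {S : Finset ℕ} (hS : S.card = k + 1) (hle : ∀ j ∈ S, j ≤ p₀) :
    altSum x I β (k + b + 1) (S ∪ Finset.Icc (p₀ + 1) (p₀ + b)) =
      blockCoeff x (p₀ + 1 + β) 0 (k + 1) b * altSum x I β (k + 1) S +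
        blockCoeff x (p₀ + 1 + β) 1 (k + 1) b * altSum x I (β + 1) (k + 1) S := by
  induction hN : k + b using Nat.strong_induction_on generalizing b k S with
  | _ N ih =>
  subst hN
  rw [altSum_union_succ x β hI hp₀ hb hle, blockCoeff_succ x _ 0, blockCoeff_succ x _ 1]
  have hlast : (if b = 0 then 0 else if (p₀ + b + β + (k + b)) % 2 = 0 then
      altSum x I β (k + b) (S ∪ Finset.Icc (p₀ + 1) (p₀ + (b - 1))) else 0) =
      (if b = 0 then 0 else if (k + 1 + (p₀ + 1 + β)) % 2 = 0 then
        blockCoeff x (p₀ + 1 + β) 0 (k + 1) (b - 1) else 0) * altSum x I β (k + 1) S +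
      (if b = 0 then 0 else if (k + 1 + (p₀ + 1 + β)) % 2 = 0 then
        blockCoeff x (p₀ + 1 + β) 1 (k + 1) (b - 1) else 0) * altSum x I (β + 1) (k + 1) S := by
    rcases Nat.eq_zero_or_pos b with rfl | hpos
    · simp
    · have h1 := ih (k + (b - 1)) (by omega) (by omega) hS hle rfl
      rw [show k + (b - 1) + 1 = k + b by omega] at h1
      simp only [if_neg (show ¬b = 0 by omega)]
      rcases Nat.mod_two_eq_zero_or_one (p₀ + k + β) with h | h
      · rw [if_pos (by omega), if_pos (by omega), if_pos (by omega), h1]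
      · rw [if_neg (by omega), if_neg (by omega), if_neg (by omega)]
        ring
  rw [hlast]
  have hcard : ∀ p ∈ S, (S.erase p).card = k := fun p hp => by
    rw [Finset.card_erase_of_mem hp, hS]; rfl
  have hfirst : ∑ p ∈ S, (if TopFree I S p ∧ (p + β + (k + b)) % 2 = 0 then
        (-1) ^ b * x ^ ((b + (p + p₀ + 1) % 2) / 2) * (topWeight x S p *
          altSum x I β (k + b) (S.erase p ∪ Finset.Icc (p₀ + 1) (p₀ + b))) else 0) =
      (-1) ^ b * x ^ ((b + (p₀ + 1 + β + k + b) % 2) / 2) *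
        ∑ p ∈ S, (if TopFree I S p ∧ (p + (β + b) + k) % 2 = 0 then
          topWeight x S p * altSum x I β (k + b) (S.erase p ∪ Finset.Icc (p₀ + 1) (p₀ + b))
          else 0) := by
    rw [Finset.mul_sum]
    refine Finset.sum_congr rfl fun p hp => ?_
    rw [show p + (β + b) + k = p + β + (k + b) by ring]
    split_ifs with h
    · rw [show (p + p₀ + 1) % 2 = (p₀ + 1 + β + k + b) % 2 by omega]
    · rw [mul_zero]
  rw [hfirst]
  rcases k with _ | k
  · obtain ⟨p, rfl⟩ := Finset.card_eq_one.1 hS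
    have h2 : TopFree I {p} p := fun _ => by simp
    have h3 : topWeight x {p} p = 1 := by simp [topWeight, right, oppRight, Finset.filter_singleton]
    rw [Finset.sum_singleton, Finset.erase_singleton, Finset.empty_union, zero_add, zero_add,
      altSum_singleton, altSum_singleton, ← altSum_Icc x β 0 hI hp₀ hb,
      ← altSum_Icc x β 1 hI hp₀ hb, h3]
    simp only [h2, true_and]
    rcases Nat.mod_two_eq_zero_or_one b with hb2 | hb2 <;>
    rcases Nat.mod_two_eq_zero_or_one (p + β) with hp2 | hp2
    · rw [if_pos (show (p + (β + b) + 0) % 2 = 0 by omega), if_pos (show (b + 0) % 2 = 0 by omega),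
        if_pos hp2, if_neg (show ¬(p + (β + 1)) % 2 = 0 by omega)]
      ring
    · rw [if_neg (show ¬(p + (β + b) + 0) % 2 = 0 by omega),
        if_neg (show ¬(b + 1) % 2 = 0 by omega),
        if_neg (show ¬(p + β) % 2 = 0 by omega), if_pos (show (p + (β + 1)) % 2 = 0 by omega)]
      ring
    · rw [if_neg (show ¬(p + (β + b) + 0) % 2 = 0 by omega),
        if_neg (show ¬(b + 0) % 2 = 0 by omega),
        if_pos hp2, if_neg (show ¬(p + (β + 1)) % 2 = 0 by omega)]
      ring
    · rw [if_pos (show (p + (β + b) + 0) % 2 = 0 by omega), if_pos (show (b + 1) % 2 = 0 by omega),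
        if_neg (show ¬(p + β) % 2 = 0 by omega), if_pos (show (p + (β + 1)) % 2 = 0 by omega)]
      ring
  · have hsum : ∑ p ∈ S, (if TopFree I S p ∧ (p + (β + b) + (k + 1)) % 2 = 0 then
        topWeight x S p * altSum x I β (k + 1 + b) (S.erase p ∪ Finset.Icc (p₀ + 1) (p₀ + b))
        else 0) =
        blockCoeff x (p₀ + 1 + β) 0 (k + 1) b *
          (if (β + b + β) % 2 = 0 then altSum x I β (k + 2) S else 0) +
        blockCoeff x (p₀ + 1 + β) 1 (k + 1) b *
          (if (β + b + (β + 1)) % 2 = 0 then altSum x I (β + 1) (k + 2) S else 0) := by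
      rw [← sum_topWeight_mul_altSum_of_parity, ← sum_topWeight_mul_altSum_of_parity,
        Finset.mul_sum, Finset.mul_sum, ← Finset.sum_add_distrib]
      refine Finset.sum_congr rfl fun p hp => ?_
      split_ifs
      · rw [show k + 1 + b = k + b + 1 by ring, ih (k + b) (by omega) hb (hcard p hp)
          (fun j hj => hle j (Finset.mem_of_mem_erase hj)) rfl]
        ring
      · ring
    rw [hsum]
    rcases Nat.mod_two_eq_zero_or_one b with hb2 | hb2
    · rw [if_pos (show (β + b + β) % 2 = 0 by omega),
        if_neg (show ¬(β + b + (β + 1)) % 2 = 0 by omega),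
        if_pos (show (b + 0) % 2 = 0 by omega), if_neg (show ¬(b + 1) % 2 = 0 by omega)]
      ring
    · rw [if_neg (show ¬(β + b + β) % 2 = 0 by omega),
        if_pos (show (β + b + (β + 1)) % 2 = 0 by omega),
        if_neg (show ¬(b + 0) % 2 = 0 by omega), if_pos (show (b + 1) % 2 = 0 by omega)]
      ring

end

section
variable {K : Type*} [Field K]

/-! ### Closed forms for the coefficients of a block -/

theorem blockCoeff_zero_left (x : K) {u : ℕ} (hu : u % 2 = 0) (v b : ℕ) :
    blockCoeff x u v 0 b = 1 := by
  induction b with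
  | zero => rw [blockCoeff]
  | succ b ih => rw [blockCoeff, if_pos hu, ih]

theorem blockCoeff_zero_left' (x : K) {u : ℕ} (hu : u % 2 = 1) (v b : ℕ) :
    blockCoeff x u v 0 (b + 1) = 0 := by
  rw [blockCoeff, if_neg (by omega)]

theorem neg_one_pow_two_mul (h : ℕ) : (-1 : K) ^ (2 * h) = 1 := by
  rw [pow_mul, neg_one_sq, one_pow]

theorem neg_one_pow_two_mul_add_one (h : ℕ) : (-1 : K) ^ (2 * h + 1) = -1 := by
  rw [pow_succ, neg_one_pow_two_mul, one_mul]

/-- The Gaussian binomial coefficient of `l + h` over `l` for `q = x ^ 2`. -/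
def qBinom (x : K) : ℕ → ℕ → K
  | 0, _ => 1
  | _ + 1, 0 => 1
  | l + 1, h + 1 => qBinom x (l + 1) h + x ^ (2 * (h + 1)) * qBinom x l (h + 1)

theorem qBinom_zero_right (x : K) (l : ℕ) : qBinom x l 0 = 1 := by
  cases l <;> rw [qBinom]

theorem qBinom_mul_poch (x : K) (l h : ℕ) :
    qBinom x l h * (poch x l * poch x h) = poch x (l + h) := by
  induction l generalizing h with
  | zero => rw [qBinom, poch_zero, zero_add]; ring
  | succ l ihl =>
    induction h with
    | zero => rw [qBinom, poch_zero, add_zero]; ring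
    | succ h ihh =>
      have h1 := ihl (h + 1)
      rw [qBinom, show l + 1 + (h + 1) = l + h + 1 + 1 by ring, poch_succ x (l + h + 1)]
      rw [show l + 1 + h = l + h + 1 by ring] at ihh
      rw [show l + (h + 1) = l + h + 1 by ring] at h1
      rw [poch_succ x h] at h1 ⊢
      rw [poch_succ x l] at ihh ⊢
      linear_combination (1 - x ^ (2 * (h + 1))) * ihh +
        x ^ (2 * (h + 1)) * (1 - x ^ (2 * (l + 1))) * h1

theorem blockCoeff_even_zero_odd (x : K) {u : ℕ} (hu : u % 2 = 0) (l h : ℕ) :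
    blockCoeff x u 0 (2 * l + 1) (2 * h) = x ^ h * blockCoeff x u 0 (2 * l) (2 * h) := by
  rw [blockCoeff_succ, if_pos (by omega), if_neg (show ¬(2 * l + 1 + u) % 2 = 0 by omega),
    neg_one_pow_two_mul, show (2 * h + (u + 2 * l + 2 * h) % 2) / 2 = h by omega]
  simp

theorem blockCoeff_even_zero_even_odd (x : K) {u : ℕ} (hu : u % 2 = 0) (l h : ℕ) :
    blockCoeff x u 0 (2 * l) (2 * h + 1) = blockCoeff x u 0 (2 * l) (2 * h) := by
  rcases l with _ | l
  · rw [mul_zero, blockCoeff_zero_left x hu, blockCoeff_zero_left x hu]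
  · rw [show 2 * (l + 1) = 2 * l + 1 + 1 by ring, blockCoeff, if_pos (by omega), if_neg (by omega),
      add_zero]

theorem blockCoeff_even_zero (x : K) {u : ℕ} (hu : u % 2 = 0) (l h : ℕ) :
    blockCoeff x u 0 (2 * l) (2 * h) = qBinom x l h := by
  induction l generalizing h with
  | zero => rw [mul_zero, blockCoeff_zero_left x hu, qBinom]
  | succ l ihl =>
    induction h with
    | zero =>
      have h1 := blockCoeff_even_zero_odd x hu l 0
      rw [ihl, qBinom_zero_right] at h1
      rw [show 2 * (l + 1) = 2 * l + 1 + 1 by ring, mul_zero, blockCoeff, if_pos rfl, qBinom]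
      rw [mul_zero] at h1
      rw [h1]; simp
    | succ h ihh =>
      have h1 := blockCoeff_even_zero_odd x hu l (h + 1)
      have h2 := blockCoeff_even_zero_even_odd x hu (l + 1) h
      rw [ihl] at h1
      rw [ihh] at h2
      rw [show 2 * (l + 1) = 2 * l + 1 + 1 by ring] at h2 ⊢
      rw [show 2 * (h + 1) = 2 * h + 1 + 1 by ring] at h1 ⊢
      rw [blockCoeff, if_pos (by omega), if_pos (by omega), h1, h2, qBinom,
        show (2 * h + 1 + 1 + (u + (2 * l + 1) + (2 * h + 1 + 1)) % 2) / 2 = h + 1 by omega,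
        show 2 * h + 1 + 1 = 2 * (h + 1) by ring, neg_one_pow_two_mul]
      ring

theorem blockCoeff_even_one_odd (x : K) {u : ℕ} (hu : u % 2 = 0) (l h : ℕ) :
    blockCoeff x u 1 (2 * l + 1) (2 * h) = 0 := by
  rw [blockCoeff_succ, if_neg (by omega), if_neg (show ¬(2 * l + 1 + u) % 2 = 0 by omega)]
  simp

theorem blockCoeff_even_one_odd_odd (x : K) {u : ℕ} (hu : u % 2 = 0) (l h : ℕ) :
    blockCoeff x u 1 (2 * l + 1) (2 * h + 1) =
      -x ^ (h + 1) * blockCoeff x u 1 (2 * l) (2 * h + 1) := by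
  rw [blockCoeff, if_neg (by omega), if_pos (by omega), neg_one_pow_two_mul_add_one,
    show (2 * h + 1 + (u + 2 * l + (2 * h + 1)) % 2) / 2 = h + 1 by omega]
  ring

theorem blockCoeff_even_one_even (x : K) {u : ℕ} (hu : u % 2 = 0) (l h : ℕ) :
    blockCoeff x u 1 (2 * l) (2 * h + 2) = blockCoeff x u 1 (2 * l) (2 * h + 1) := by
  rcases l with _ | l
  · rw [mul_zero, blockCoeff_zero_left x hu, blockCoeff_zero_left x hu]
  · rw [show 2 * (l + 1) = 2 * l + 1 + 1 by ring, blockCoeff, if_pos (by omega), if_neg (by omega),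
      add_zero]

theorem blockCoeff_even_one_zero (x : K) (u l : ℕ) : blockCoeff x u 1 (l + 1) 0 = 0 := by
  rw [blockCoeff, if_neg (by omega)]

theorem blockCoeff_even_one_even_odd (x : K) {u : ℕ} (hu : u % 2 = 0) (l h : ℕ) :
    blockCoeff x u 1 (2 * l) (2 * h + 1) = x ^ l * qBinom x l h := by
  have step : ∀ l h, blockCoeff x u 1 (2 * (l + 1)) (2 * h + 1) =
      blockCoeff x u 1 (2 * (l + 1)) (2 * h) +
        x ^ (2 * h + 1) * blockCoeff x u 1 (2 * l) (2 * h + 1) := by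
    intro l h
    have h1 := blockCoeff_even_one_odd_odd x hu l h
    rw [show 2 * (l + 1) = 2 * l + 1 + 1 by ring, blockCoeff, if_pos (by omega),
      if_pos (by omega), h1,
      show (2 * h + 1 + (u + (2 * l + 1) + (2 * h + 1)) % 2) / 2 = h by omega,
      neg_one_pow_two_mul_add_one]
    ring
  induction l generalizing h with
  | zero => rw [mul_zero, blockCoeff_zero_left x hu, qBinom, pow_zero, one_mul]
  | succ l ihl =>
    induction h with
    | zero =>
      have h1 := blockCoeff_even_one_zero x u (2 * l + 1)
      rw [step, ihl, mul_zero, show 2 * (l + 1) = 2 * l + 1 + 1 by ring, h1, qBinom_zero_right,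
        qBinom_zero_right]
      ring
    | succ h ihh =>
      rw [step, ihl, mul_add_one 2 h, blockCoeff_even_one_even x hu, ihh, qBinom]
      ring

theorem blockCoeff_odd_zero_even_odd (x : K) {u : ℕ} (hu : u % 2 = 1) (l h : ℕ) :
    blockCoeff x u 0 (2 * l + 2) (2 * h + 1) = 0 := by
  rw [blockCoeff, if_neg (by omega), if_neg (by omega), add_zero]

theorem blockCoeff_odd_zero_even (x : K) {u : ℕ} (hu : u % 2 = 1) (l h : ℕ) :
    blockCoeff x u 0 (2 * l + 2) (2 * h) = x ^ h * blockCoeff x u 0 (2 * l + 1) (2 * h) := by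
  rw [blockCoeff_succ, if_pos (by omega), if_neg (show ¬(2 * l + 1 + 1 + u) % 2 = 0 by omega),
    neg_one_pow_two_mul, show (2 * h + (u + (2 * l + 1) + 2 * h) % 2) / 2 = h by omega]
  simp

theorem blockCoeff_odd_zero_odd (x : K) {u : ℕ} (hu : u % 2 = 1) (l h : ℕ) :
    blockCoeff x u 0 (2 * l + 1) (2 * h + 1) = blockCoeff x u 0 (2 * l + 1) (2 * h) := by
  rw [blockCoeff, if_pos (by omega), if_neg (by omega), add_zero]

theorem blockCoeff_odd_zero (x : K) {u : ℕ} (hu : u % 2 = 1) (l h : ℕ) :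
    blockCoeff x u 0 (2 * l + 1) (2 * h) = qBinom x l h := by
  have step : ∀ l h, blockCoeff x u 0 (2 * l + 1) (2 * (h + 1)) =
      blockCoeff x u 0 (2 * l + 1) (2 * h) +
        x ^ (h + 1) * blockCoeff x u 0 (2 * l) (2 * (h + 1)) := by
    intro l h
    rw [← blockCoeff_odd_zero_odd x hu l h, show 2 * (h + 1) = 2 * h + 1 + 1 by ring, blockCoeff,
      if_pos (by omega), if_pos (by omega), show 2 * h + 1 + 1 = 2 * (h + 1) by ring,
      neg_one_pow_two_mul, show (2 * (h + 1) + (u + 2 * l + 2 * (h + 1)) % 2) / 2 = h + 1 by omega]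
    ring
  induction l generalizing h with
  | zero =>
    induction h with
    | zero => rw [qBinom, blockCoeff, if_pos rfl, mul_zero, blockCoeff]
    | succ h ihh =>
      rw [step, ihh, mul_zero, mul_add_one, blockCoeff_zero_left' x hu, qBinom, qBinom]
      ring
  | succ l ihl =>
    have step' : ∀ h, blockCoeff x u 0 (2 * (l + 1)) (2 * h) = x ^ h * qBinom x l h := by
      intro h
      rw [mul_add_one, blockCoeff_odd_zero_even x hu, ihl]
    induction h with
    | zero =>
      have h1 := step' 0
      rw [mul_zero] at h1
      rw [mul_zero, blockCoeff, if_pos rfl, h1, qBinom_zero_right, qBinom_zero_right]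
      simp
    | succ h ihh =>
      rw [step, ihh, step', qBinom]
      ring

theorem blockCoeff_odd_one (x : K) {u : ℕ} (hu : u % 2 = 1) (k b : ℕ) :
    blockCoeff x u 1 (k + 1) b = 0 := by
  induction k generalizing b with
  | zero =>
    induction b with
    | zero => rw [blockCoeff, if_neg (by omega)]
    | succ b ihb => rw [blockCoeff, ihb, blockCoeff_zero_left' x hu]; simp
  | succ k ihk =>
    induction b with
    | zero => rw [blockCoeff, if_neg (by omega)]
    | succ b ihb => rw [blockCoeff, ihb, ihk]; simp

end

/-! ### Connected components -/

theorem mem_components {I J : Finset ℕ} : J ∈ components I ↔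
    ∃ a b, a ≤ b ∧ J = Finset.Icc a b ∧ (∀ i, a ≤ i → i ≤ b → i ∈ I) ∧ b + 1 ∉ I ∧
      ∀ c, c + 1 = a → c ∉ I := by
  unfold components
  simp only [Finset.mem_filter, Finset.mem_powerset]
  constructor
  · rintro ⟨h, a, b, hab, rfl, h1, h2⟩
    exact ⟨a, b, hab, rfl, fun i h3 h4 => h (Finset.mem_Icc.2 ⟨h3, h4⟩), h1, h2⟩
  · rintro ⟨a, b, hab, rfl, h, h1, h2⟩
    exact ⟨fun i hi => h i (Finset.mem_Icc.1 hi).1 (Finset.mem_Icc.1 hi).2, a, b, hab, rfl, h1, h2⟩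

theorem components_empty : components ∅ = ∅ := by
  ext J
  simp only [mem_components, Finset.notMem_empty, iff_false]
  rintro ⟨a, b, hab, -, h, -⟩
  exact h a le_rfl hab

theorem components_Icc {a b : ℕ} (h : a ≤ b) :
    components (Finset.Icc a b) = {Finset.Icc a b} := by
  ext J
  rw [mem_components, Finset.mem_singleton]
  simp only [Finset.mem_Icc]
  constructor
  · rintro ⟨a', b', hab, rfl, h1, h2, h3⟩
    have h4 := h1 a' le_rfl hab
    have h5 := h1 b' hab le_rfl
    have h6 : a' = a := by
      rcases Nat.eq_zero_or_pos a' with h7 | h7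
      · omega
      · have := h3 (a' - 1) (by omega)
        omega
    have h7 : b' = b := by omega
    rw [h6, h7]
  · rintro rfl
    exact ⟨a, b, h, rfl, fun i h1 h2 => ⟨h1, h2⟩, by omega, fun c _ => by omega⟩

/-- Two sets separated by a missing vertex `p` have no component in common, and no component of
the union meets both. -/
theorem components_union {A B : Finset ℕ} {p : ℕ} (hA : ∀ i ∈ A, i < p) (hB : ∀ i ∈ B, p < i) :
    components (A ∪ B) = components A ∪ components B := by
  have hA' : ∀ i, p ≤ i → i ∉ A := fun i h h1 => absurd (hA i h1) (by omega)
  have hB' : ∀ i, i ≤ p → i ∉ B := fun i h h1 => absurd (hB i h1) (by omega)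
  ext J
  simp only [Finset.mem_union, mem_components]
  constructor
  · rintro ⟨a, b, hab, rfl, h1, h2, h3⟩
    have hp : b < p ∨ p < a := by
      by_contra hcon
      rcases h1 p (by omega) (by omega) with h4 | h4
      · exact hA' p le_rfl h4
      · exact hB' p le_rfl h4
    rcases hp with hp | hp
    · exact Or.inl ⟨a, b, hab, rfl, fun i h4 h5 => (h1 i h4 h5).resolve_right (hB' i (by omega)),
        fun h4 => h2 (Or.inl h4), fun c h4 h5 => h3 c h4 (Or.inl h5)⟩
    · exact Or.inr ⟨a, b, hab, rfl, fun i h4 h5 => (h1 i h4 h5).resolve_left (hA' i (by omega)),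
        fun h4 => h2 (Or.inr h4), fun c h4 h5 => h3 c h4 (Or.inr h5)⟩
  · rintro (⟨a, b, hab, rfl, h1, h2, h3⟩ | ⟨a, b, hab, rfl, h1, h2, h3⟩)
    · have h4 := hA b (h1 b hab le_rfl)
      exact ⟨a, b, hab, rfl, fun i h5 h6 => Or.inl (h1 i h5 h6),
        fun h5 => h5.elim h2 (hB' _ (by omega)), fun c h5 h6 => h6.elim (h3 c h5) (hB' _ (by omega))⟩
    · have h4 := hB a (h1 a le_rfl hab)
      exact ⟨a, b, hab, rfl, fun i h5 h6 => Or.inr (h1 i h5 h6),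
        fun h5 => h5.elim (hA' _ (by omega)) h2, fun c h5 h6 => h6.elim (hA' _ (by omega)) (h3 c h5)⟩

theorem disjoint_components {A B : Finset ℕ} (h : Disjoint A B) :
    Disjoint (components A) (components B) := by
  rw [Finset.disjoint_left]
  intro J hA hB
  obtain ⟨a, b, hab, rfl, h1, -⟩ := mem_components.1 hA
  obtain ⟨a', b', hab', h2, h3, -⟩ := mem_components.1 hB
  have h4 : a ∈ Finset.Icc a' b' := h2 ▸ Finset.mem_Icc.2 ⟨le_rfl, hab⟩
  rw [Finset.mem_Icc] at h4
  exact Finset.disjoint_left.1 h (h1 a le_rfl hab) (h3 a h4.1 h4.2)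

theorem m_union {A B : Finset ℕ} {p : ℕ} (hA : ∀ i ∈ A, i < p) (hB : ∀ i ∈ B, p < i) :
    m (A ∪ B) = m A + m B := by
  unfold m
  rw [components_union hA hB, Finset.sum_union (disjoint_components _)]
  exact Finset.disjoint_left.2 fun i h h' => absurd (hA i h) (by have := hB i h'; omega)

theorem m_Icc (a b : ℕ) : m (Finset.Icc a b) = (b + 1 - a + 1) / 2 := by
  unfold m
  rcases le_or_gt a b with h | h
  · rw [components_Icc h, Finset.sum_singleton, Nat.card_Icc]
  · rw [Finset.Icc_eq_empty (by omega), components_empty, Finset.sum_empty]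
    omega

section
variable {K : Type*} [Field K]

/-- The denominator `∏_k (1 - q) ⋯ (1 - q ^ r_k)`, `r_k = ⌊(|I_k| + 1) / 2⌋`, for `q = x ^ 2`. -/
noncomputable def pochProd (x : K) (I : Finset ℕ) : K := ∏ J ∈ components I, poch x ((J.card + 1) / 2)

theorem pochProd_union (x : K) {A B : Finset ℕ} {p : ℕ} (hA : ∀ i ∈ A, i < p)
    (hB : ∀ i ∈ B, p < i) : pochProd x (A ∪ B) = pochProd x A * pochProd x B := by
  unfold pochProd
  rw [components_union hA hB, Finset.prod_union (disjoint_components _)]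
  exact Finset.disjoint_left.2 fun i h h' => absurd (hA i h) (by have := hB i h'; omega)

theorem pochProd_Icc (x : K) (a b : ℕ) :
    pochProd x (Finset.Icc a b) = poch x ((b + 1 - a + 1) / 2) := by
  unfold pochProd
  rcases le_or_gt a b with h | h
  · rw [components_Icc h, Finset.prod_singleton, Nat.card_Icc]
  · rw [Finset.Icc_eq_empty (by omega), components_empty, Finset.prod_empty,
      show (b + 1 - a + 1) / 2 = 0 by omega, poch_zero]

theorem poch_ne_zero {x : K} (hx : ∀ k > 0, x ^ k ≠ 1) (r : ℕ) : poch x r ≠ 0 :=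
  Finset.prod_ne_zero_iff.2 fun i _ => sub_ne_zero.2 (hx (2 * (i + 1)) (by omega)).symm

/-! ### Closed forms for the alternating sums -/

/-- Only the ascent conditions between adjacent positions of `S` matter. -/
theorem altSum_congr_left (x : K) {I I' : Finset ℕ} (β k : ℕ) {S : Finset ℕ}
    (h : ∀ i ∈ S, i + 1 ∈ S → (i ∈ I ↔ i ∈ I')) : altSum x I β k S = altSum x I' β k S := by
  induction k generalizing S with
  | zero => rfl
  | succ k ih =>
    unfold altSum
    refine Finset.sum_congr rfl fun p hp => ?_
    rw [ih fun i hi hi' => h i (Finset.mem_of_mem_erase hi) (Finset.mem_of_mem_erase hi')]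
    refine if_congr (and_congr_left fun _ => ?_) rfl rfl
    unfold TopFree
    exact ⟨fun h1 h2 h3 => h1 ((h p hp h3).2 h2) h3, fun h1 h2 h3 => h1 ((h p hp h3).1 h2) h3⟩

/-- The closed forms for the alternating sums over the interval `[s + 1, s + n]`, up to the common
denominator `pochProd x J`. The smallest value stands at a position with the parity of `s + 1` or of
`s`; the second sum vanishes unless `n` is even and exceeds `2 * m J`. -/
def AltForm (x : K) (J : Finset ℕ) (s n : ℕ) : Prop :=
  (n = 2 * m J ∧
    altSum x J (s + 1) n (Finset.Icc (s + 1) (s + n)) * pochProd x J = poch x (m J) ∧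
    altSum x J s n (Finset.Icc (s + 1) (s + n)) = 0) ∨
  (∃ l, n = 2 * l + 1 ∧ m J ≤ l ∧
    altSum x J (s + 1) n (Finset.Icc (s + 1) (s + n)) * pochProd x J = poch x l ∧
    altSum x J s n (Finset.Icc (s + 1) (s + n)) = 0) ∨
  ∃ l, n = 2 * l + 2 ∧ m J ≤ l ∧
    altSum x J (s + 1) n (Finset.Icc (s + 1) (s + n)) * pochProd x J = poch x l ∧
    altSum x J s n (Finset.Icc (s + 1) (s + n)) * pochProd x J = -x ^ (l + 1) * poch x l

/-- The decomposition at the last missing vertex `s + k`. -/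
theorem exists_eq_union_Icc {J : Finset ℕ} {s n : ℕ} (hn : 1 ≤ n)
    (hJ : ∀ i ∈ J, s < i ∧ i < s + n) : ∃ (J' : Finset ℕ) (k b : ℕ), n = k + (b + 1) ∧
      (∀ i ∈ J', s < i ∧ i < s + k) ∧ J = J' ∪ Finset.Icc (s + k + 1) (s + k + b) := by
  classical
  set k := Nat.findGreatest (fun k => s + k ∉ J) (n - 1) with hk
  have h0 : s + 0 ∉ J := fun h => absurd (hJ _ h).1 (by omega)
  have h1 : s + k ∉ J := Nat.findGreatest_spec (P := fun k => s + k ∉ J) (Nat.zero_le _) h0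
  have h2 : k ≤ n - 1 := Nat.findGreatest_le _
  have h3 : ∀ j, k < j → j ≤ n - 1 → s + j ∈ J := fun j h4 h5 =>
    not_not.1 (Nat.findGreatest_is_greatest h4 h5)
  refine ⟨J.filter (· < s + k), k, n - 1 - k, by omega, fun i hi => ?_, ?_⟩
  · rw [Finset.mem_filter] at hi
    exact ⟨(hJ i hi.1).1, hi.2⟩
  · ext i
    simp only [Finset.mem_union, Finset.mem_filter, Finset.mem_Icc]
    constructor
    · intro hi
      have h4 := hJ i hi
      have h5 : i ≠ s + k := fun h => h1 (h ▸ hi)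
      rcases lt_or_gt_of_ne h5 with h6 | h6
      · exact Or.inl ⟨hi, h6⟩
      · exact Or.inr (by omega)
    · rintro (h | h)
      · exact h.1
      · obtain ⟨j, rfl⟩ := Nat.exists_eq_add_of_le (show s ≤ i by omega)
        exact h3 j (by omega) (by omega)

theorem altForm_Icc (x : K) (s b : ℕ) : AltForm x (Finset.Icc (s + 1) (s + b)) s (b + 1) := by
  have hI : ∀ i, s < i → i < s + (b + 1) → i ∈ Finset.Icc (s + 1) (s + b) := fun i h1 h2 =>
    Finset.mem_Icc.2 ⟨h1, by omega⟩
  have hs : s ∉ Finset.Icc (s + 1) (s + b) := by simp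
  have h1 := altSum_Icc x (s + 1) 0 hI hs le_rfl
  have h0 := altSum_Icc x s 0 hI hs le_rfl
  rw [blockCoeff_zero_left x (by omega)] at h1
  rw [blockCoeff_zero_left' x (by omega)] at h0
  unfold AltForm
  rw [h1, h0, pochProd_Icc, m_Icc, one_mul, show s + b + 1 - (s + 1) + 1 = b + 1 by omega]
  rcases Nat.mod_two_eq_zero_or_one b with h | h
  · exact Or.inr (Or.inl ⟨b / 2, by omega, by omega, by rw [show (b + 1) / 2 = b / 2 by omega], rfl⟩)
  · exact Or.inl ⟨by omega, rfl, rfl⟩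

variable [CharZero K]

/-- Appending a block to the positions `[s + 1, s + k + 1]` preserves the closed forms. -/
theorem AltForm.union {x : K} (hx : ∀ k > 0, x ^ k ≠ 1) {J : Finset ℕ} {s k : ℕ}
    (hJ : ∀ i ∈ J, s < i ∧ i < s + (k + 1)) (h : AltForm x J s (k + 1)) (b : ℕ) :
    AltForm x (J ∪ Finset.Icc (s + (k + 1) + 1) (s + (k + 1) + b)) s (k + 1 + (b + 1)) := by
  set B := Finset.Icc (s + (k + 1) + 1) (s + (k + 1) + b) with hB
  have hJB : ∀ i, i ∈ J ∪ B ↔ i ∈ J ∨ (s + (k + 1) < i ∧ i ≤ s + (k + 1) + b) := by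
    intro i
    rw [Finset.mem_union, hB, Finset.mem_Icc, Nat.succ_le_iff]
  have hI : ∀ i, s + (k + 1) < i → i < s + (k + 1) + (b + 1) → i ∈ J ∪ B := fun i h1 h2 =>
    (hJB i).2 (Or.inr (by omega))
  have hp : s + (k + 1) ∉ J ∪ B := by
    rw [hJB]
    rintro (h1 | h1)
    · exact absurd (hJ _ h1).2 (by omega)
    · omega
  have hS : (Finset.Icc (s + 1) (s + (k + 1))).card = k + 1 := by rw [Nat.card_Icc]; omega
  have hmJ : m (J ∪ B) = m J + (b + 1) / 2 := by
    rw [m_union (p := s + (k + 1)) (fun i hi => (hJ i hi).2)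
      (fun i hi => by rw [hB, Finset.mem_Icc] at hi; omega), hB, m_Icc]
    congr 2; omega
  have hD : pochProd x (J ∪ B) = pochProd x J * poch x ((b + 1) / 2) := by
    rw [pochProd_union x (p := s + (k + 1)) (fun i hi => (hJ i hi).2)
      (fun i hi => by rw [hB, Finset.mem_Icc] at hi; omega), hB, pochProd_Icc]
    congr 3; omega
  have hres : ∀ β, altSum x (J ∪ B) β (k + 1) (Finset.Icc (s + 1) (s + (k + 1))) =
      altSum x J β (k + 1) (Finset.Icc (s + 1) (s + (k + 1))) := by
    intro β
    refine altSum_congr_left x β _ fun i hi hi' => ?_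
    rw [Finset.mem_Icc] at hi hi'
    rw [hJB, or_iff_left (by omega)]
  have key : ∀ β, altSum x (J ∪ B) β (k + 1 + (b + 1))
      (Finset.Icc (s + 1) (s + (k + 1 + (b + 1)))) =
      blockCoeff x (s + (k + 1) + 1 + β) 0 (k + 1) (b + 1) *
        altSum x J β (k + 1) (Finset.Icc (s + 1) (s + (k + 1))) +
      blockCoeff x (s + (k + 1) + 1 + β) 1 (k + 1) (b + 1) *
        altSum x J (β + 1) (k + 1) (Finset.Icc (s + 1) (s + (k + 1))) := by
    intro β
    have h1 := altSum_union x β hI hp le_rfl hS (fun j hj => (Finset.mem_Icc.1 hj).2)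
    have h2 : Finset.Icc (s + 1) (s + (k + 1)) ∪
        Finset.Icc (s + (k + 1) + 1) (s + (k + 1) + (b + 1)) =
        Finset.Icc (s + 1) (s + (k + 1 + (b + 1))) := by
      ext i
      simp only [Finset.mem_union, Finset.mem_Icc]
      omega
    rw [h2, hres, hres, show k + (b + 1) + 1 = k + 1 + (b + 1) by ring] at h1
    exact h1
  have key1 := key (s + 1)
  have key0 := key s
  rw [altSum_congr x J (show (s + 1 + 1) % 2 = s % 2 by omega)] at key1
  unfold AltForm at h ⊢
  rw [hmJ, hD, key1, key0]
  clear key1 key0 key hres hD hmJ hS hp hI hJB hJ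
  set A1 := altSum x J (s + 1) (k + 1) (Finset.Icc (s + 1) (s + (k + 1)))
  set A0 := altSum x J s (k + 1) (Finset.Icc (s + 1) (s + (k + 1)))
  set D := pochProd x J
  rcases h with ⟨hk, h1, h0⟩ | ⟨l, hk, hl, h1, h0⟩ | ⟨l, hk, hl, h1, h0⟩
  · obtain ⟨l, hl⟩ : ∃ l, m J = l + 1 := ⟨m J - 1, by omega⟩
    obtain rfl : k = 2 * l + 1 := by omega
    rw [hl] at h1
    rcases Nat.even_or_odd' b with ⟨h, rfl | rfl⟩
    · refine Or.inr (Or.inl ⟨l + 1 + h, by omega, by omega, ?_, by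
        rw [h0, blockCoeff_odd_one x (by omega),
          show 2 * l + 1 + 1 = 2 * l + 2 by ring, blockCoeff_odd_zero_even_odd x (by omega)]; ring⟩)
      rw [h0, show 2 * l + 1 + 1 = 2 * (l + 1) by ring, blockCoeff_even_zero_even_odd x (by omega),
        blockCoeff_even_zero x (by omega), ← qBinom_mul_poch,
        show (2 * h + 1) / 2 = h by omega]
      linear_combination qBinom x (l + 1) h * poch x h * h1
    · refine Or.inl ⟨by omega, ?_, by
        rw [h0, blockCoeff_odd_one x (by omega)]; ring⟩
      rw [h0, show 2 * l + 1 + 1 = 2 * (l + 1) by ring,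
        show 2 * h + 1 + 1 = 2 * (h + 1) by ring,
        blockCoeff_even_zero x (by omega), hl, show 2 * (h + 1) / 2 = h + 1 by omega,
        ← qBinom_mul_poch x (l + 1) (h + 1)]
      linear_combination qBinom x (l + 1) (h + 1) * poch x (h + 1) * h1
  · obtain rfl : k = 2 * l := by omega
    rcases Nat.even_or_odd' b with ⟨h, rfl | rfl⟩
    · refine Or.inr (Or.inr ⟨l + h, by omega, by omega, ?_, ?_⟩)
      · rw [blockCoeff_odd_one x (by omega), blockCoeff_odd_zero_odd x (by omega),
          blockCoeff_odd_zero x (by omega), ← qBinom_mul_poch, show (2 * h + 1) / 2 = h by omega]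
        linear_combination qBinom x l h * poch x h * h1
      · rw [h0, blockCoeff_even_one_odd_odd x (by omega), blockCoeff_even_one_even_odd x (by omega),
          ← qBinom_mul_poch, show (2 * h + 1) / 2 = h by omega]
        linear_combination -x ^ (h + 1) * x ^ l * qBinom x l h * poch x h * h1
    · refine Or.inr (Or.inl ⟨l + (h + 1), by omega, by omega, ?_, ?_⟩)
      · rw [show 2 * h + 1 + 1 = 2 * (h + 1) by ring, blockCoeff_odd_one x (by omega),
          blockCoeff_odd_zero x (by omega), ← qBinom_mul_poch,
          show 2 * (h + 1) / 2 = h + 1 by omega]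
        linear_combination qBinom x l (h + 1) * poch x (h + 1) * h1
      · rw [h0, show 2 * h + 1 + 1 = 2 * (h + 1) by ring, blockCoeff_even_one_odd x (by omega)]
        ring
  · obtain rfl : k = 2 * l + 1 := by omega
    have hne : (1 - x ^ (2 * (l + 1))) ≠ 0 := sub_ne_zero.2 (hx _ (by omega)).symm
    rcases Nat.even_or_odd' b with ⟨h, rfl | rfl⟩
    · refine Or.inr (Or.inl ⟨l + 1 + h, by omega, by omega, ?_, by
        rw [blockCoeff_odd_one x (by omega),
          show 2 * l + 1 + 1 = 2 * l + 2 by ring, blockCoeff_odd_zero_even_odd x (by omega)]; ring⟩)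
      rw [show 2 * l + 1 + 1 = 2 * (l + 1) by ring, blockCoeff_even_zero_even_odd x (by omega),
        blockCoeff_even_zero x (by omega), blockCoeff_even_one_even_odd x (by omega),
        ← qBinom_mul_poch, show (2 * h + 1) / 2 = h by omega, poch_succ]
      linear_combination qBinom x (l + 1) h * poch x h * (h1 + x ^ (l + 1) * h0)
    · have e1 := qBinom_mul_poch x (l + 1) (h + 1)
      have e2 := qBinom_mul_poch x (l + 1) h
      have e3 := qBinom_mul_poch x l (h + 1)
      refine Or.inr (Or.inr ⟨l + (h + 1), by omega, by omega, ?_, ?_⟩)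
      · -- `x ^ (2 * l + 2)` times the second coefficient, subtracted from the first, gives the
        -- other form of the Pascal recursion, seen after multiplication by `1 - x ^ (2 * l + 2)`
        rw [show 2 * l + 1 + 1 = 2 * (l + 1) by ring, show 2 * h + 1 + 1 = 2 * h + 2 by ring,
          blockCoeff_even_one_even x (by omega), blockCoeff_even_one_even_odd x (by omega),
          show 2 * h + 2 = 2 * (h + 1) by ring, blockCoeff_even_zero x (by omega),
          show 2 * (h + 1) / 2 = h + 1 by omega]
        refine mul_right_cancel₀ hne ?_
        rw [show l + 1 + (h + 1) = l + (h + 1) + 1 by ring, poch_succ x (l + (h + 1)),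
          poch_succ x l] at e1
        rw [show l + 1 + h = l + (h + 1) by ring, poch_succ x l] at e2
        rw [poch_succ x h] at e1 ⊢
        linear_combination (1 - x ^ (2 * (l + 1))) * poch x h * (1 - x ^ (2 * (h + 1))) *
          (qBinom x (l + 1) (h + 1) * h1 + x ^ (l + 1) * qBinom x (l + 1) h * h0) + e1 -
          x ^ (2 * (l + 1)) * (1 - x ^ (2 * (h + 1))) * e2
      · rw [show 2 * l + 1 + 1 = 2 * l + 2 by ring, show 2 * h + 1 + 1 = 2 * (h + 1) by ring,
          show 2 * l + 2 = 2 * l + 1 + 1 by ring, blockCoeff_odd_one x (by omega),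
          blockCoeff_odd_zero_even x (by omega), blockCoeff_odd_zero x (by omega),
          show 2 * (h + 1) / 2 = h + 1 by omega]
        linear_combination x ^ (h + 1) * qBinom x l (h + 1) * poch x (h + 1) * h0 -
          x ^ (l + (h + 1) + 1) * e3

/-- The closed forms hold for every proper set of ascent conditions. -/
theorem altForm {x : K} (hx : ∀ k > 0, x ^ k ≠ 1) {J : Finset ℕ} {s n : ℕ} (hn : 1 ≤ n)
    (hJ : ∀ i ∈ J, s < i ∧ i < s + n) : AltForm x J s n := by
  induction n using Nat.strong_induction_on generalizing J with
  | _ n ih =>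
  obtain ⟨J', k, b, rfl, hJ', rfl⟩ := exists_eq_union_Icc hn hJ
  rcases k with _ | k
  · obtain rfl : J' = ∅ := Finset.eq_empty_of_forall_notMem fun i hi => by
      have := hJ' i hi
      omega
    rw [Finset.empty_union, add_zero, zero_add]
    exact altForm_Icc x s b
  · exact (ih (k + 1) (by omega) (by omega) hJ').union hx hJ' b

end

/-! ### The product formula -/

section
variable {K : Type*} [Field K]

theorem signedProd_of_lt (x : K) {a n : ℕ} (h : n < a) : signedProd x a n = 1 := by
  rw [signedProd, Finset.Icc_eq_empty (by omega), Finset.prod_empty]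

theorem signedProd_succ (x : K) {a n : ℕ} (h : a ≤ n + 1) :
    signedProd x a (n + 1) = signedProd x a n * (1 + (-1) ^ n * x ^ ((n + 1) / 2)) := by
  rw [signedProd, Finset.prod_Icc_succ_top h, signedProd, Nat.add_sub_cancel]

/-- Consecutive factors pair up: `(1 - x ^ k) (1 + x ^ k) = 1 - x ^ (2 k)`. -/
theorem signedProd_odd (x : K) (r : ℕ) {N : ℕ} (h : r ≤ N) :
    signedProd x (2 * r + 2) (2 * N + 1) * poch x r = poch x N := by
  induction N, h using Nat.le_induction with
  | base => rw [signedProd_of_lt x (by omega), one_mul]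
  | succ N hN ih =>
    rw [show 2 * (N + 1) + 1 = 2 * N + 1 + 1 + 1 by ring, signedProd_succ x (by omega),
      signedProd_succ x (by omega), show 2 * N + 1 + 1 = 2 * (N + 1) by ring,
      neg_one_pow_two_mul, neg_one_pow_two_mul_add_one,
      show (2 * (N + 1) + 1) / 2 = N + 1 by omega, show 2 * (N + 1) / 2 = N + 1 by omega,
      poch_succ, ← ih]
    ring

theorem signedProd_even (x : K) (r : ℕ) {N : ℕ} (h : r ≤ N) :
    signedProd x (2 * r + 2) (2 * N + 2) * poch x r = poch x N * (1 - x ^ (N + 1)) := by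
  rw [signedProd_succ x (by omega), ← signedProd_odd x r h, neg_one_pow_two_mul_add_one,
    show (2 * N + 1 + 1) / 2 = N + 1 by omega]
  ring

theorem qFactorial_eq (x : K) (r : ℕ) :
    qFactorial (x ^ 2) r = poch x r / (1 - x ^ 2) ^ r := by
  induction r with
  | zero => rw [qFactorial, poch_zero]; simp
  | succ r ih =>
    rw [qFactorial, Finset.prod_Icc_succ_top (by omega), ← qFactorial, ih, qNumber, poch_succ,
      pow_succ (1 - x ^ 2), div_mul_div_comm, pow_mul x 2]

theorem C_mul {x : K} (hx : ∀ k > 0, x ^ k ≠ 1) (I : Finset ℕ) :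
    C x I * pochProd x I = poch x (m I) := by
  have h1 : (1 - x ^ 2) ≠ 0 := sub_ne_zero.2 (hx 2 (by omega)).symm
  have h2 : pochProd x I ≠ 0 := Finset.prod_ne_zero_iff.2 fun J _ => poch_ne_zero hx _
  have h3 : ∏ J ∈ components I, qFactorial (x ^ 2) ((J.card + 1) / 2) =
      pochProd x I / (1 - x ^ 2) ^ m I := by
    unfold pochProd m
    rw [← Finset.prod_pow_eq_pow_sum, ← Finset.prod_div_distrib]
    exact Finset.prod_congr rfl fun J _ => qFactorial_eq x _
  have h4 : (1 - x ^ 2) ^ m I ≠ 0 := pow_ne_zero _ h1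
  rw [C, h3, qFactorial_eq]
  field_simp

theorem one_add_pow_ne_zero {x : K} (hx : ∀ k > 0, x ^ k ≠ 1) {r : ℕ} (hr : 0 < r) :
    1 + x ^ r ≠ 0 := by
  intro h
  refine hx (2 * r) (by omega) ?_
  rw [mul_comm, pow_mul]
  linear_combination (x ^ r - 1) * h

/-- The factor `f` when the component of `0` has even length `2 α` and the other components
contribute `M` to `m_I`, in degree `2 α + k`. -/
def evenFactor (x : K) (α M k : ℕ) : K :=
  if k = 2 * M then (1 + x ^ (2 * α) + 2 * x ^ (α + M)) / (1 + x ^ (α + M)) else 1 + x ^ (2 * α)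

theorem evenFactor_zero {x : K} (hx : ∀ k > 0, x ^ k ≠ 1) {M k : ℕ} (hk : 0 < k) :
    evenFactor x 0 M k = 2 := by
  unfold evenFactor
  split_ifs with h
  · have := one_add_pow_ne_zero hx (show 0 < 0 + M by omega)
    rw [div_eq_iff this]
    ring
  · norm_num

/-- The product formula when the first block has even length `2 α`. -/
theorem expansion_even {x : K} (hx : ∀ k > 0, x ^ k ≠ 1) (α : ℕ) {k : ℕ}
    (hk0 : 0 < k) {J : Finset ℕ} (h : AltForm x J (2 * α) k) :
    (doubledCoeff x (2 * α) k 0 * altSum x J 0 k (Finset.Icc (2 * α + 1) (2 * α + k)) +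
      doubledCoeff x (2 * α) k 1 * altSum x J 1 k (Finset.Icc (2 * α + 1) (2 * α + k))) *
        (poch x α * pochProd x J) =
      2 * evenFactor x α (m J) k * poch x (α + m J) * signedProd x (2 * α + 2) (2 * α + k) *
        signedProd x (2 * (α + m J) + 2) (2 * α + k) := by
  have hp := poch_ne_zero hx
  unfold AltForm at h
  rw [altSum_congr x J (show (2 * α + 1) % 2 = 1 % 2 by omega),
    altSum_congr x J (show 2 * α % 2 = 0 % 2 by omega)] at h
  set A1 := altSum x J 1 k (Finset.Icc (2 * α + 1) (2 * α + k))
  set A0 := altSum x J 0 k (Finset.Icc (2 * α + 1) (2 * α + k))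
  set D := pochProd x J
  obtain ⟨row1, row2⟩ := evenRow x α
  rcases h with ⟨hk, h1, h0⟩ | ⟨l, hk, hl, h1, h0⟩ | ⟨l, hk, hl, h1, h0⟩
  · obtain ⟨N, hN⟩ : ∃ N, α + m J = N + 1 := ⟨α + m J - 1, by omega⟩
    obtain ⟨e1, -⟩ := row2 (m J) N hN
    have p1 := signedProd_even x α (show α ≤ N by omega)
    have hne := one_add_pow_ne_zero hx (show 0 < N + 1 by omega)
    rw [evenFactor, if_pos hk, signedProd_of_lt x (show 2 * α + k < 2 * (α + m J) + 2 by omega),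
      show 2 * α + k = 2 * N + 2 by omega, h0, hN, poch_succ, hk]
    refine mul_right_cancel₀ (mul_ne_zero hne (mul_ne_zero (hp α) (hp (m J)))) ?_
    generalize hF : (1 + x ^ (2 * α) + 2 * x ^ (N + 1)) / (1 + x ^ (N + 1)) = F
    rw [div_eq_iff hne] at hF
    rw [hF] at e1
    linear_combination (1 + x ^ (N + 1)) * (doubledCoeff x (2 * α) (2 * m J) 1 * poch x α ^ 2 *
      poch x (m J) * h1 + poch x (m J) * e1) - (1 + x ^ (N + 1)) * poch x (m J) * 2 * F *
        poch x N * (1 - x ^ (2 * (N + 1))) * p1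
  · obtain ⟨e1, -⟩ := row1 l
    have p1 := signedProd_odd x α (show α ≤ α + l by omega)
    have p2 := signedProd_odd x (α + m J) (show α + m J ≤ α + l by omega)
    rw [hk, evenFactor, if_neg (by omega), h0, show 2 * α + (2 * l + 1) = 2 * (α + l) + 1 by ring]
    refine mul_right_cancel₀ (mul_ne_zero (hp α) (hp l)) ?_
    linear_combination doubledCoeff x (2 * α) (2 * l + 1) 1 * poch x α ^ 2 * poch x l * h1 +
      poch x l * e1 - poch x l * 2 * (1 + x ^ (2 * α)) *
        (signedProd x (2 * α + 2) (2 * (α + l) + 1) * poch x α * p2 + poch x (α + l) * p1)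
  · obtain ⟨e1, e0⟩ := row2 (l + 1) (α + l) (by omega)
    have p1 := signedProd_even x α (show α ≤ α + l by omega)
    have p2 := signedProd_even x (α + m J) (show α + m J ≤ α + l by omega)
    rw [hk, evenFactor, if_neg (by omega), show 2 * α + (2 * l + 2) = 2 * (α + l) + 2 by ring]
    refine mul_right_cancel₀ (mul_ne_zero (hp α) (hp (l + 1))) ?_
    rw [show 2 * (l + 1) = 2 * l + 2 by ring] at e1 e0
    rw [poch_succ x l] at e1 e0 ⊢
    linear_combination doubledCoeff x (2 * α) (2 * l + 2) 1 * poch x α ^ 2 * poch x l *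
        (1 - x ^ (2 * (l + 1))) * h1 +
      doubledCoeff x (2 * α) (2 * l + 2) 0 * poch x α ^ 2 * poch x l *
        (1 - x ^ (2 * (l + 1))) * h0 + poch x l * e1 - x ^ (l + 1) * poch x l * e0 -
      poch x l * (1 - x ^ (2 * (l + 1))) * 2 * (1 + x ^ (2 * α)) *
        (signedProd x (2 * α + 2) (2 * (α + l) + 2) * poch x α * p2 +
          poch x (α + l) * (1 - x ^ (α + l + 1)) * p1)

/-- The product formula when the first block has odd length `2 α + 1`. -/
theorem expansion_odd {x : K} (hx : ∀ k > 0, x ^ k ≠ 1) (α : ℕ) {k : ℕ}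
    (hk0 : 0 < k) {J : Finset ℕ} (h : AltForm x J (2 * α + 1) k) :
    (doubledCoeff x (2 * α + 1) k 0 *
        altSum x J 0 k (Finset.Icc (2 * α + 1 + 1) (2 * α + 1 + k)) +
      doubledCoeff x (2 * α + 1) k 1 *
        altSum x J 1 k (Finset.Icc (2 * α + 1 + 1) (2 * α + 1 + k))) *
        (poch x α * pochProd x J) =
      2 * poch x (α + m J) * signedProd x (2 * α + 2) (2 * α + 1 + k) *
        signedProd x (2 * (α + m J) + 2) (2 * α + 1 + k) := by
  have hp := poch_ne_zero hx
  unfold AltForm at h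
  rw [altSum_congr x J (show (2 * α + 1 + 1) % 2 = 0 % 2 by omega),
    altSum_congr x J (show (2 * α + 1) % 2 = 1 % 2 by omega)] at h
  set A1 := altSum x J 1 k (Finset.Icc (2 * α + 1 + 1) (2 * α + 1 + k))
  set A0 := altSum x J 0 k (Finset.Icc (2 * α + 1 + 1) (2 * α + 1 + k))
  set D := pochProd x J
  have row := oddRow x α
  rcases h with ⟨hk, h1, h0⟩ | ⟨l, hk, hl, h1, h0⟩ | ⟨l, hk, hl, h1, h0⟩
  · obtain ⟨⟨e1, -⟩, -⟩ := row (m J)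
    have p1 := signedProd_odd x α (show α ≤ α + m J by omega)
    have p2 := signedProd_odd x (α + m J) le_rfl
    rw [h0, show 2 * α + 1 + k = 2 * (α + m J) + 1 by omega, hk]
    refine mul_right_cancel₀ (mul_ne_zero (hp α) (hp (m J))) ?_
    linear_combination doubledCoeff x (2 * α + 1) (2 * m J) 0 * poch x α ^ 2 * poch x (m J) * h1 +
      poch x (m J) * e1 - poch x (m J) * 2 *
        (signedProd x (2 * α + 2) (2 * (α + m J) + 1) * poch x α * p2 + poch x (α + m J) * p1)
  · obtain ⟨-, e1, -⟩ := row l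
    have p1 := signedProd_even x α (show α ≤ α + l by omega)
    have p2 := signedProd_even x (α + m J) (show α + m J ≤ α + l by omega)
    rw [h0, hk, show 2 * α + 1 + (2 * l + 1) = 2 * (α + l) + 2 by ring]
    refine mul_right_cancel₀ (mul_ne_zero (hp α) (hp l)) ?_
    linear_combination doubledCoeff x (2 * α + 1) (2 * l + 1) 0 * poch x α ^ 2 * poch x l * h1 +
      poch x l * e1 - poch x l * 2 *
        (signedProd x (2 * α + 2) (2 * (α + l) + 2) * poch x α * p2 +
          poch x (α + l) * (1 - x ^ (α + l + 1)) * p1)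
  · obtain ⟨⟨e1, e0⟩, -⟩ := row (l + 1)
    have p1 := signedProd_odd x α (show α ≤ α + (l + 1) by omega)
    have p2 := signedProd_odd x (α + m J) (show α + m J ≤ α + (l + 1) by omega)
    rw [hk, show 2 * α + 1 + (2 * l + 2) = 2 * (α + (l + 1)) + 1 by ring]
    refine mul_right_cancel₀ (mul_ne_zero (hp α) (hp (l + 1))) ?_
    rw [show 2 * (l + 1) = 2 * l + 2 by ring] at e1 e0
    rw [poch_succ x l] at e1 e0 ⊢
    linear_combination doubledCoeff x (2 * α + 1) (2 * l + 2) 0 * poch x α ^ 2 * poch x l *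
        (1 - x ^ (2 * (l + 1))) * h1 +
      doubledCoeff x (2 * α + 1) (2 * l + 2) 1 * poch x α ^ 2 * poch x l *
        (1 - x ^ (2 * (l + 1))) * h0 + poch x l * e1 - x ^ (l + 1) * poch x l * e0 -
      poch x l * (1 - x ^ (2 * (l + 1))) * 2 *
        (signedProd x (2 * α + 2) (2 * (α + (l + 1)) + 1) * poch x α * p2 +
          poch x (α + (l + 1)) * p1)

end

/-! ### The decomposition of the index set -/

theorem zeroComponent_eq_range {I : Finset ℕ} {a : ℕ} (h : ∀ i < a, i ∈ I) (ha : a ∉ I) :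
    zeroComponent I = Finset.range a := by
  ext k
  simp only [zeroComponent, Finset.mem_filter, Finset.mem_range]
  constructor
  · rintro ⟨-, h1⟩
    by_contra h2
    exact ha (h1 (Finset.mem_Icc.2 ⟨Nat.zero_le _, by omega⟩))
  · intro hk
    exact ⟨h k hk, fun i hi => h i (by have := (Finset.mem_Icc.1 hi).2; omega)⟩

theorem exists_first_gap {n : ℕ} {I : Finset ℕ} (hI : I ⊂ Finset.range n) :
    ∃ a < n, (∀ i < a, i ∈ I) ∧ a ∉ I := by
  classical
  obtain ⟨p, hp, hpI⟩ := Finset.exists_of_ssubset hI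
  have h : ∃ a, a ∉ I := ⟨p, hpI⟩
  refine ⟨Nat.find h, ?_, fun i hi => not_not.1 (Nat.find_min h hi), Nat.find_spec h⟩
  exact lt_of_le_of_lt (Nat.find_le hpI) (Finset.mem_range.1 hp)

section
variable {K : Type*} [Field K] [CharZero K]

/-- The product formula for index sets without `0`. -/
theorem signedSum_of_zero_notMem {x : K} (hx : ∀ k > 0, x ^ k ≠ 1) {n : ℕ} (hn : 2 ≤ n)
    {J : Finset ℕ} (hJ : ∀ i ∈ J, 0 < i ∧ i < n) :
    signedSum x J n (Finset.Icc 1 n) =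
      2 * (C x J * signedProd x 2 n * signedProd x (2 * m J + 2) n) := by
  have h0 : 0 ∉ J := fun h => absurd (hJ 0 h).1 (by omega)
  obtain ⟨k, rfl⟩ : ∃ k, n = k + 1 := ⟨n - 1, by omega⟩
  have h1 := signedSum_union x (I := J) (a₀ := 0) (a := 0) (k := k) (by omega) h0 (by omega) le_rfl
    (S := Finset.Icc 1 (k + 1)) (by simp) (fun j hj => (Finset.mem_Icc.1 hj).1)
  have h2 := expansion_even hx 0 (k := k + 1) (by omega) (J := J)
    (altForm hx (by omega) fun i hi => by
      rw [mul_zero, zero_add]; exact hJ i hi)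
  have hD : pochProd x J ≠ 0 := Finset.prod_ne_zero_iff.2 fun _ _ => poch_ne_zero hx _
  have h3 := C_mul hx J
  rw [evenFactor_zero hx (by omega)] at h2
  simp only [doubledCoeff, mul_zero, zero_add, if_true, poch_zero, one_mul] at h2
  rw [Finset.Icc_eq_empty (by omega), Finset.empty_union, zero_add] at h1
  rw [h1]
  refine mul_right_cancel₀ (mul_ne_zero two_ne_zero hD) ?_
  linear_combination h2 - 4 * signedProd x 2 (k + 1) * signedProd x (2 * m J + 2) (k + 1) * h3

/-- The product formula when the component of `0` is `[0, a - 1]` with `a ≥ 2`. -/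
theorem signedSum_of_two_le {x : K} (hx : ∀ k > 0, x ^ k ≠ 1) {n a : ℕ} (ha : 2 ≤ a) (han : a < n)
    {I : Finset ℕ} (hI : I ⊆ Finset.range n) (h : ∀ i < a, i ∈ I) (haI : a ∉ I) :
    signedSum x I n (Finset.Icc 1 n) =
      2 * (f x n I * C x (tilde I) * signedProd x (2 * ((a + 2) / 2)) n *
        signedProd x (2 * m (tilde I) + 2) n) := by
  obtain ⟨k, rfl⟩ : ∃ k, n = a + k + 1 := ⟨n - a - 1, by omega⟩
  set J := I.filter (a < ·) with hJdef
  have hJ : ∀ i ∈ J, a < i ∧ i < a + (k + 1) := fun i hi => by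
    rw [hJdef, Finset.mem_filter] at hi
    exact ⟨hi.2, Finset.mem_range.1 (hI hi.1)⟩
  have hmem : ∀ i, i ∈ I ↔ i < a ∨ i ∈ J := fun i => by
    rw [hJdef, Finset.mem_filter]
    rcases lt_trichotomy i a with h1 | rfl | h1
    · exact ⟨fun _ => Or.inl h1, fun _ => h i h1⟩
    · simp [haI]
    · simp [h1, h1.le.not_gt]
  have hIJ : I = Finset.Icc 0 (a - 1) ∪ J := by
    ext i
    rw [hmem, Finset.mem_union, Finset.mem_Icc]
    exact or_congr_left (by omega)
  have hzero := zeroComponent_eq_range h haI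
  have htilde : tilde I = Finset.Icc 1 (a - 1) ∪ J := by
    rw [tilde, hzero, if_neg (by simp; omega)]
    ext i
    rw [Finset.mem_union, Finset.mem_erase, Finset.mem_singleton, hmem, Finset.mem_union,
      Finset.mem_Icc]
    by_cases hi : i ∈ J
    · have := hJ i hi
      simp only [hi, or_true, iff_true, and_true]
      omega
    · simp only [hi, or_false]
      omega
  have hlt : ∀ b, ∀ i ∈ Finset.Icc b (a - 1), i < a := fun b i hi => by
    rw [Finset.mem_Icc] at hi; omega
  have hgt : ∀ i ∈ J, a < i := fun i hi => (hJ i hi).1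
  have hmI : m I = (a + 1) / 2 + m J := by
    rw [hIJ, m_union (hlt 0) hgt, m_Icc]
    congr 2; omega
  have hmT : m (tilde I) = a / 2 + m J := by
    rw [htilde, m_union (hlt 1) hgt, m_Icc]
    congr 2; omega
  have hDT : pochProd x (tilde I) = poch x (a / 2) * pochProd x J := by
    rw [htilde, pochProd_union x (hlt 1) hgt, pochProd_Icc]
    congr 3; omega
  have hsum := signedSum_union x h haI (by omega) le_rfl (k := k)
    (S := Finset.Icc (a + 1) (a + (k + 1))) (by rw [Nat.card_Icc]; omega)
    (fun j hj => (Finset.mem_Icc.1 hj).1)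
  have hunion : Finset.Icc 1 a ∪ Finset.Icc (a + 1) (a + (k + 1)) = Finset.Icc 1 (a + k + 1) := by
    ext i
    simp only [Finset.mem_union, Finset.mem_Icc]
    omega
  have hres : ∀ β, altSum x I β (k + 1) (Finset.Icc (a + 1) (a + (k + 1))) =
      altSum x J β (k + 1) (Finset.Icc (a + 1) (a + (k + 1))) := fun β =>
    altSum_congr_left x β _ fun i hi _ => by
      rw [Finset.mem_Icc] at hi
      rw [hmem, or_iff_right (by omega)]
  have hcoeff : ∀ β, signedCoeff x a (k + 1) β = doubledCoeff x a (k + 1) β := fun β => by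
    rw [doubledCoeff, if_neg (by omega), one_mul]
  rw [hunion, hres, hres, hcoeff, hcoeff] at hsum
  have hform := altForm hx (by omega) hJ
  have hC := C_mul hx (tilde I)
  rw [hmT, hDT] at hC
  have hne : poch x (a / 2) * pochProd x J ≠ 0 := mul_ne_zero (poch_ne_zero hx _)
    (Finset.prod_ne_zero_iff.2 fun _ _ => poch_ne_zero hx _)
  rw [hsum, hmT]
  refine mul_right_cancel₀ hne ?_
  rcases Nat.even_or_odd' a with ⟨α, rfl | rfl⟩
  · have hf : f x (2 * α + k + 1) I = evenFactor x α (m J) (k + 1) := by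
      have hM : 2 * m J ≤ k + 1 := by
        rcases hform with ⟨h1, -⟩ | ⟨l, h1, h2, -⟩ | ⟨l, h1, h2, -⟩ <;> omega
      rw [f, evenFactor, hzero, Finset.card_range, hmI, show (2 * α + 1) / 2 = α by omega]
      by_cases hk : k + 1 = 2 * m J
      · rw [if_pos ⟨ha, even_two_mul α, by omega⟩, if_pos hk]
      · rw [if_neg fun h1 => hk (by omega), if_pos ⟨ha, even_two_mul α, by omega⟩, if_neg hk]
    have := expansion_even hx α (by omega) hform
    rw [show 2 * α / 2 = α by omega] at hC ⊢
    rw [hf, show 2 * ((2 * α + 2) / 2) = 2 * α + 2 by omega]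
    linear_combination this - 2 * evenFactor x α (m J) (k + 1) *
      signedProd x (2 * α + 2) (2 * α + k + 1) *
      signedProd x (2 * (α + m J) + 2) (2 * α + k + 1) * hC
  · have hf : f x (2 * α + 1 + k + 1) I = 1 := by
      have : ¬Even (2 * α + 1) := by simp
      rw [f, hzero, Finset.card_range, if_neg fun h1 => this h1.2.1, if_neg fun h1 => this h1.2.1]
    have := expansion_odd hx α (by omega) hform
    rw [show (2 * α + 1) / 2 = α by omega] at hC ⊢
    rw [hf, show 2 * ((2 * α + 1 + 2) / 2) = 2 * α + 2 by omega]
    linear_combination this - 2 * signedProd x (2 * α + 2) (2 * α + 1 + k + 1) *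
      signedProd x (2 * (α + m J) + 2) (2 * α + 1 + k + 1) * hC

end

/-- The closed product formula over a field of characteristic zero. -/
theorem sum_quotient_eq_prod {K : Type*} [Field K] [CharZero K] {x : K} (hx : ∀ k > 0, x ^ k ≠ 1)
    {n : ℕ} (hn : 2 ≤ n) {I : Finset ℕ} (hI : I ⊂ Finset.range n) :
    ∑ σ ∈ (finite_quotient n I).toFinset, (-1) ^ len n σ * x ^ oddLen n σ =
      f x n I * C x (tilde I) * signedProd x (2 * (((zeroComponent I).card + 2) / 2)) n *
        signedProd x (2 * m (tilde I) + 2) n := by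
  obtain ⟨a, han, h, haI⟩ := exists_first_gap hI
  refine mul_left_cancel₀ (two_ne_zero (α := K)) ?_
  rw [two_mul_sum_quotient x hn hI.subset, zeroComponent_eq_range h haI, Finset.card_range]
  rcases Nat.lt_or_ge a 2 with ha | ha
  · have hf : f x n I = 1 := by
      unfold f
      rw [zeroComponent_eq_range h haI, Finset.card_range, if_neg (by omega), if_neg (by omega)]
    have hlt : ∀ i ∈ I, i < n := fun i hi => Finset.mem_range.1 (hI.subset hi)
    rw [hf, one_mul, show 2 * ((a + 2) / 2) = 2 by omega, tilde, zeroComponent_eq_range h haI]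
    rcases Nat.eq_zero_or_pos a with rfl | ha0
    · rw [Finset.range_zero, if_pos rfl]
      exact signedSum_of_zero_notMem hx hn fun i hi =>
        ⟨Nat.pos_of_ne_zero fun h0 => haI (h0 ▸ hi), hlt i hi⟩
    · obtain rfl : a = 1 := by omega
      rw [if_neg (by simp), signedSum_swap_zero_one x hn (h 0 (by omega)) haI]
      refine signedSum_of_zero_notMem hx hn fun i hi => ?_
      rw [Finset.mem_union, Finset.mem_erase, Finset.mem_singleton] at hi
      rcases hi with hi | rfl
      · exact ⟨Nat.pos_of_ne_zero hi.1, hlt i hi.2⟩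
      · omega
  · exact signedSum_of_two_le hx ha han hI.subset h haI

end OddLengthD

theorem theorem5p1 (n : ℕ) (hn : 2 ≤ n) (I : Finset ℕ) (hI : I ⊂ Finset.range n) :
    algebraMap (Polynomial ℤ) (RatFunc ℤ) (OddLengthD.signTwistedGF n I) =
      OddLengthD.f RatFunc.X n I *
        OddLengthD.C RatFunc.X (OddLengthD.tilde I) *
        OddLengthD.signedProd RatFunc.X
          (2 * (((OddLengthD.zeroComponent I).card + 2) / 2)) n *
        OddLengthD.signedProd RatFunc.X (2 * OddLengthD.m (OddLengthD.tilde I) + 2) n := by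
  have hinj : Function.Injective (algebraMap (Polynomial ℤ) (RatFunc ℤ)) :=
    RatFunc.algebraMap_injective ℤ
  have : CharZero (RatFunc ℤ) := charZero_of_injective_algebraMap hinj
  have hx : ∀ k > 0, (RatFunc.X : RatFunc ℤ) ^ k ≠ 1 := by
    intro k hk h
    rw [← RatFunc.algebraMap_X, ← map_pow, ← map_one (algebraMap (Polynomial ℤ) (RatFunc ℤ))] at h
    have h1 := congrArg Polynomial.natDegree (hinj h)
    rw [Polynomial.natDegree_X_pow, Polynomial.natDegree_one] at h1
    omega
  rw [← OddLengthD.sum_quotient_eq_prod hx hn hI, OddLengthD.signTwistedGF, map_sum]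
  refine Finset.sum_congr rfl fun σ _ => ?_
  rw [map_mul, map_pow, map_pow, map_neg, map_one, RatFunc.algebraMap_X]
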